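/- Let $n\ge 2$ and $r\ge n+3$, let $C\subset\mathbb{P}^n$ be a rational normal curve of degree $n$ over $\mathbb{C}$, and let $p_1,\dots,p_r$ be distinct points of $C$. Let $X$ be the blow-up of $\mathbb{P}^n$ at $p_1,\dots,p_r$, let $E_1,\dots,E_r$ be the exceptional divisors, and let $H$ be the pull-back of the hyperplane class. Let $$\mathrm{Cox}(X)=\bigoplus_{(d,e)\in\mathbb{Z}\times\mathbb{Z}^r}\mathrm{H}^0\Bigl(X,\;dH+\sum_{i=1}^r e_iE_i\Bigr)$$ be the Cox ring of $X$ with respect to the basis $H,E_1,\dots,E_r$ of $\mathrm{Pic}(X)$. Consider the divisors $E_1,\dots,E_r$ and the divisors $$kH-k\sum_{i\in I}E_i-(k-1)\sum_{i\notin I}E_i$$ for all integers $k$ with $1\le k\le 1+n/2$ and all subsets $I\subset\{1,\dots,r\}$ with $|I|=n+2-2k$. Then each of these finitely many divisors $E$ satisfies $\dim_{\mathbb{C}}\mathrm{H}^0(X,E)=1$, and, for any choice of nonzero sections $x_E\in\mathrm{H}^0(X,E)$, the elements $x_E$ generate $\mathrm{Cox}(X)$ as a $\mathbb{C}$-algebra.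 In particular, $\mathrm{Cox}(X)$ is a finitely generated $\mathbb{C}$-algebra. -/

import Mathlib

open scoped DirectSum LinearAlgebra.Projectivization

noncomputable section

namespace BlowUpCox

/-! ### Regular functions -/

/-- Polynomial functions on a complex vector space: the algebra generated by the linear forms. -/
def polyFun (W : Type) [AddCommGroup W] [Module ℂ W] : Subalgebra ℂ (W → ℂ) :=
  Algebra.adjoin ℂ {f | ∃ φ : Module.Dual ℂ W, f = fun w => φ w}

/-- `g` is a regular function on the subvariety `S` of `W`: near every point of `S` it is a
quotient of two polynomial functions. (Only the values of `g` on `S` matter.) -/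
def IsRegularOn {W : Type} [AddCommGroup W] [Module ℂ W] (S : Set W) (g : W → ℂ) : Prop :=
  ∀ z ∈ S, ∃ P ∈ polyFun W, ∃ Q ∈ polyFun W,
    Q z ≠ 0 ∧ ∀ w ∈ S, Q w ≠ 0 → g w = P w / Q w

section Regular

variable {W : Type} [AddCommGroup W] [Module ℂ W] {S : Set W} {f g : W → ℂ}

theorem isRegularOn_const (c : ℂ) : IsRegularOn S (fun _ => c) := fun _ _ =>
  ⟨_, (polyFun W).algebraMap_mem c, 1, (polyFun W).one_mem, one_ne_zero, fun w _ _ => by simp⟩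

theorem IsRegularOn.add (hf : IsRegularOn S f) (hg : IsRegularOn S g) :
    IsRegularOn S (f + g) := by
  intro z hz
  obtain ⟨P, hP, Q, hQ, hQz, h⟩ := hf z hz
  obtain ⟨P', hP', Q', hQ', hQz', h'⟩ := hg z hz
  refine ⟨P * Q' + Q * P', add_mem (mul_mem hP hQ') (mul_mem hQ hP'), Q * Q', mul_mem hQ hQ',
    mul_ne_zero hQz hQz', fun w hw hne => ?_⟩
  have h1 : Q w ≠ 0 := left_ne_zero_of_mul hne
  have h2 : Q' w ≠ 0 := right_ne_zero_of_mul hne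
  simp only [Pi.add_apply, Pi.mul_apply, h w hw h1, h' w hw h2]
  exact div_add_div _ _ h1 h2

theorem IsRegularOn.mul (hf : IsRegularOn S f) (hg : IsRegularOn S g) :
    IsRegularOn S (f * g) := by
  intro z hz
  obtain ⟨P, hP, Q, hQ, hQz, h⟩ := hf z hz
  obtain ⟨P', hP', Q', hQ', hQz', h'⟩ := hg z hz
  refine ⟨P * P', mul_mem hP hP', Q * Q', mul_mem hQ hQ',
    mul_ne_zero hQz hQz', fun w hw hne => ?_⟩
  have h1 : Q w ≠ 0 := left_ne_zero_of_mul hne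
  have h2 : Q' w ≠ 0 := right_ne_zero_of_mul hne
  simp only [Pi.mul_apply, h w hw h1, h' w hw h2]
  exact div_mul_div_comm _ _ _ _

end Regular

/-! ### Projective space and rational normal curves -/

/-- The vector space `ℂ^(n+1)`; its projectivization is `ℙ^n`. -/
abbrev Vec (n : ℕ) : Type := Fin (n + 1) → ℂ

/-- The vector `(s^n, s^(n-1) t, …, t^n)`. -/
def veronese (n : ℕ) (s t : ℂ) : Vec n := fun j => s ^ (n - (j : ℕ)) * t ^ (j : ℕ)

/-- A rational normal curve of degree `n` in `ℙ^n`: the image of the standard curve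
`[s : t] ↦ [s^n : s^(n-1) t : … : t^n]` under a projective linear transformation. -/
def IsRationalNormalCurve {n : ℕ} (C : Set (ℙ ℂ (Vec n))) : Prop :=
  ∃ A : Vec n ≃ₗ[ℂ] Vec n, ∀ P : ℙ ℂ (Vec n), P ∈ C ↔
    ∃ s t : ℂ, (s ≠ 0 ∨ t ≠ 0) ∧ P.submodule = Submodule.span ℂ {A (veronese n s t)}

/-! ### The blow-up of projective space at points -/

variable {n r : ℕ}

/-- The projectivization of `ℂ^(n+1) / p i` is the `ℙ^(n-1)` of lines in `ℙ^n` through `p i`. -/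
abbrev Dir (p : Fin r → ℙ ℂ (Vec n)) (i : Fin r) : Type := Vec n ⧸ (p i).submodule

/-- The blow-up of `ℙ^n` at the points `p i`, as a subvariety of `ℙ^n × ∏ i, ℙ^(n-1)`:
the points `(x, ℓ)`, where `x` is a point of `ℙ^n` and `ℓ i` is a line through `p i` and `x`. -/
def BlowUp (p : Fin r → ℙ ℂ (Vec n)) : Set (ℙ ℂ (Vec n) × ∀ i, ℙ ℂ (Dir p i)) :=
  {ξ | ∀ i, ξ.1.submodule.map (p i).submodule.mkQ ≤ (ξ.2 i).submodule}

/-- The space of multihomogeneous coordinates on `ℙ^n × ∏ i, ℙ^(n-1)`. -/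
abbrev Ambient (p : Fin r → ℙ ℂ (Vec n)) : Type := Vec n × ∀ i, Dir p i

/-- The multicone over the blow-up: all multihomogeneous coordinate vectors of its points. -/
def cone (p : Fin r → ℙ ℂ (Vec n)) : Set (Ambient p) :=
  {z | ∃ (h : z.1 ≠ 0) (h' : ∀ i, z.2 i ≠ 0),
    (Projectivization.mk ℂ z.1 h, fun i => Projectivization.mk ℂ (z.2 i) (h' i)) ∈ BlowUp p}

/-- `t i` is the value at `z = (x, y)` in the multicone of the equation of the exceptional divisor
`E i`, the locus over `p i`: the linear forms on `ℂ^(n+1)` that vanish at `p i` are the `φ (x mod p i)`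
with `φ` a linear form on the quotient, and `φ (x mod p i) = t i * φ (y i)`, where some
`φ (y i)` is nonzero; so `t i` generates the pulled back ideal of `p i` locally. -/
def IsExcEq (p : Fin r → ℙ ℂ (Vec n)) (z : Ambient p) (t : Fin r → ℂ) : Prop :=
  ∀ i, (p i).submodule.mkQ z.1 = t i • z.2 i

/-- Coordinate vectors of the points of `ℙ^n` other than the `p i`, i.e. of the points of the
blow-up outside the exceptional divisors. -/
abbrev Off (p : Fin r → ℙ ℂ (Vec n)) : Type :=
  {x : Vec n // x ≠ 0 ∧ ∀ i, x ∉ (p i).submodule}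

/-- The divisors `d H + ∑ i, e i E i`, written as `(d, e)`. -/
abbrev Div (r : ℕ) : Type := ℤ × (Fin r → ℤ)

/-- The pull-back of the hyperplane class. -/
def H : Div r := (1, 0)

/-- The exceptional divisors. -/
def E (i : Fin r) : Div r := (0, Pi.single i 1)

/-- The space `H⁰(X, d H + ∑ i, e i E i)` on the blow-up `X` of `ℙ^n` at the `p i`. A section is a
section `F` of the pull-back of `𝒪(d)` over the complement of the exceptional divisors
(a homogeneous function of degree `d` there) such that the divisor `div F + ∑ i, e i E i` is effective
on `X`: the product of `F` and of the equation of `∑ i, e i E i` extends to a regular function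
on the whole multicone over `X`. -/
def H0 (p : Fin r → ℙ ℂ (Vec n)) (D : Div r) : Submodule ℂ (Off p → ℂ) where
  carrier := {F |
    (∀ (c : ℂ) (x x' : Off p), c ≠ 0 → x'.1 = c • x.1 → F x' = c ^ D.1 * F x) ∧
    ∃ g : Ambient p → ℂ, IsRegularOn (cone p) g ∧
      ∀ z ∈ cone p, ∀ t, IsExcEq p z t → ∀ x : Off p, z.1 = x.1 →
        g z = F x * ∏ i, t i ^ D.2 i}
  zero_mem' := ⟨fun _ _ _ _ _ => by simp, fun _ => 0, isRegularOn_const 0,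
    fun _ _ _ _ _ _ => by simp⟩
  add_mem' := by
    rintro F F' ⟨hF, g, hg, h⟩ ⟨hF', g', hg', h'⟩
    refine ⟨fun c x x' hc hx => ?_, g + g', hg.add hg', fun z hz t ht x hx => ?_⟩
    · simp only [Pi.add_apply, hF c x x' hc hx, hF' c x x' hc hx]; ring
    · simp only [Pi.add_apply, h z hz t ht x hx, h' z hz t ht x hx]; ring
  smul_mem' := by
    rintro a F ⟨hF, g, hg, h⟩
    refine ⟨fun c x x' hc hx => ?_, (fun _ => a) * g, (isRegularOn_const a).mul hg,
      fun z hz t ht x hx => ?_⟩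
    · simp only [Pi.smul_apply, smul_eq_mul, hF c x x' hc hx]; ring
    · simp only [Pi.smul_apply, smul_eq_mul, Pi.mul_apply, h z hz t ht x hx]; ring

theorem exc_ne_zero {p : Fin r → ℙ ℂ (Vec n)} {z : Ambient p} {t : Fin r → ℂ}
    (ht : IsExcEq p z t) (x : Off p) (hx : z.1 = x.1) (i : Fin r) : t i ≠ 0 := by
  intro h0
  have h := ht i
  rw [h0, zero_smul, hx, Submodule.mkQ_apply, Submodule.Quotient.mk_eq_zero] at h
  exact x.2.2 i h

instance (p : Fin r → ℙ ℂ (Vec n)) : SetLike.GradedMonoid (H0 p) where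
  one_mem := ⟨fun c _ _ _ _ => by simp, fun _ => 1, isRegularOn_const 1,
    fun _ _ _ _ _ _ => by simp⟩
  mul_mem := by
    rintro D D' F F' ⟨hF, g, hg, h⟩ ⟨hF', g', hg', h'⟩
    refine ⟨fun c x x' hc hx => ?_, g * g', hg.mul hg', fun z hz t ht x hx => ?_⟩
    · simp only [Pi.mul_apply, hF c x x' hc hx, hF' c x x' hc hx, Prod.fst_add, zpow_add₀ hc]
      ring
    · have hpr : ∏ i, t i ^ (D + D').2 i = (∏ i, t i ^ D.2 i) * ∏ i, t i ^ D'.2 i := by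
        rw [← Finset.prod_mul_distrib]
        exact Finset.prod_congr rfl fun i _ => zpow_add₀ (exc_ne_zero ht x hx i) _ _
      simp only [Pi.mul_apply, h z hz t ht x hx, h' z hz t ht x hx, hpr]
      ring

/-- The Cox ring of the blow-up of `ℙ^n` at the points `p i`, with respect to the basis
`H, E 1, …, E r` of its Picard group. -/
abbrev Cox (p : Fin r → ℙ ℂ (Vec n)) : Type := ⨁ D : Div r, H0 p D

/-- The divisor `k H - k ∑_{i ∈ I} E i - (k - 1) ∑_{i ∉ I} E i`. -/
def minimalDivisor (k : ℕ) (I : Finset (Fin r)) : Div r :=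
  (k : ℤ) • H - (k : ℤ) • ∑ i ∈ I, E i - ((k : ℤ) - 1) • ∑ i ∈ Iᶜ, E i

/-- The exceptional divisors and the minimal divisors with `|I| = n + 2 - 2k`,
`1 ≤ k ≤ 1 + n/2`. -/
def generatorDivisors (n r : ℕ) : Set (Div r) :=
  {D | (∃ i, D = E i) ∨ ∃ (k : ℕ) (I : Finset (Fin r)),
    1 ≤ k ∧ 2 * k ≤ n + 2 ∧ I.card = n + 2 - 2 * k ∧ D = minimalDivisor k I}

end BlowUpCox

end

/-! A section of `dH + ∑ e_i E_i` is a form of degree `d` with multiplicity at least `-e_i` at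
`p_i`. Put the curve in the form `y ↦ (1, y, …, y^n)`, read the coordinates as moments and set `q =
n + 2`. Multiplicity at a point then becomes a bound on the degree in the direction of that point:
at most `b_i = d + e_i` along `p_i`. If `|I| + 2k = q`, the Hankel determinant of size `k` of the
moments with weight `∏_{c ∈ I} (X - c)` has degree at most one along every point of the curve and
degree zero along the roots, so it is a section of a minimal divisor. The core is
`mem_span_cfgProd`: all forms with prescribed bounds are combinations of products of Hankel
determinants.

Impose in addition degree at most `N` along all points of the curve (`adm`), and compare `qN` with
`2d + ∑ (N - b_l)⁺`. If `qN` is smaller, then `N` can be lowered (`dop_pow_eq_zero_of_lt`): the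
`N`-th derivative along the generic point `Y` of the curve has degree at most `(q - 2)N` in `Y`,
vanishes to order `N - b_l` at each `l`, and gains a double zero at `x` with each further derivative
along `x`; these are too many zeros.

Otherwise products of `N` Hankel determinants span (`adm_le_cfgSpan`). At a fresh point `c`, the
`N`-th derivative of `F` is pulled back under projection from the tangent line at `c`, where `q`
drops by two and induction applies. Raising all sizes by one lifts the resulting products to some
`G` with the same `N`-th derivative, so `F - G` has smaller degree along `c`, at the cost of one
unit of slack. Once the slack is used up, `N` drops, and an exchange of roots
(`cfgProd_mem_span_tight`) makes room for a trivial `N`-th factor. Roots can be exchanged because a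
Hankel determinant of size `k` is a polynomial of degree at most `k` in each root
(`hankel_mem_span`).

The passage between forms and sections is `exists_polynomial_of_mem_H0` (a Hartogs argument),
`dop_pow_eq_zero_of_mem_H0` and `sec_mem_H0`. A count of incidences using `r ≥ n + 3` shows that the
generators are unique up to scalars; excess in the multiplicities is absorbed by the `E_i`. -/

noncomputable section

namespace BlowUpCox

open MvPolynomial

/-! ### Constant-coefficient derivations of the polynomial ring in the moments -/

section Derivations

variable {K L : Type*} [CommRing K] [CommRing L]

/-- The derivation of the polynomial ring in the moments `z 0, z 1, …` with `z i ↦ a i`. -/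
def mder (a : ℕ → K) : Derivation K (MvPolynomial ℕ K) (MvPolynomial ℕ K) :=
  mkDerivation K fun i => C (a i)

/-- The derivation `mder a` as a linear endomorphism. -/
def dop (a : ℕ → K) : Module.End K (MvPolynomial ℕ K) := (mder a).toLinearMap

/-- The moments of the unit mass at `y`. -/
def pt (y : K) : ℕ → K := fun i => y ^ i

theorem dop_apply (a : ℕ → K) (F : MvPolynomial ℕ K) : dop a F = mder a F := rfl

@[simp] theorem dop_X (a : ℕ → K) (i : ℕ) : dop a (X i) = C (a i) := by
  simp [dop_apply, mder]

@[simp] theorem dop_C (a : ℕ → K) (c : K) : dop a (C c) = 0 := by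
  simp [dop_apply]

theorem dop_mul (a : ℕ → K) (F G : MvPolynomial ℕ K) :
    dop a (F * G) = F * dop a G + dop a F * G := by
  rw [dop_apply, Derivation.leibniz]; simp [dop_apply, mul_comm]

theorem dop_commute (a b : ℕ → K) : Commute (dop a) (dop b) := by
  have h : ⁅mder a, mder b⁆ = 0 := derivation_ext fun i => by
    rw [Derivation.commutator_apply]; simp [mder]
  refine LinearMap.ext fun F => ?_
  have := DFunLike.congr_fun h F
  rw [Derivation.commutator_apply] at this
  exact sub_eq_zero.1 this

theorem dop_add (a b : ℕ → K) : dop (fun i => a i + b i) = dop a + dop b := by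
  have h : mder (fun i => a i + b i) = mder a + mder b := derivation_ext fun i => by
    simp [mder]
  refine LinearMap.ext fun F => DFunLike.congr_fun h F

theorem dop_smul (w : K) (a : ℕ → K) : dop (fun i => w * a i) = w • dop a := by
  have h : mder (fun i => w * a i) = w • mder a := derivation_ext fun i => by
    simp [mder, MvPolynomial.smul_eq_C_mul]
  refine LinearMap.ext fun F => DFunLike.congr_fun h F

theorem map_dop (φ : K →+* L) (a : ℕ → K) (F : MvPolynomial ℕ K) :
    map φ (dop a F) = dop (fun i => φ (a i)) (map φ F) := by
  induction F using MvPolynomial.induction_on with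
  | C c => simp
  | add p q hp hq => simp [hp, hq]
  | mul_X p i hp => simp [dop_mul, hp]

theorem map_dop_pow (φ : K →+* L) (a : ℕ → K) (j : ℕ) (F : MvPolynomial ℕ K) :
    map φ ((dop a ^ j) F) = (dop (fun i => φ (a i)) ^ j) (map φ F) := by
  induction j with
  | zero => simp
  | succ j ih => rw [pow_succ', pow_succ', Module.End.mul_apply, Module.End.mul_apply, map_dop, ih]

theorem dop_supported (a : ℕ → K) {s : Set ℕ} {F : MvPolynomial ℕ K} (hF : F ∈ supported K s) :
    dop a F ∈ supported K s := by
  rw [supported_eq_adjoin_X] at *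
  induction hF using Algebra.adjoin_induction with
  | mem x hx =>
    obtain ⟨i, _, rfl⟩ := hx
    rw [dop_X]; exact Subalgebra.algebraMap_mem _ _
  | algebraMap r => rw [MvPolynomial.algebraMap_eq, dop_C]; exact zero_mem _
  | add x y _ _ hx hy => rw [map_add]; exact add_mem hx hy
  | mul x y hx' hy' hx hy => rw [dop_mul]; exact add_mem (mul_mem hx' hy) (mul_mem hx hy')

theorem dop_pow_supported (a : ℕ → K) {s : Set ℕ} {F : MvPolynomial ℕ K}
    (hF : F ∈ supported K s) (j : ℕ) : (dop a ^ j) F ∈ supported K s := by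
  induction j with
  | zero => simpa
  | succ j ih => rw [pow_succ', Module.End.mul_apply]; exact dop_supported a ih

theorem dop_eq_sum (a : ℕ → K) {s : Finset ℕ} {F : MvPolynomial ℕ K} (hs : F.vars ⊆ s) :
    dop a F = ∑ i ∈ s, C (a i) * pderiv i F := by
  classical
  have hsum : ∀ G, (∑ i ∈ s, a i • pderiv i :
      Derivation K (MvPolynomial ℕ K) (MvPolynomial ℕ K)) G = ∑ i ∈ s, C (a i) * pderiv i G := by
    intro G
    have := congrFun (map_sum (Derivation.coeFnAddMonoidHom (R := K) (A := MvPolynomial ℕ K)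
      (M := MvPolynomial ℕ K)) (fun i => a i • pderiv i) s) G
    rw [Finset.sum_apply] at this
    refine this.trans (Finset.sum_congr rfl fun i _ => ?_)
    simp [Derivation.coeFnAddMonoidHom, MvPolynomial.smul_eq_C_mul]
  rw [dop_apply, ← hsum]
  refine derivation_eq_of_forall_mem_vars fun i hi => ?_
  rw [hsum, Finset.sum_eq_single i]
  · simp [mder]
  · intro j _ hj; simp [pderiv_X_of_ne hj.symm]
  · intro hi'; exact absurd (hs hi) hi'

theorem coeff_dop (a : ℕ → K) {s : Finset ℕ} {F : MvPolynomial ℕ K} (hs : F.vars ⊆ s)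
    (m : ℕ →₀ ℕ) : coeff m (dop a F) =
      ∑ i ∈ s, a i * (coeff (m + Finsupp.single i 1) F * (m i + 1)) := by
  rw [dop_eq_sum a hs, coeff_sum]
  simp [coeff_pderiv]

theorem isHomogeneous_dop (a : ℕ → K) {F : MvPolynomial ℕ K} {d : ℕ}
    (hF : F.IsHomogeneous (d + 1)) : (dop a F).IsHomogeneous d := by
  intro m hm
  rw [coeff_dop a subset_rfl] at hm
  obtain ⟨i, -, hi⟩ := Finset.exists_ne_zero_of_sum_ne_zero hm
  have := hF (left_ne_zero_of_mul (right_ne_zero_of_mul hi))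
  simpa [Finsupp.weight_apply, Finsupp.sum_add_index'] using this

theorem dop_eq_zero_of_isHomogeneous_zero (a : ℕ → K) {F : MvPolynomial ℕ K}
    (hF : F.IsHomogeneous 0) : dop a F = 0 := by
  rw [totalDegree_eq_zero_iff_eq_C.1 ((totalDegree_zero_iff_isHomogeneous ℕ).2 hF), dop_C]

theorem isHomogeneous_dop_pow (a : ℕ → K) {F : MvPolynomial ℕ K} {d j : ℕ}
    (hF : F.IsHomogeneous (d + j)) : ((dop a ^ j) F).IsHomogeneous d := by
  induction j generalizing d with
  | zero => simpa using hF
  | succ j ih =>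
    rw [pow_succ', Module.End.mul_apply]
    exact isHomogeneous_dop a (ih (by convert hF using 1; ring))

theorem dop_pow_eq_zero (a : ℕ → K) {F : MvPolynomial ℕ K} {d j : ℕ}
    (hF : F.IsHomogeneous d) (hj : d < j) : (dop a ^ j) F = 0 := by
  obtain ⟨t, rfl⟩ := Nat.exists_eq_add_of_lt hj
  rw [show d + t + 1 = t + (1 + d) by ring, pow_add, pow_add, Module.End.mul_apply,
    Module.End.mul_apply, pow_one, dop_eq_zero_of_isHomogeneous_zero a
      (isHomogeneous_dop_pow a (by simpa using hF)), map_zero]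

/-- The coefficients of `dop (pt x) F` are polynomials in `x` whose coefficients are nonzero integer
multiples of those of `F`, so infinitely many zeros kill them all. In other words, the points of the
curve span. -/
theorem eq_zero_of_dop_pt [IsDomain K] [CharZero K] {S : Set K} (hS : S.Infinite)
    {F : MvPolynomial ℕ K} {d : ℕ} (hF : F.IsHomogeneous (d + 1))
    (h : ∀ x ∈ S, dop (pt x) F = 0) : F = 0 := by
  have key : ∀ m i, coeff (m + Finsupp.single i 1) F = 0 := by
    intro m i
    by_cases hi : i ∈ F.vars
    · have hp : (∑ i ∈ F.vars, Polynomial.C (coeff (m + Finsupp.single i 1) F * (m i + 1)) *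
          Polynomial.X ^ i : Polynomial K) = 0 := by
        refine Polynomial.eq_zero_of_infinite_isRoot _ (hS.mono fun x hx => ?_)
        have := congrArg (coeff m) (h x hx)
        rw [coeff_dop _ subset_rfl, coeff_zero] at this
        simp only [Set.mem_ofPred_eq, Polynomial.IsRoot.def, Polynomial.eval_finsetSum]
        rw [← this]
        exact Finset.sum_congr rfl fun j _ => by simp [pt]; ring
      have := congrArg (fun p => Polynomial.coeff p i) hp
      simp only [Polynomial.finsetSum_coeff, Polynomial.coeff_C_mul_X_pow, Polynomial.coeff_zero,
        Finset.sum_ite_eq, hi, if_true] at this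
      exact (mul_eq_zero.1 this).resolve_right (Nat.cast_add_one_ne_zero _)
    · by_contra hne
      exact hi ((mem_vars_iff_mem_support i).2 ⟨_, mem_support_iff.2 hne, by simp⟩)
  ext m
  rw [coeff_zero]
  by_contra hne
  have hm := hF hne
  have : m ≠ 0 := by rintro rfl; simp at hm
  obtain ⟨i, hi⟩ := Finsupp.ne_iff.1 this
  refine hne ?_
  rw [← key (m - Finsupp.single i 1) i, tsub_add_cancel_of_le]
  exact Finsupp.single_le_iff.2 (Nat.one_le_iff_ne_zero.2 hi)

end Derivations

/-! ### Derivations along a moving point of the curve -/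

section Moving

open Polynomial (evalRingHom)

/-- Extension of scalars from `ℂ` to `ℂ[Y]`. -/
def cst (F : MvPolynomial ℕ ℂ) : MvPolynomial ℕ (Polynomial ℂ) := map Polynomial.C F

/-- The derivation along the generic point of the curve. -/
def genDop : Module.End (Polynomial ℂ) (MvPolynomial ℕ (Polynomial ℂ)) := dop (pt Polynomial.X)

/-- The divided difference of the derivations along the generic point and along `x`. -/
def diffDop (x : ℂ) : Module.End (Polynomial ℂ) (MvPolynomial ℕ (Polynomial ℂ)) :=
  dop fun i => ∑ j ∈ Finset.range i, Polynomial.X ^ j * Polynomial.C x ^ (i - 1 - j)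

/-- The derivation along the tangent vector of the curve at `x`. -/
def tanDop (x : ℂ) : Module.End ℂ (MvPolynomial ℕ ℂ) := dop fun i => i * x ^ (i - 1)

theorem cst_dop_pow (x : ℂ) (j : ℕ) (F : MvPolynomial ℕ ℂ) :
    cst ((dop (pt x) ^ j) F) = (dop (pt (Polynomial.C x)) ^ j) (cst F) := by
  rw [cst, map_dop_pow]
  simp only [cst, pt, map_pow]
  rfl

theorem map_eval_cst (y : ℂ) (F : MvPolynomial ℕ ℂ) : map (evalRingHom y) (cst F) = F := by
  rw [cst, map_map]
  convert map_id F
  ext; simp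

theorem map_eval_genDop_pow (y : ℂ) (j : ℕ) (F : MvPolynomial ℕ ℂ) :
    map (evalRingHom y) ((genDop ^ j) (cst F)) = (dop (pt y) ^ j) F := by
  rw [genDop, map_dop_pow, map_eval_cst]
  simp only [pt, map_pow, Polynomial.coe_evalRingHom, Polynomial.eval_X]
  rfl

theorem eq_zero_of_map_eval {G : MvPolynomial ℕ (Polynomial ℂ)} {S : Set ℂ} (hS : S.Infinite)
    (h : ∀ y ∈ S, map (evalRingHom y) G = 0) : G = 0 := by
  ext1 m
  refine Polynomial.eq_zero_of_infinite_isRoot _ (hS.mono fun y hy => ?_)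
  simpa [coeff_map] using congrArg (coeff m) (h y hy)

theorem genDop_pow_eq_zero {F : MvPolynomial ℕ ℂ} {j : ℕ} {S : Set ℂ} (hS : S.Infinite)
    (h : ∀ y ∈ S, (dop (pt y) ^ j) F = 0) : (genDop ^ j) (cst F) = 0 :=
  eq_zero_of_map_eval hS fun y hy => by rw [map_eval_genDop_pow, h y hy]

/-- The condition passes from infinitely many points to the generic point, and from there
specializes to every point. -/
theorem dop_pow_eq_zero_of_infinite {F : MvPolynomial ℕ ℂ} {j : ℕ} {S : Set ℂ} (hS : S.Infinite)
    (h : ∀ y ∈ S, (dop (pt y) ^ j) F = 0) (y : ℂ) : (dop (pt y) ^ j) F = 0 := by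
  rw [← map_eval_genDop_pow, genDop_pow_eq_zero hS h, map_zero]

theorem genDop_eq (x : ℂ) : genDop =
    dop (pt (Polynomial.C x)) + (Polynomial.X - Polynomial.C x) • diffDop x := by
  rw [genDop, diffDop, ← dop_smul, ← dop_add]
  congr 1
  funext i
  rw [mul_comm, geom_sum₂_mul]
  simp [pt]

theorem dop_pt_C_eq (x : ℂ) : dop (pt (Polynomial.C x)) =
    genDop - (Polynomial.X - Polynomial.C x) • diffDop x := by
  refine LinearMap.ext fun F => ?_
  rw [genDop_eq x, LinearMap.sub_apply, LinearMap.add_apply, add_sub_cancel_right]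

/-- Binomial expansion modulo `t ^ 2`. With `t = Y - x` it is the source of the double zeros. -/
theorem exists_sub_smul_pow_eq {R A : Type*} [CommRing R] [Ring A] [Algebra R A] {a b : A}
    (h : Commute a b) (t : R) (n : ℕ) : ∃ z : A,
      (a - t • b) ^ (n + 1) = a ^ (n + 1) - ((n + 1 : R) * t) • (a ^ n * b) + t ^ 2 • z := by
  induction n with
  | zero => exact ⟨0, by simp⟩
  | succ n ih =>
    obtain ⟨z, hz⟩ := ih
    refine ⟨a * z + ((n : R) + 1) • (a ^ n * b * b) - t • (b * z), ?_⟩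
    have hb : b * a ^ (n + 1) = a ^ (n + 1) * b := ((h.pow_left (n + 1)).eq).symm
    have hb' : b * (a ^ n * b) = a ^ n * b * b := by
      rw [← mul_assoc, ((h.pow_left n).eq).symm]
    have ha : a * (a ^ n * b) = a ^ (n + 1) * b := by rw [← mul_assoc, ← pow_succ']
    have ha' : a * a ^ (n + 1) = a ^ (n + 2) := (pow_succ' a (n + 1)).symm
    rw [pow_succ' (a - t • b), hz]
    simp only [sub_mul, mul_add, mul_sub, smul_mul_assoc, mul_smul_comm, hb, hb', ha, ha']
    push_cast
    module

theorem X_sub_C_smul_injective (x : ℂ) : Function.Injective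
    fun G : MvPolynomial ℕ (Polynomial ℂ) => (Polynomial.X - Polynomial.C x) • G := by
  intro G G' h
  simp only [MvPolynomial.smul_eq_C_mul] at h
  refine mul_left_cancel₀ ?_ h
  exact (map_ne_zero_iff _ (C_injective _ _)).2 (Polynomial.X_sub_C_ne_zero x)

/-- If `F` has degree at most `N` along all points of the curve, then the derivative of order `N`
along the generic point, followed by the divided difference at `x`, vanishes at `x`. -/
theorem exists_genDop_pow_diffDop {F : MvPolynomial ℕ ℂ} {N : ℕ}
    (h : ∀ y, (dop (pt y) ^ (N + 1)) F = 0) (x : ℂ) :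
    ∃ G, (genDop ^ N) (diffDop x (cst F)) = (Polynomial.X - Polynomial.C x) • G := by
  have hc : Commute genDop (diffDop x) := dop_commute _ _
  obtain ⟨z, hz⟩ := exists_sub_smul_pow_eq
    (A := Module.End (Polynomial ℂ) (MvPolynomial ℕ (Polynomial ℂ))) hc
    (Polynomial.X - Polynomial.C x) N
  rw [← dop_pt_C_eq] at hz
  -- Both `(N + 1)`-st powers kill `F`, so the linear term of the expansion is divisible by `(Y - x)
  -- ^ 2`; one factor cancels and `N + 1` is invertible.
  have h1 := LinearMap.congr_fun hz (cst F)
  rw [← cst_dop_pow, h x] at h1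
  have h2 : (genDop ^ (N + 1)) (cst F) = 0 :=
    genDop_pow_eq_zero Set.infinite_univ fun y _ => h y
  simp only [cst, map_zero, LinearMap.add_apply, LinearMap.sub_apply, LinearMap.smul_apply,
    Module.End.mul_apply] at h1 h2 ⊢
  rw [h2, zero_sub, eq_comm, neg_add_eq_zero] at h1
  have h3 : ((N : Polynomial ℂ) + 1) • (genDop ^ N) (diffDop x (map Polynomial.C F)) =
      (Polynomial.X - Polynomial.C x) • z (map Polynomial.C F) := by
    apply X_sub_C_smul_injective x
    simp only [smul_smul]
    rw [mul_comm, h1, pow_two]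
  refine ⟨Polynomial.C ((N : ℂ) + 1)⁻¹ • z (map Polynomial.C F), ?_⟩
  rw [smul_comm, ← h3, smul_smul]
  have : Polynomial.C ((N : ℂ) + 1)⁻¹ * ((N : Polynomial ℂ) + 1) = 1 := by
    rw [← Polynomial.C_eq_natCast, ← Polynomial.C_1, ← Polynomial.C_add, ← Polynomial.C_mul,
      inv_mul_cancel₀ (Nat.cast_add_one_ne_zero N)]
  rw [this, one_smul]

/-- At `Y = x` the divided difference becomes the tangent derivation, and the divisibility of
`exists_genDop_pow_diffDop` becomes vanishing. This is what makes the `N`-th derivative descend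
along the projection from the tangent line. -/
theorem dop_pow_tanDop {F : MvPolynomial ℕ ℂ} {N : ℕ}
    (h : ∀ y, (dop (pt y) ^ (N + 1)) F = 0) (x : ℂ) : tanDop x ((dop (pt x) ^ N) F) = 0 := by
  obtain ⟨G, hG⟩ := exists_genDop_pow_diffDop h x
  have hc : Commute (genDop ^ N) (diffDop x) := (dop_commute _ _).pow_left N
  have h1 := congrArg (map (evalRingHom x)) hG
  rw [← Module.End.mul_apply, hc.eq, Module.End.mul_apply, diffDop, map_dop, map_eval_genDop_pow,
    MvPolynomial.smul_eq_C_mul, map_mul, map_C] at h1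
  simp only [Polynomial.coe_evalRingHom, Polynomial.eval_sub, Polynomial.eval_X,
    Polynomial.eval_C, sub_self, map_zero, zero_mul, Polynomial.eval_finsetSum,
    Polynomial.eval_mul, Polynomial.eval_pow] at h1
  rw [tanDop]
  convert h1 using 3
  funext i
  rw [Finset.sum_congr rfl fun j hj => by
    rw [← pow_add, show j + (i - 1 - j) = i - 1 by have := Finset.mem_range.1 hj; omega]]
  simp

/-- As `genDop ^ (N + 1)` kills `F`, the derivation along `x` may be replaced by `-(Y - x)` times
the divided difference; the second factor `Y - x` comes from `exists_genDop_pow_diffDop`. -/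
theorem dvd_genDop_pow_dop {F : MvPolynomial ℕ ℂ} {N : ℕ}
    (h : ∀ y, (dop (pt y) ^ (N + 1)) F = 0) (x : ℂ) :
    C ((Polynomial.X - Polynomial.C x) ^ 2) ∣ (genDop ^ N) (cst (dop (pt x) F)) := by
  obtain ⟨G, hG⟩ := exists_genDop_pow_diffDop h x
  have h2 : (genDop ^ (N + 1)) (cst F) = 0 :=
    genDop_pow_eq_zero Set.infinite_univ fun y _ => h y
  have h3 := cst_dop_pow x 1 F
  rw [pow_one, pow_one] at h3
  rw [h3, dop_pt_C_eq, LinearMap.sub_apply, map_sub, ← Module.End.mul_apply, ← pow_succ, h2,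
    LinearMap.smul_apply, map_smul, hG]
  rw [smul_smul, MvPolynomial.smul_eq_C_mul, zero_sub, ← pow_two]
  exact (dvd_neg (α := MvPolynomial ℕ (Polynomial ℂ))).2 (Dvd.intro _ rfl)

/-- Expand `genDop ^ N` binomially in the derivation along `x` and `(Y - x)` times the divided
difference: terms with more than `b` derivatives along `x` vanish, and the others contain `Y - x` at
least `N - b` times. -/
theorem dvd_genDop_pow {F : MvPolynomial ℕ ℂ} {x : ℂ} {b : ℕ}
    (h : (dop (pt x) ^ (b + 1)) F = 0) (N : ℕ) :
    C ((Polynomial.X - Polynomial.C x) ^ (N - b)) ∣ (genDop ^ N) (cst F) := by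
  have hc : Commute (dop (pt (Polynomial.C x)))
      ((Polynomial.X - Polynomial.C x) • diffDop x) := (dop_commute _ _).smul_right _
  rw [genDop_eq x, hc.add_pow, LinearMap.sum_apply]
  refine Finset.dvd_sum fun m hm => ?_
  rw [(hc.pow_pow _ _).eq, ← nsmul_eq_mul', LinearMap.smul_apply, Module.End.mul_apply,
    ← cst_dop_pow]
  by_cases hmb : b + 1 ≤ m
  · obtain ⟨t, rfl⟩ := Nat.exists_eq_add_of_le' hmb
    rw [pow_add, Module.End.mul_apply, h]
    simp [cst]
  · rw [smul_pow, LinearMap.smul_apply, MvPolynomial.smul_eq_C_mul, nsmul_eq_mul]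
    refine Dvd.dvd.mul_left (Dvd.dvd.mul_right ?_ _) _
    exact map_dvd _ (pow_dvd_pow _ (by omega))

theorem natDegree_coeff_genDop_pow {F : MvPolynomial ℕ ℂ} {q : ℕ}
    (hF : F ∈ supported ℂ {i | i + 2 ≤ q}) (N : ℕ) (m : ℕ →₀ ℕ) :
    (coeff m ((genDop ^ N) (cst F))).natDegree ≤ (q - 2) * N := by
  have hs : cst F ∈ supported (Polynomial ℂ) {i | i + 2 ≤ q} := by
    rw [mem_supported] at hF ⊢
    exact (Finset.coe_subset.2 (vars_map _ _)).trans hF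
  induction N generalizing m with
  | zero => simp [cst, coeff_map]
  | succ N ih =>
    rw [pow_succ', Module.End.mul_apply, genDop, coeff_dop _ subset_rfl]
    refine Polynomial.natDegree_sum_le_of_forall_le _ _ fun i hi => ?_
    have hi' : i + 2 ≤ q := mem_supported.1 (dop_pow_supported (pt Polynomial.X) hs N) hi
    refine Polynomial.natDegree_mul_le.trans ?_
    have h1 : (pt Polynomial.X i : Polynomial ℂ).natDegree ≤ q - 2 := by
      simp only [pt, Polynomial.natDegree_X_pow]; omega
    have h2 : (coeff (m + Finsupp.single i 1) ((dop (pt Polynomial.X) ^ N) (cst F)) *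
        ((m i : Polynomial ℂ) + 1)).natDegree ≤ (q - 2) * N := by
      refine Polynomial.natDegree_mul_le.trans ?_
      have h3 : ((m i : Polynomial ℂ) + 1).natDegree = 0 := by
        exact_mod_cast Polynomial.natDegree_natCast (m i + 1)
      rw [h3, add_zero]
      exact ih _
    exact (Nat.add_le_add h1 h2).trans (le_of_eq (by ring))

/-- A count of zeros in `Y`, by induction on the degree `e` left after `N` derivatives. A derivative
along `x` with `w(x) ≠ 0` enlarges `w` by `(Y - x) ^ 2`, and vanishing of these derivatives suffices
by `eq_zero_of_dop_pt`. For `e = 0` the coefficients have degree at most `(q - 2) N`, less than the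
degree of their divisor `w`. -/
theorem genDop_pow_eq_zero_of_dvd {q N e : ℕ} {F : MvPolynomial ℕ ℂ} {w : Polynomial ℂ}
    (hF : F.IsHomogeneous (e + N)) (hs : F ∈ supported ℂ {i | i + 2 ≤ q})
    (h : ∀ y, (dop (pt y) ^ (N + 1)) F = 0) (hw : w ≠ 0) (hdvd : C w ∣ (genDop ^ N) (cst F))
    (hdeg : (q - 2) * N < w.natDegree + 2 * e) : (genDop ^ N) (cst F) = 0 := by
  induction e generalizing F w with
  | zero =>
    have h0 : ((genDop ^ N) (cst F)).IsHomogeneous 0 :=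
      isHomogeneous_dop_pow _ (hF.map _)
    ext1 m
    refine Polynomial.eq_zero_of_dvd_of_natDegree_lt ((C_dvd_iff_dvd_coeff _ _).1 hdvd m) ?_
    exact (natDegree_coeff_genDop_pow hs N m).trans_lt (by simpa using hdeg)
  | succ e ih =>
    have hinf : (Polynomial.C '' {x : ℂ | w.eval x ≠ 0}).Infinite := by
      refine Set.Infinite.image (Polynomial.C_injective.injOn) ?_
      exact (Polynomial.finite_setOfPred_isRoot hw).infinite_compl
    refine eq_zero_of_dop_pt (d := e) hinf (isHomogeneous_dop_pow _ ?_) ?_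
    · exact hF.map _
    · rintro _ ⟨x, hx, rfl⟩
      have hcomm : dop (pt (Polynomial.C x)) ((genDop ^ N) (cst F)) =
          (genDop ^ N) (cst (dop (pt x) F)) := by
        have h3 := cst_dop_pow x 1 F
        rw [pow_one, pow_one] at h3
        have hc : Commute (dop (pt (Polynomial.C x))) genDop := dop_commute _ _
        rw [h3, ← Module.End.mul_apply, ← Module.End.mul_apply, (hc.pow_right N).eq]
      rw [hcomm]
      refine ih (w := w * (Polynomial.X - Polynomial.C x) ^ 2)
        (isHomogeneous_dop _ (by rwa [show e + 1 + N = e + N + 1 by ring] at hF)) (dop_supported _ hs) ?_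
        (mul_ne_zero hw (pow_ne_zero _ (Polynomial.X_sub_C_ne_zero x))) ?_ ?_
      · intro y
        rw [← Module.End.mul_apply, ← ((dop_commute (pt x) (pt y)).pow_right (N + 1)).eq,
          Module.End.mul_apply, h y, map_zero]
      · rw [C_mul]
        refine IsCoprime.mul_dvd ?_ ?_ (dvd_genDop_pow_dop h x)
        · refine IsCoprime.map (f := (C : Polynomial ℂ →+* MvPolynomial ℕ (Polynomial ℂ))) ?_
          refine IsCoprime.pow_right ?_
          exact ((Polynomial.irreducible_X_sub_C x).coprime_iff_not_dvd.2
            (fun hd => hx (Polynomial.dvd_iff_isRoot.1 hd))).symm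
        · rw [← hcomm]
          obtain ⟨G, hG⟩ := hdvd
          rw [hG, ← MvPolynomial.smul_eq_C_mul, map_smul, MvPolynomial.smul_eq_C_mul]
          exact dvd_mul_right _ _
      · rw [Polynomial.natDegree_mul hw (pow_ne_zero _ (Polynomial.X_sub_C_ne_zero x)),
          Polynomial.natDegree_pow, Polynomial.natDegree_X_sub_C]
        omega

/-- A form whose multiplicities at points of the curve are too large has larger multiplicity along
the curve. -/
theorem dop_pow_eq_zero_of_lt {q N d : ℕ} {Λ : Finset ℂ} {b : ℂ → ℕ} {F : MvPolynomial ℕ ℂ}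
    (hF : F.IsHomogeneous d) (hs : F ∈ supported ℂ {i | i + 2 ≤ q})
    (hb : ∀ l ∈ Λ, (dop (pt l) ^ (b l + 1)) F = 0)
    (h : ∀ y, (dop (pt y) ^ (N + 1)) F = 0)
    (hD : q * N < 2 * d + ∑ l ∈ Λ, (N - b l)) (y : ℂ) : (dop (pt y) ^ N) F = 0 := by
  -- For `q < 2` there are no moments and `F` is constant; this case is separate because the
  -- truncated `q - 2` no longer matches `hD`.
  rcases lt_or_ge q 2 with hq | hq
  · have hF0 : F.IsHomogeneous 0 := by
      have : {i | i + 2 ≤ q} = (∅ : Set ℕ) := by ext i; simp; omega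
      rw [this, supported_empty] at hs
      obtain ⟨c, rfl⟩ := Algebra.mem_bot.1 hs
      exact isHomogeneous_C _ _
    rcases Nat.eq_zero_or_pos N with rfl | hN
    · by_contra hne
      have := hF.inj_right hF0 hne
      simp [this] at hD
    · exact dop_pow_eq_zero _ hF0 hN
  rcases lt_or_ge d N with hd | hd
  · exact dop_pow_eq_zero _ hF hd
  obtain ⟨e, rfl⟩ := Nat.exists_eq_add_of_le' hd
  rw [← map_eval_genDop_pow, genDop_pow_eq_zero_of_dvd hF hs h
    (w := ∏ l ∈ Λ, (Polynomial.X - Polynomial.C l) ^ (N - b l)), map_zero]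
  · exact Finset.prod_ne_zero_iff.2 fun l _ => pow_ne_zero _ (Polynomial.X_sub_C_ne_zero l)
  · rw [map_prod]
    refine Finset.prod_dvd_of_coprime ?_ fun l hl => dvd_genDop_pow (hb l hl) N
    intro l _ l' _ hne
    refine IsCoprime.map (f := (C : Polynomial ℂ →+* MvPolynomial ℕ (Polynomial ℂ))) ?_
    exact (Polynomial.isCoprime_X_sub_C_of_isUnit_sub (sub_ne_zero.2 hne).isUnit).pow
  · rw [Polynomial.natDegree_prod _ _ fun l _ => pow_ne_zero _ (Polynomial.X_sub_C_ne_zero l)]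
    simp only [Polynomial.natDegree_pow, Polynomial.natDegree_X_sub_C, mul_one]
    obtain ⟨q, rfl⟩ := Nat.exists_eq_add_of_le' hq
    rw [add_tsub_cancel_right]
    nlinarith

end Moving

/-! ### Linear forms, translations and projections -/

section Linear

/-- The linear form in the moments attached to a polynomial in one variable. -/
def ev : Polynomial ℂ →ₗ[ℂ] MvPolynomial ℕ ℂ :=
  (Polynomial.basisMonomials ℂ).constr ℂ fun i => (X i : MvPolynomial ℕ ℂ)

theorem ev_X_pow (i : ℕ) : ev (Polynomial.X ^ i) = X i := by
  have := (Polynomial.basisMonomials ℂ).constr_basis ℂ (fun i => (X i : MvPolynomial ℕ ℂ)) i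
  simp only [Polynomial.coe_basisMonomials, Polynomial.monomial_one_right_eq_X_pow] at this
  exact this

theorem ev_eq_sum (p : Polynomial ℂ) {s : Finset ℕ} (hs : p.support ⊆ s) :
    ev p = ∑ i ∈ s, p.coeff i • X i := by
  conv_lhs => rw [Polynomial.as_sum_support_C_mul_X_pow p]
  rw [map_sum, ← Finset.sum_subset hs]
  · refine Finset.sum_congr rfl fun i _ => ?_
    rw [← Polynomial.smul_eq_C_mul, map_smul, ev_X_pow]
  · intro i _ hi
    rw [Polynomial.notMem_support_iff.1 hi, zero_smul]

theorem ev_hom_ext {W : Type*} [AddCommMonoid W] [Module ℂ W] {f g : Polynomial ℂ →ₗ[ℂ] W}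
    (h : ∀ i, f (Polynomial.X ^ i) = g (Polynomial.X ^ i)) (p : Polynomial ℂ) : f p = g p := by
  refine LinearMap.congr_fun ((Polynomial.basisMonomials ℂ).ext fun i => ?_) p
  simp only [Polynomial.coe_basisMonomials, Polynomial.monomial_one_right_eq_X_pow]
  exact h i

theorem dop_pt_ev (y : ℂ) (p : Polynomial ℂ) : dop (pt y) (ev p) = C (p.eval y) := by
  refine ev_hom_ext (f := (dop (pt y)).comp ev)
    (g := (Algebra.linearMap ℂ (MvPolynomial ℕ ℂ)).comp (Polynomial.leval y)) (fun i => ?_) p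
  simp [ev_X_pow, pt, MvPolynomial.algebraMap_eq]

theorem tanDop_ev (y : ℂ) (p : Polynomial ℂ) :
    tanDop y (ev p) = C (p.derivative.eval y) := by
  refine ev_hom_ext (f := (tanDop y).comp ev)
    (g := (Algebra.linearMap ℂ (MvPolynomial ℕ ℂ)).comp
      ((Polynomial.leval y).comp Polynomial.derivative)) (fun i => ?_) p
  simp [ev_X_pow, tanDop, MvPolynomial.algebraMap_eq, Polynomial.derivative_X_pow]

theorem isHomogeneous_ev (p : Polynomial ℂ) : (ev p).IsHomogeneous 1 := by
  rw [ev_eq_sum p subset_rfl]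
  refine IsHomogeneous.sum _ _ _ fun i _ => ?_
  rw [MvPolynomial.smul_eq_C_mul]
  exact isHomogeneous_C_mul_X _ _

theorem ev_mem_supported {p : Polynomial ℂ} {s : Set ℕ} (h : ∀ i ≤ p.natDegree, i ∈ s) :
    ev p ∈ supported ℂ s := by
  rw [ev_eq_sum p subset_rfl]
  refine sum_mem fun i hi => Subalgebra.smul_mem _ ?_ _
  exact X_mem_supported.2 (h i (Polynomial.le_natDegree_of_mem_supp i hi))

theorem aeval_mem_of_supported {s : Set ℕ} {g : ℕ → MvPolynomial ℕ ℂ}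
    {T : Subalgebra ℂ (MvPolynomial ℕ ℂ)} (hg : ∀ i ∈ s, g i ∈ T) {F : MvPolynomial ℕ ℂ}
    (hF : F ∈ supported ℂ s) : aeval g F ∈ T := by
  have : supported ℂ s ≤ T.comap (aeval g) := by
    rw [supported_eq_adjoin_X, Algebra.adjoin_le_iff]
    rintro _ ⟨i, hi, rfl⟩
    simpa using hg i hi
  exact this hF

theorem isHomogeneous_aeval_of_linear {F : MvPolynomial ℕ ℂ} {d : ℕ} (hF : F.IsHomogeneous d)
    {g : ℕ → MvPolynomial ℕ ℂ} (hg : ∀ i, (g i).IsHomogeneous 1) :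
    (aeval g F).IsHomogeneous d := by
  have := hF.aeval g hg
  rwa [one_mul] at this

/-- The action on the moments of the translation by `c`. -/
def trans (c : ℂ) : MvPolynomial ℕ ℂ →ₐ[ℂ] MvPolynomial ℕ ℂ :=
  aeval fun j => ev ((Polynomial.X - Polynomial.C c) ^ j)

/-- The pull-back under the projection from the tangent line of the curve at `c`. -/
def proj (c : ℂ) : MvPolynomial ℕ ℂ →ₐ[ℂ] MvPolynomial ℕ ℂ :=
  aeval fun j => ev ((Polynomial.X - Polynomial.C c) ^ 2 * Polynomial.X ^ j)

theorem trans_ev (c : ℂ) (p : Polynomial ℂ) :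
    trans c (ev p) = ev (p.comp (Polynomial.X - Polynomial.C c)) := by
  refine ev_hom_ext (f := (trans c).toLinearMap.comp ev)
    (g := ev.comp (Polynomial.aeval (R := ℂ) (Polynomial.X - Polynomial.C c)).toLinearMap)
    (fun i => ?_) p |>.trans ?_
  · rw [LinearMap.comp_apply, ev_X_pow, AlgHom.toLinearMap_apply, trans, aeval_X,
      LinearMap.comp_apply, AlgHom.toLinearMap_apply, Polynomial.aeval_X_pow]
  · rw [LinearMap.comp_apply, AlgHom.toLinearMap_apply, Polynomial.aeval_def, Polynomial.comp,
      Polynomial.algebraMap_eq]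

theorem proj_ev (c : ℂ) (p : Polynomial ℂ) :
    proj c (ev p) = ev ((Polynomial.X - Polynomial.C c) ^ 2 * p) := by
  have h := ev_hom_ext (f := (proj c).toLinearMap.comp ev)
    (g := ev.comp (LinearMap.mulLeft ℂ ((Polynomial.X - Polynomial.C c) ^ 2))) (fun i => by
      rw [LinearMap.comp_apply, ev_X_pow, AlgHom.toLinearMap_apply, proj, aeval_X,
        LinearMap.comp_apply, LinearMap.mulLeft_apply]) p
  rwa [LinearMap.comp_apply, AlgHom.toLinearMap_apply, LinearMap.comp_apply,
    LinearMap.mulLeft_apply] at h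

theorem trans_trans_neg (c : ℂ) (F : MvPolynomial ℕ ℂ) : trans c (trans (-c) F) = F := by
  have : (trans c).comp (trans (-c)) = AlgHom.id ℂ _ := by
    refine MvPolynomial.algHom_ext fun i => ?_
    rw [AlgHom.comp_apply]
    conv_lhs => rw [trans, trans, aeval_X, ← trans, trans_ev]
    simp [ev_X_pow]
  exact DFunLike.congr_fun this F

/-- In the coordinate centred at `c`, the projection from the tangent line is the shift of indices
by two. -/
theorem proj_trans (c : ℂ) (F : MvPolynomial ℕ ℂ) :
    proj c (trans c F) = trans c (rename (· + 2) F) := by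
  have : (proj c).comp (trans c) = (trans c).comp (rename (· + 2)) := by
    refine MvPolynomial.algHom_ext fun i => ?_
    rw [AlgHom.comp_apply, AlgHom.comp_apply, rename_X]
    conv_lhs => rw [trans, aeval_X, proj_ev]
    rw [trans, aeval_X]
    ring_nf
  exact DFunLike.congr_fun this F

theorem proj_injective (c : ℂ) : Function.Injective (proj c) := by
  have ht : Function.Injective (trans c) := by
    intro F G h
    have h' := congrArg (trans (-c)) h
    have e : ∀ F, trans (-c) (trans c F) = F := by simpa using trans_trans_neg (-c)
    rwa [e, e] at h'
  intro F G h
  rw [← trans_trans_neg c F, ← trans_trans_neg c G, proj_trans, proj_trans] at h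
  have h2 := rename_injective _ (add_left_injective 2) (ht h)
  rw [← trans_trans_neg c F, ← trans_trans_neg c G, h2]

/-- The projection maps the point `pt y` to `(y - c) ^ 2` times `pt y`; the rest is the chain rule.
-/
theorem dop_proj (y c : ℂ) (F : MvPolynomial ℕ ℂ) :
    dop (pt y) (proj c F) = (y - c) ^ 2 • proj c (dop (pt y) F) := by
  induction F using MvPolynomial.induction_on with
  | C a => simp [proj]
  | add F G hF hG => simp only [map_add, hF, hG, smul_add]
  | mul_X F i h =>
    rw [map_mul, dop_mul, h, dop_mul, map_add, map_mul, map_mul, ← ev_X_pow i, proj_ev,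
      dop_pt_ev, dop_pt_ev, Polynomial.eval_mul, MvPolynomial.smul_eq_C_mul,
      MvPolynomial.smul_eq_C_mul]
    simp only [Polynomial.eval_pow, Polynomial.eval_sub, Polynomial.eval_X, Polynomial.eval_C,
      C_mul, C_sub, proj, algHom_C, MvPolynomial.algebraMap_eq, map_pow]
    ring

theorem dop_pow_proj (y c : ℂ) (j : ℕ) (F : MvPolynomial ℕ ℂ) :
    (dop (pt y) ^ j) (proj c F) = ((y - c) ^ 2) ^ j • proj c ((dop (pt y) ^ j) F) := by
  induction j with
  | zero => simp
  | succ j ih =>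
    rw [pow_succ', Module.End.mul_apply, ih, map_smul, dop_proj, smul_smul, ← pow_succ,
      ← Module.End.mul_apply]

theorem dop_trans {a a' : ℕ → ℂ} {c : ℂ}
    (h : ∀ i, dop a (ev ((Polynomial.X - Polynomial.C c) ^ i)) = C (a' i))
    (F : MvPolynomial ℕ ℂ) : dop a (trans c F) = trans c (dop a' F) := by
  induction F using MvPolynomial.induction_on with
  | C a => simp [trans]
  | add F G hF hG => simp only [map_add, hF, hG]
  | mul_X F i hF =>
    rw [map_mul, dop_mul, hF, dop_mul, map_add, map_mul, map_mul, dop_X]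
    conv_lhs => enter [1, 2, 2]; rw [trans, aeval_X]
    rw [h]
    simp [trans]

/-- At the parameter `0` the curve point and the tangent vector are the first two basis vectors, so
the partial derivatives in the moments `0` and `1` vanish. -/
theorem mem_supported_two_le {G : MvPolynomial ℕ ℂ} (h0 : dop (pt 0) G = 0)
    (h1 : tanDop 0 G = 0) : G ∈ supported ℂ {i | 2 ≤ i} := by
  have key : ∀ (a : ℕ → ℂ) (i : ℕ), (∀ j, a j = if j = i then 1 else 0) → dop a G = 0 →
      i ∉ G.vars := by
    intro a i ha h hi
    obtain ⟨m, hm, him⟩ := (mem_vars_iff_mem_support i).1 hi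
    have := congrArg (coeff (m - Finsupp.single i 1)) h
    rw [coeff_dop _ subset_rfl, coeff_zero, Finset.sum_eq_single_of_mem i hi] at this
    · rw [ha, if_pos rfl, one_mul, tsub_add_cancel_of_le
        (Finsupp.single_le_iff.2 (Nat.one_le_iff_ne_zero.2 (Finsupp.mem_support_iff.1 him)))] at this
      exact (mul_ne_zero (mem_support_iff.1 hm) (Nat.cast_add_one_ne_zero _)) this
    · intro j _ hj
      rw [ha, if_neg hj, zero_mul]
  rw [mem_supported]
  intro i hi
  by_contra hlt
  have : i = 0 ∨ i = 1 := by simp at hlt; omega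
  rcases this with rfl | rfl
  · refine key _ 0 (fun j => ?_) h0 hi
    simp [pt, zero_pow_eq]
  · refine key _ 1 (fun j => ?_) h1 hi
    rcases j with _ | _ | j <;> simp

/-- Translate `c` to `0`, where only moments of index at least two occur; lower the indices by two
and translate back. -/
theorem exists_proj_eq {G : MvPolynomial ℕ ℂ} {c : ℂ} {q d : ℕ} (hG : G.IsHomogeneous d)
    (hs : G ∈ supported ℂ {i | i + 2 ≤ q}) (h0 : dop (pt c) G = 0) (h1 : tanDop c G = 0) :
    ∃ R, proj c R = G ∧ R.IsHomogeneous d ∧ R ∈ supported ℂ {i | i + 2 ≤ q - 2} := by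
  set G' := trans (-c) G with hG'
  have hsG' : G' ∈ supported ℂ {i | i + 2 ≤ q} := by
    refine aeval_mem_of_supported (fun i hi => ev_mem_supported fun j hj => ?_) hs
    have : ((Polynomial.X - Polynomial.C (-c)) ^ i).natDegree = i := by
      rw [Polynomial.natDegree_pow, Polynomial.natDegree_X_sub_C, mul_one]
    simp only [Set.mem_ofPred_eq] at hi ⊢
    omega
  have h2 : G' ∈ supported ℂ {i | 2 ≤ i} := by
    refine mem_supported_two_le ?_ ?_
    · rw [hG', dop_trans (a' := pt c), h0, map_zero]
      intro i; rw [dop_pt_ev]; simp [pt]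
    · rw [tanDop, hG', dop_trans (a' := fun i => i * c ^ (i - 1)), ← tanDop, h1, map_zero]
      intro i; rw [← tanDop, tanDop_ev]; simp [Polynomial.derivative_pow]
  let down : ℕ → MvPolynomial ℕ ℂ := fun i => if 2 ≤ i then X (i - 2) else 0
  have hdown : rename (· + 2) (aeval down G') = G' := by
    have : supported ℂ {i | 2 ≤ i} ≤ AlgHom.equalizer
        ((rename (· + 2) : MvPolynomial ℕ ℂ →ₐ[ℂ] _).comp (aeval down)) (AlgHom.id ℂ _) := by
      rw [supported_eq_adjoin_X, Algebra.adjoin_le_iff]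
      rintro _ ⟨i, hi, rfl⟩
      have hi : 2 ≤ i := hi
      simp [down, hi]
    exact this h2
  refine ⟨trans c (aeval down G'), ?_, ?_, ?_⟩
  · rw [proj_trans, hdown, hG', trans_trans_neg]
  · refine isHomogeneous_aeval_of_linear (isHomogeneous_aeval_of_linear
      (isHomogeneous_aeval_of_linear hG fun i => isHomogeneous_ev _) fun i => ?_)
      fun i => isHomogeneous_ev _
    by_cases hi : 2 ≤ i
    · simp only [down, hi, if_true]; exact isHomogeneous_X _ _
    · simp only [down, hi, if_false]; exact isHomogeneous_zero _ _ _
  · refine aeval_mem_of_supported (s := {i | i + 2 ≤ q - 2})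
      (fun i hi => ev_mem_supported fun j hj => ?_) ?_
    · have : ((Polynomial.X - Polynomial.C c) ^ i).natDegree = i := by
        rw [Polynomial.natDegree_pow, Polynomial.natDegree_X_sub_C, mul_one]
      simp only [Set.mem_ofPred_eq] at hi ⊢
      omega
    · refine aeval_mem_of_supported (fun i hi => ?_) hsG'
      by_cases h2i : 2 ≤ i
      · simp only [down, h2i, if_true]
        refine X_mem_supported.2 ?_
        simp only [Set.mem_ofPred_eq] at hi ⊢
        omega
      · simp only [down, h2i, if_false]; exact zero_mem _

end Linear

/-! ### Hankel determinants -/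

section Hankel

theorem sign_cast_eq_C {k : ℕ} (σ : Equiv.Perm (Fin k)) :
    (((Equiv.Perm.sign σ : ℤˣ) : ℤ) : MvPolynomial ℕ ℂ) =
      C (((Equiv.Perm.sign σ : ℤˣ) : ℤ) : ℂ) := by
  rw [map_intCast]

/-- The determinant of the Hankel matrix of size `k` of the moments with weight `f`. -/
def hankel (k : ℕ) (f : Polynomial ℂ) : MvPolynomial ℕ ℂ :=
  Matrix.det (Matrix.of fun i j : Fin k => ev (f * Polynomial.X ^ (i + j : ℕ)))

@[simp] theorem hankel_zero (f : Polynomial ℂ) : hankel 0 f = 1 := by simp [hankel]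

theorem isHomogeneous_hankel (k : ℕ) (f : Polynomial ℂ) : (hankel k f).IsHomogeneous k := by
  rw [hankel, Matrix.det_apply']
  refine IsHomogeneous.sum _ _ _ fun σ _ => ?_
  have h : (∏ i : Fin k, Matrix.of (fun i j : Fin k => ev (f * Polynomial.X ^ (i + j : ℕ)))
      (σ i) i).IsHomogeneous k := by
    have := IsHomogeneous.prod Finset.univ _ (fun _ : Fin k => 1) fun i _ =>
      isHomogeneous_ev (f * Polynomial.X ^ (σ i + i : ℕ))
    rwa [Finset.sum_const, Finset.card_univ, Fintype.card_fin, smul_eq_mul, mul_one] at this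
  rw [sign_cast_eq_C]
  exact h.C_mul _

theorem hankel_mem_supported {k q : ℕ} {f : Polynomial ℂ} (h : f.natDegree + 2 * k ≤ q) :
    hankel k f ∈ supported ℂ {i | i + 2 ≤ q} := by
  rw [hankel, Matrix.det_apply']
  refine sum_mem fun σ _ => ?_
  have hp : (∏ i : Fin k, Matrix.of (fun i j : Fin k => ev (f * Polynomial.X ^ (i + j : ℕ)))
      (σ i) i) ∈ supported ℂ {i | i + 2 ≤ q} := by
    refine prod_mem fun i _ => ev_mem_supported fun j hj => ?_
    have h1 := hj.trans Polynomial.natDegree_mul_le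
    rw [Polynomial.natDegree_X_pow] at h1
    have := i.2
    have := (σ i).2
    simp only [Set.mem_ofPred_eq]
    omega
  exact mul_mem (intCast_mem _ _) hp

theorem proj_hankel (c : ℂ) (k : ℕ) (f : Polynomial ℂ) :
    proj c (hankel k f) = hankel k ((Polynomial.X - Polynomial.C c) ^ 2 * f) := by
  rw [hankel, AlgHom.map_det, hankel]
  congr 1
  ext1 i j
  simp only [AlgHom.mapMatrix_apply, Matrix.map_apply, Matrix.of_apply, proj_ev, mul_assoc]

theorem ev_C_mul (y : ℂ) (p : Polynomial ℂ) : ev (Polynomial.C y * p) = C y * ev p := by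
  rw [← Polynomial.smul_eq_C_mul, map_smul, MvPolynomial.smul_eq_C_mul]

/-- The monomial basis modified so that all but the first element vanish at `y`. -/
def ptBasis (y : ℂ) : ℕ → Polynomial ℂ
  | 0 => 1
  | i + 1 => (Polynomial.X - Polynomial.C y) * Polynomial.X ^ i

/-- Subtract `y` times the preceding row or column. Afterwards all weights except that of the corner
entry vanish at `y`. -/
theorem hankel_eq_det_ptBasis (y : ℂ) (k : ℕ) (f : Polynomial ℂ) : hankel (k + 1) f =
    Matrix.det (Matrix.of fun i j : Fin (k + 1) => ev (f * ptBasis y i * ptBasis y j)) := by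
  rw [hankel, Matrix.det_eq_of_forall_row_eq_smul_add_pred
    (B := Matrix.of fun i j : Fin (k + 1) => ev (f * ptBasis y i * Polynomial.X ^ (j : ℕ)))
    (fun _ => C y), Matrix.det_eq_of_forall_col_eq_smul_add_pred (fun _ => C y)]
  · intro i; simp [ptBasis]
  · intro i j
    simp only [Matrix.of_apply, Fin.val_succ, Fin.val_castSucc, ptBasis, ← ev_C_mul, ← map_add]
    exact congrArg ev (by ring)
  · intro i; simp [ptBasis]
  · intro i j
    simp only [Matrix.of_apply, Fin.val_succ, Fin.val_castSucc, ptBasis, ← ev_C_mul, ← map_add]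
    exact congrArg ev (by ring)

theorem dop_det_eq_zero {a : ℕ → ℂ} {k : ℕ} {A : Matrix (Fin k) (Fin k) (MvPolynomial ℕ ℂ)}
    (h : ∀ i j, dop a (A i j) = 0) : dop a A.det = 0 := by
  rw [Matrix.det_apply', map_sum]
  refine Finset.sum_eq_zero fun σ _ => ?_
  have hp : ∀ s : Finset (Fin k), dop a (∏ i ∈ s, A (σ i) i) = 0 := by
    intro s
    induction s using Finset.induction_on with
    | empty => rw [Finset.prod_empty, ← C_1, dop_C]
    | insert i s hi ih => rw [Finset.prod_insert hi, dop_mul, ih, h, mul_zero, zero_mul, add_zero]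
  rw [sign_cast_eq_C, ← MvPolynomial.smul_eq_C_mul, map_smul, hp, smul_zero]

/-- In the basis adapted to `y` only the corner entry can have a nonzero derivative, namely `f(y)`,
and its cofactor is a Hankel determinant with weight `(X - y) ^ 2 * f`. By `proj_hankel` this
cofactor is a pull-back under `proj y`, which is what makes the lifting in `exists_lift` possible.
-/
theorem dop_hankel_succ (y : ℂ) (k : ℕ) (f : Polynomial ℂ) : dop (pt y) (hankel (k + 1) f) =
    C (f.eval y) * hankel k ((Polynomial.X - Polynomial.C y) ^ 2 * f) := by
  rw [hankel_eq_det_ptBasis y, Matrix.det_succ_row_zero, map_sum, Finset.sum_eq_single 0]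
  · rw [dop_mul, dop_det_eq_zero, hankel]
    · simp only [Fin.val_zero, pow_zero, one_mul, mul_zero, zero_add, Matrix.of_apply, ptBasis,
        mul_one, dop_pt_ev]
      refine congrArg _ (congrArg Matrix.det (Matrix.ext fun i j => ?_))
      simp only [Matrix.submatrix_apply, Matrix.of_apply, Fin.succAbove_zero, Fin.val_succ]
      exact congrArg ev (by ring)
    · intro i j
      simp [dop_pt_ev, ptBasis]
  · intro j _ hj
    rw [dop_mul, dop_det_eq_zero]
    · obtain ⟨j, rfl⟩ := Fin.exists_succ_eq.2 hj
      have h1 : ((-1) ^ ((j.succ : Fin (k + 1)) : ℕ) : MvPolynomial ℕ ℂ) = C ((-1) ^ (j.succ : ℕ)) := by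
        simp
      rw [h1, dop_mul, dop_C]
      simp [dop_pt_ev, ptBasis]
    · intro i j
      simp [dop_pt_ev, ptBasis]
  · simp

theorem dop_hankel_eq_zero {y : ℂ} {k : ℕ} {f : Polynomial ℂ} (h : k = 0 ∨ f.eval y = 0) :
    dop (pt y) (hankel k f) = 0 := by
  rcases k with _ | k
  · rw [hankel_zero, ← C_1, dop_C]
  · rw [dop_hankel_succ, h.resolve_left (Nat.succ_ne_zero k), C_0, zero_mul]

/-- The weight left after one derivative vanishes at `y`: moving along a point of the curve changes
the Hankel matrix by rank one. -/
theorem dop_dop_hankel (y : ℂ) (k : ℕ) (f : Polynomial ℂ) :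
    dop (pt y) (dop (pt y) (hankel k f)) = 0 := by
  rcases k with _ | k
  · rw [dop_hankel_eq_zero (Or.inl rfl), map_zero]
  · rw [dop_hankel_succ, ← MvPolynomial.smul_eq_C_mul, map_smul, dop_hankel_eq_zero, smul_zero]
    right; simp

/-- A derivative along a point where the weight does not vanish lowers the size by one. -/
theorem hankel_ne_zero (k : ℕ) {f : Polynomial ℂ} (hf : f ≠ 0) : hankel k f ≠ 0 := by
  induction k generalizing f with
  | zero => simp
  | succ k ih =>
    intro h
    obtain ⟨y, hy⟩ := (Polynomial.finite_setOfPred_isRoot hf).infinite_compl.nonempty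
    have h1 := congrArg (dop (pt y)) h
    rw [dop_hankel_succ, map_zero] at h1
    refine mul_ne_zero ?_ (ih ?_) h1
    · exact (map_ne_zero_iff _ (C_injective _ _)).2 hy
    · exact mul_ne_zero (pow_ne_zero _ (Polynomial.X_sub_C_ne_zero y)) hf

/-- As a function of one root of the weight, a Hankel determinant of size `k` is a polynomial of
degree at most `k`. -/
theorem hankel_mem_span (k : ℕ) (f : Polynomial ℂ) (c : ℂ) {S : Finset ℂ} (hS : k < S.card) :
    hankel k (f * (Polynomial.X - Polynomial.C c)) ∈
      Submodule.span ℂ ((fun s => hankel k (f * (Polynomial.X - Polynomial.C s))) '' S) := by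
  set A : Matrix (Fin k) (Fin k) (MvPolynomial ℕ ℂ) :=
    Matrix.of fun i j => ev (-(f * Polynomial.X ^ (i + j : ℕ))) with hA
  set B : Matrix (Fin k) (Fin k) (MvPolynomial ℕ ℂ) :=
    Matrix.of fun i j => ev (f * Polynomial.X * Polynomial.X ^ (i + j : ℕ)) with hB
  set P : Polynomial (MvPolynomial ℕ ℂ) :=
    Matrix.det ((Polynomial.X : Polynomial (MvPolynomial ℕ ℂ)) • A.map Polynomial.C +
      B.map Polynomial.C) with hP
  have hdeg : P.natDegree ≤ k := by
    simpa using Polynomial.natDegree_det_X_add_C_le A B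
  have hval : ∀ s, hankel k (f * (Polynomial.X - Polynomial.C s)) =
      ∑ i ∈ Finset.range (k + 1), s ^ i • P.coeff i := by
    intro s
    have h1 : hankel k (f * (Polynomial.X - Polynomial.C s)) = P.eval (C s) := by
      rw [hP, ← Polynomial.coe_evalRingHom, RingHom.map_det, hankel]
      refine congrArg Matrix.det (Matrix.ext fun i j => ?_)
      simp only [RingHom.mapMatrix_apply, Matrix.map_apply, Matrix.of_apply, Matrix.add_apply,
        Matrix.smul_apply, smul_eq_mul, hA, hB, Polynomial.coe_evalRingHom, Polynomial.eval_add,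
        Polynomial.eval_mul, Polynomial.eval_X, Polynomial.eval_C]
      rw [← ev_C_mul, ← map_add]
      exact congrArg ev (by ring)
    rw [h1, Polynomial.eval_eq_sum_range' (Nat.lt_succ_of_le hdeg)]
    refine Finset.sum_congr rfl fun i _ => ?_
    rw [MvPolynomial.smul_eq_C_mul, C_pow, mul_comm]
  -- Lagrange interpolation at more than `k` nodes is exact up to degree `k`, with weights that do
  -- not depend on `i`.
  have hlag : ∀ i ∈ Finset.range (k + 1),
      c ^ i = ∑ s ∈ S, s ^ i * (Lagrange.basis S id s).eval c := by
    intro i hi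
    have h1 := Lagrange.eq_interpolate (s := S) (v := id) (f := (Polynomial.X ^ i : Polynomial ℂ))
      Function.injective_id.injOn (by
        rw [Polynomial.degree_X_pow]
        have := Finset.mem_range.1 hi
        exact_mod_cast (by omega : i < S.card))
    have h2 := congrArg (Polynomial.eval c) h1
    rw [Lagrange.interpolate_apply] at h2
    simpa [Polynomial.eval_finsetSum] using h2
  have : hankel k (f * (Polynomial.X - Polynomial.C c)) = ∑ s ∈ S,
      (Lagrange.basis S id s).eval c • hankel k (f * (Polynomial.X - Polynomial.C s)) := by
    rw [hval c, Finset.sum_congr rfl fun i hi => by rw [hlag i hi, Finset.sum_smul],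
      Finset.sum_comm]
    refine Finset.sum_congr rfl fun s _ => ?_
    rw [hval s, Finset.smul_sum]
    refine Finset.sum_congr rfl fun i _ => ?_
    rw [smul_smul, mul_comm]
  rw [this]
  exact sum_mem fun s hs => Submodule.smul_mem _ _ (Submodule.subset_span ⟨s, hs, rfl⟩)

theorem dop_pow_mul {a : ℕ → ℂ} {F : MvPolynomial ℕ ℂ} (hF : dop a (dop a F) = 0) (m : ℕ)
    (G : MvPolynomial ℕ ℂ) : (dop a ^ (m + 1)) (F * G) =
      F * (dop a ^ (m + 1)) G + ((m : MvPolynomial ℕ ℂ) + 1) * (dop a F * (dop a ^ m) G) := by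
  induction m with
  | zero => simp [dop_mul]
  | succ m ih =>
    have h1 : ((m : MvPolynomial ℕ ℂ) + 1) = C ((m : ℂ) + 1) := by simp
    rw [pow_succ', Module.End.mul_apply, ih, map_add, dop_mul, h1, dop_mul _ (C _), dop_C,
      dop_mul _ (dop a F), hF, pow_succ' _ m]
    simp only [Module.End.mul_apply, Nat.cast_add, Nat.cast_one, C_add, C_1, map_natCast]
    ring

theorem dop_pow_mul_of_eq_zero {a : ℕ → ℂ} {F : MvPolynomial ℕ ℂ} (hF : dop a F = 0) (m : ℕ)
    (G : MvPolynomial ℕ ℂ) : (dop a ^ m) (F * G) = F * (dop a ^ m) G := by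
  rcases m with _ | m
  · simp
  · rw [dop_pow_mul (by rw [hF, map_zero]), hF]; ring

-- Degrees along `a` add up: a factor constant along `a` contributes nothing, any other factor at
-- most one.
open Classical in
theorem dop_pow_prod_eq_zero {ι : Type*} {a : ℕ → ℂ} (s : Finset ι) {H : ι → MvPolynomial ℕ ℂ}
    (hH : ∀ j ∈ s, dop a (dop a (H j)) = 0) {m : ℕ}
    (hm : (s.filter fun j => dop a (H j) ≠ 0).card < m) : (dop a ^ m) (∏ j ∈ s, H j) = 0 := by
  induction s using Finset.induction_on generalizing m with
  | empty =>
    rw [Finset.prod_empty]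
    exact dop_pow_eq_zero a (isHomogeneous_one _ _) (by simpa using hm)
  | insert i s hi ih =>
    rw [Finset.prod_insert hi]
    have hs : ∀ j ∈ s, dop a (dop a (H j)) = 0 := fun j hj => hH j (Finset.mem_insert_of_mem hj)
    rw [Finset.filter_insert] at hm
    by_cases h0 : dop a (H i) = 0
    · rw [dop_pow_mul_of_eq_zero h0, ih hs (by simpa [h0] using hm), mul_zero]
    · rw [if_pos h0, Finset.card_insert_of_notMem (by simp [hi])] at hm
      obtain ⟨m, rfl⟩ := Nat.exists_eq_add_of_le' (Nat.one_le_of_lt hm)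
      rw [dop_pow_mul (hH i (Finset.mem_insert_self i s)), ih hs (by omega), ih hs (by omega)]
      ring

/-- The top coefficient along `a` of a product of affine functions is the product of the slopes. -/
theorem dop_pow_card_prod {ι : Type*} {a : ℕ → ℂ} (s : Finset ι) {H : ι → MvPolynomial ℕ ℂ}
    (hH : ∀ j ∈ s, dop a (dop a (H j)) = 0) :
    (dop a ^ s.card) (∏ j ∈ s, H j) = (s.card.factorial : MvPolynomial ℕ ℂ) *
      ∏ j ∈ s, dop a (H j) := by
  classical
  induction s using Finset.induction_on with
  | empty => simp
  | insert i s hi ih =>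
    have hs : ∀ j ∈ s, dop a (dop a (H j)) = 0 := fun j hj => hH j (Finset.mem_insert_of_mem hj)
    rw [Finset.prod_insert hi, Finset.card_insert_of_notMem hi,
      dop_pow_mul (hH i (Finset.mem_insert_self i s)), ih hs,
      dop_pow_prod_eq_zero s hs (Nat.lt_succ_of_le (Finset.card_filter_le _ _)),
      Finset.prod_insert hi, Nat.factorial_succ]
    push_cast
    ring

end Hankel

/-! ### Configurations -/

section Config

/-- The monic polynomial with simple roots at the points of `I`. -/
def rootPoly (I : Finset ℂ) : Polynomial ℂ := ∏ c ∈ I, (Polynomial.X - Polynomial.C c)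

theorem rootPoly_ne_zero (I : Finset ℂ) : rootPoly I ≠ 0 :=
  Finset.prod_ne_zero_iff.2 fun c _ => Polynomial.X_sub_C_ne_zero c

theorem natDegree_rootPoly (I : Finset ℂ) : (rootPoly I).natDegree = I.card := by
  rw [rootPoly, Polynomial.natDegree_prod _ _ fun c _ => Polynomial.X_sub_C_ne_zero c]
  simp

theorem eval_rootPoly_eq_zero {I : Finset ℂ} {y : ℂ} : (rootPoly I).eval y = 0 ↔ y ∈ I := by
  rw [rootPoly, Polynomial.eval_prod, Finset.prod_eq_zero_iff]
  constructor
  · rintro ⟨c, hc, h⟩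
    rw [Polynomial.eval_sub, Polynomial.eval_X, Polynomial.eval_C, sub_eq_zero] at h
    rwa [h]
  · intro h; exact ⟨y, h, by simp⟩

/-- Forms `F` of degree `d` in the first `q - 1` moments, of degree at most `b l` along the points
`l ∈ Λ` of the curve and of degree at most `N` along all points of the curve. -/
def adm (q N d : ℕ) (Λ : Finset ℂ) (b : ℂ → ℕ) : Submodule ℂ (MvPolynomial ℕ ℂ) where
  carrier := {F | F.IsHomogeneous d ∧ F ∈ supported ℂ {i | i + 2 ≤ q} ∧
    (∀ l ∈ Λ, (dop (pt l) ^ (b l + 1)) F = 0) ∧ ∀ y, (dop (pt y) ^ (N + 1)) F = 0}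
  zero_mem' := ⟨isHomogeneous_zero _ _ _, zero_mem _, fun _ _ => map_zero _, fun _ => map_zero _⟩
  add_mem' := by
    rintro F G ⟨h1, h2, h3, h4⟩ ⟨h1', h2', h3', h4'⟩
    exact ⟨h1.add h1', add_mem h2 h2', fun l hl => by rw [map_add, h3 l hl, h3' l hl, add_zero],
      fun y => by rw [map_add, h4, h4', add_zero]⟩
  smul_mem' := by
    rintro a F ⟨h1, h2, h3, h4⟩
    refine ⟨?_, Subalgebra.smul_mem _ h2 _, fun l hl => by rw [map_smul, h3 l hl, smul_zero],
      fun y => by rw [map_smul, h4, smul_zero]⟩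
    rw [MvPolynomial.smul_eq_C_mul]
    exact h1.C_mul a

/-- The number of members of the family `I` that contain `l`. -/
def inc {N : ℕ} (I : Fin N → Finset ℂ) (l : ℂ) : ℕ := (Finset.univ.filter fun j => l ∈ I j).card

/-- The sizes and weights of a product of `N` Hankel determinants in `adm q N d Λ b`, with the
roots of the weights outside `W`. -/
structure IsConfig (q : ℕ) {N : ℕ} (d : ℕ) (Λ : Finset ℂ) (b : ℂ → ℕ) (W : Finset ℂ)
    (k : Fin N → ℕ) (I : Fin N → Finset ℂ) : Prop where
  card : ∀ j, (I j).card + 2 * k j = q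
  sum : ∑ j, k j = d
  mult : ∀ l ∈ Λ, N ≤ b l + inc I l
  avoid : ∀ j, Disjoint (I j) W

/-- The product of Hankel determinants of a configuration. -/
def cfgProd {N : ℕ} (k : Fin N → ℕ) (I : Fin N → Finset ℂ) : MvPolynomial ℕ ℂ :=
  ∏ j, hankel (k j) (rootPoly (I j))

/-- The span of the products of Hankel determinants of the configurations. -/
def cfgSpan (q N d : ℕ) (Λ : Finset ℂ) (b : ℂ → ℕ) (W : Finset ℂ) :
    Submodule ℂ (MvPolynomial ℕ ℂ) :=
  Submodule.span ℂ {F | ∃ (k : Fin N → ℕ) (I : Fin N → Finset ℂ),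
    IsConfig q d Λ b W k I ∧ F = cfgProd k I}

theorem card_filter_notMem {N : ℕ} (I : Fin N → Finset ℂ) (l : ℂ) :
    (Finset.univ.filter fun j => l ∉ I j).card + inc I l = N := by
  rw [inc, add_comm, Finset.card_filter_add_card_filter_not, Finset.card_univ, Fintype.card_fin]

theorem cfgProd_mem_adm {q N d : ℕ} {Λ : Finset ℂ} {b : ℂ → ℕ} {W : Finset ℂ} {k : Fin N → ℕ}
    {I : Fin N → Finset ℂ} (h : IsConfig q d Λ b W k I) : cfgProd k I ∈ adm q N d Λ b := by
  classical
  refine ⟨?_, ?_, ?_, ?_⟩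
  · rw [← h.sum]
    exact IsHomogeneous.prod _ _ _ fun j _ => isHomogeneous_hankel _ _
  · exact prod_mem fun j _ => hankel_mem_supported
      (by rw [natDegree_rootPoly, h.card j])
  · intro l hl
    refine dop_pow_prod_eq_zero _ (fun j _ => dop_dop_hankel _ _ _) ?_
    have h1 : (Finset.univ.filter fun j => dop (pt l) (hankel (k j) (rootPoly (I j))) ≠ 0).card ≤
        (Finset.univ.filter fun j => l ∉ I j).card := by
      refine Finset.card_le_card fun j hj => ?_
      simp only [Finset.mem_filter, Finset.mem_univ, true_and] at hj ⊢
      exact fun hm => hj (dop_hankel_eq_zero (Or.inr (eval_rootPoly_eq_zero.2 hm)))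
    have h2 := card_filter_notMem I l
    have h3 := h.mult l hl
    omega
  · intro y
    refine dop_pow_prod_eq_zero _ (fun j _ => dop_dop_hankel _ _ _) ?_
    refine Nat.lt_succ_of_le ((Finset.card_filter_le _ _).trans ?_)
    simp

theorem cfgSpan_le_adm (q N d : ℕ) (Λ : Finset ℂ) (b : ℂ → ℕ) (W : Finset ℂ) :
    cfgSpan q N d Λ b W ≤ adm q N d Λ b := by
  refine Submodule.span_le.2 ?_
  rintro _ ⟨k, I, h, rfl⟩
  exact cfgProd_mem_adm h

open Classical in
theorem inc_update {N : ℕ} (I : Fin N → Finset ℂ) (j : Fin N) (J : Finset ℂ) (l : ℂ) :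
    inc (Function.update I j J) l + (if l ∈ I j then 1 else 0) =
      inc I l + if l ∈ J then 1 else 0 := by
  simp only [inc, Finset.card_filter]
  rw [← Finset.add_sum_erase _ _ (Finset.mem_univ j),
    ← Finset.add_sum_erase _ (fun i => if l ∈ I i then 1 else 0) (Finset.mem_univ j),
    Function.update_self, Finset.sum_congr rfl fun i hi => by
      rw [Function.update_of_ne (Finset.ne_of_mem_erase hi)]]
  ring

theorem sum_card_inter_eq {N : ℕ} (I : Fin N → Finset ℂ) (Λ : Finset ℂ) :
    ∑ j, (I j ∩ Λ).card = ∑ l ∈ Λ, inc I l := by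
  simp only [inc, Finset.card_filter]
  rw [Finset.sum_comm]
  refine Finset.sum_congr rfl fun j _ => ?_
  rw [← Finset.card_filter, Finset.inter_comm, Finset.filter_mem_eq_inter]

/-- Replacing the root `c` of the weight with index `j` by the elements of `S`. -/
theorem cfgProd_mem_span_update {N : ℕ} (k : Fin N → ℕ) (I : Fin N → Finset ℂ) {j : Fin N} {c : ℂ}
    (hc : c ∈ I j) {S : Finset ℂ} (hS : Disjoint S (I j)) (hk : k j < S.card) :
    cfgProd k I ∈ Submodule.span ℂ ((fun s => cfgProd k
      (Function.update I j (insert s ((I j).erase c)))) '' S) := by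
  have hfac : ∀ J, cfgProd k (Function.update I j J) = hankel (k j) (rootPoly J) *
      ∏ i ∈ Finset.univ.erase j, hankel (k i) (rootPoly (I i)) := by
    intro J
    rw [cfgProd, ← Finset.mul_prod_erase _ _ (Finset.mem_univ j), Function.update_self]
    refine congrArg _ (Finset.prod_congr rfl fun i hi => ?_)
    rw [Function.update_of_ne (Finset.ne_of_mem_erase hi)]
  have h1 := hankel_mem_span (k j) (rootPoly ((I j).erase c)) c hk
  have hI : rootPoly (I j) = rootPoly ((I j).erase c) * (Polynomial.X - Polynomial.C c) := by
    rw [rootPoly, rootPoly, Finset.prod_erase_mul _ _ hc]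
  have hself := hfac (I j)
  rw [Function.update_eq_self] at hself
  rw [hself, hI]
  have h2 := Submodule.mem_map_of_mem (f := LinearMap.mulRight ℂ
    (∏ i ∈ Finset.univ.erase j, hankel (k i) (rootPoly (I i)))) h1
  rw [Submodule.map_span] at h2
  refine Submodule.span_mono ?_ h2
  rintro _ ⟨_, ⟨s, hs, rfl⟩, rfl⟩
  refine ⟨s, hs, ?_⟩
  have hs' : s ∉ (I j).erase c := fun h =>
    Finset.disjoint_left.1 hS hs (Finset.mem_of_mem_erase h)
  change cfgProd k _ = _
  rw [hfac, LinearMap.mulRight_apply, rootPoly, Finset.prod_insert hs', mul_comm (_ - _)]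
  rfl

/-- Exchange of roots: in a tight situation all roots can be moved to `Λ`, with no point used more
often than needed for one more factor. -/
theorem cfgProd_mem_span_tight {q N d : ℕ} {Λ : Finset ℂ} {b : ℂ → ℕ} {k : Fin N → ℕ}
    {I : Fin N → Finset ℂ} (hcard : ∀ j, (I j).card + 2 * k j = q) (hsum : ∑ j, k j = d)
    (hb : ∀ l ∈ Λ, b l ≤ N) (hmult : ∀ l ∈ Λ, N ≤ b l + inc I l)
    (hT : q * (N + 1) = 2 * d + ∑ l ∈ Λ, (N + 1 - b l)) :
    cfgProd k I ∈ Submodule.span ℂ {F | ∃ I' : Fin N → Finset ℂ,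
      (∀ j, (I' j).card + 2 * k j = q) ∧ (∀ j, I' j ⊆ Λ) ∧
      (∀ l ∈ Λ, N ≤ b l + inc I' l ∧ b l + inc I' l ≤ N + 1) ∧ F = cfgProd k I'} := by
  classical
  -- These are the points of `Λ` with room for one more root. A root outside `Λ` or at an overused
  -- point is exchanged for such points, and each exchange fills one of them.
  induction hB : (Λ.filter fun l => b l + inc I l < N + 1).card using Nat.strong_induction_on
    generalizing I with
  | _ m ih =>
  set B := Λ.filter fun l => b l + inc I l < N + 1 with hBdef
  have htot : ∑ j, (I j).card + 2 * d = q * N := by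
    rw [← hsum, Finset.mul_sum, ← Finset.sum_add_distrib, Finset.sum_congr rfl fun j _ => hcard j]
    simp [mul_comm]
  have hsplit : ∑ j, (I j).card = ∑ l ∈ Λ, inc I l + ∑ j, (I j \ Λ).card := by
    rw [← sum_card_inter_eq, ← Finset.sum_add_distrib]
    exact Finset.sum_congr rfl fun j _ => (Finset.card_inter_add_card_sdiff _ _).symm
  have hBcard : B.card + ∑ l ∈ Λ, inc I l =
      ∑ l ∈ Λ, (N + 1 - b l) + ∑ l ∈ Λ, (b l + inc I l - (N + 1)) := by
    rw [hBdef, Finset.card_filter, ← Finset.sum_add_distrib, ← Finset.sum_add_distrib]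
    refine Finset.sum_congr rfl fun l hl => ?_
    have h1 := hb l hl
    have h2 := hmult l hl
    split_ifs <;> omega
  -- The total number of roots is `q * N - 2 * d`; compared with `hT`, the number of free places is
  -- `q` plus the number of misplaced roots.
  have hBq : B.card = q + ∑ j, (I j \ Λ).card + ∑ l ∈ Λ, (b l + inc I l - (N + 1)) := by
    have : q * (N + 1) = q * N + q := by ring
    omega
  by_cases hgood : (∀ j, I j ⊆ Λ) ∧ ∀ l ∈ Λ, b l + inc I l ≤ N + 1
  · exact Submodule.subset_span ⟨I, hcard, hgood.1, fun l hl => ⟨hmult l hl, hgood.2 l hl⟩, rfl⟩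
  · obtain ⟨j, c, hcj, hc⟩ : ∃ j c, c ∈ I j ∧ (c ∈ Λ → N + 1 < b c + inc I c) := by
      by_contra hcon
      push Not at hcon
      refine hgood ⟨fun j c hcj => (hcon j c hcj).1, fun l hl => ?_⟩
      by_contra hlt
      have hpos : 0 < inc I l := by have := hb l hl; omega
      obtain ⟨j, hj⟩ := Finset.card_pos.1 hpos
      exact hlt (hcon j l (by simpa using hj)).2
    have hbad : 1 ≤ ∑ j, (I j \ Λ).card + ∑ l ∈ Λ, (b l + inc I l - (N + 1)) := by
      by_cases hcΛ : c ∈ Λ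
      · have h1 := Finset.single_le_sum (f := fun l => b l + inc I l - (N + 1))
          (fun _ _ => Nat.zero_le _) hcΛ
        have h2 := hc hcΛ
        omega
      · have h1 := Finset.single_le_sum (f := fun j => (I j \ Λ).card)
          (fun _ _ => Nat.zero_le _) (Finset.mem_univ j)
        have h2 : 0 < (I j \ Λ).card := Finset.card_pos.2 ⟨c, Finset.mem_sdiff.2 ⟨hcj, hcΛ⟩⟩
        omega
    -- One misplaced root gives `q + 1 ≤ |B|`, while `|I j| = q - 2 * k j`; hence more than `2 * k
    -- j` nodes are available for the interpolation.
    have hk : k j < (B \ I j).card := by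
      have h1 := Finset.le_card_sdiff (I j) B
      have h2 := hcard j
      omega
    refine Submodule.span_le.2 ?_ (cfgProd_mem_span_update k I hcj Finset.sdiff_disjoint hk)
    rintro _ ⟨s, hs, rfl⟩
    obtain ⟨hsB, hsj⟩ := Finset.mem_sdiff.1 hs
    obtain ⟨hsΛ, hslt⟩ := Finset.mem_filter.1 hsB
    have hsc : s ≠ c := fun h => hsj (h ▸ hcj)
    have hcard' : (insert s ((I j).erase c)).card = (I j).card := by
      rw [Finset.card_insert_of_notMem fun h => hsj (Finset.mem_of_mem_erase h),
        Finset.card_erase_add_one hcj]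
    have hinc : ∀ l, inc (Function.update I j (insert s ((I j).erase c))) l +
        (if l = c then 1 else 0) = inc I l + if l = s then 1 else 0 := by
      intro l
      have h1 := inc_update I j (insert s ((I j).erase c)) l
      by_cases hlc : l = c
      · subst hlc
        simpa [hcj, hsc, Ne.symm hsc] using h1
      · by_cases hls : l = s
        · subst hls; simpa [hsj, hlc] using h1
        · by_cases hlj : l ∈ I j <;> simpa [hlc, hls, hlj] using h1
    refine ih _ ?_ ?_ ?_ rfl
    · rw [← hB]
      refine Finset.card_lt_card (Finset.ssubset_iff_of_subset ?_ |>.2 ⟨s, hsB, ?_⟩)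
      · intro l hl
        obtain ⟨hlΛ, hl⟩ := Finset.mem_filter.1 hl
        refine Finset.mem_filter.2 ⟨hlΛ, ?_⟩
        have h1 := hinc l
        by_cases hlc : l = c
        · subst hlc
          have h2 := hc hlΛ
          rw [if_pos rfl, if_neg (Ne.symm hsc)] at h1
          omega
        · rw [if_neg hlc] at h1
          omega
      · intro hsf
        have h1 := (Finset.mem_filter.1 hsf).2
        have h2 := hinc s
        rw [if_neg hsc, if_pos rfl] at h2
        have h3 := hmult s hsΛ
        omega
    · intro i
      by_cases hij : i = j
      · subst hij; rw [Function.update_self, hcard', hcard]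
      · rw [Function.update_of_ne hij, hcard]
    · intro l hl
      have h1 := hinc l
      have h2 := hmult l hl
      by_cases hlc : l = c
      · subst hlc
        have h3 := hc hl
        rw [if_pos rfl, if_neg (Ne.symm hsc)] at h1
        omega
      · rw [if_neg hlc] at h1
        omega

end Config

/-! ### Forms with given multiplicities are spanned by products of Hankel determinants -/

section Spanning

theorem eq_zero_of_supported_of_lt {q d : ℕ} {F : MvPolynomial ℕ ℂ} (hq : q < 2) (hd : 0 < d)
    (hF : F.IsHomogeneous d) (hs : F ∈ supported ℂ {i | i + 2 ≤ q}) : F = 0 := by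
  have hF0 : F.IsHomogeneous 0 := by
    have : {i | i + 2 ≤ q} = (∅ : Set ℕ) := by ext i; simp; omega
    rw [this, supported_empty] at hs
    obtain ⟨c, rfl⟩ := Algebra.mem_bot.1 hs
    exact isHomogeneous_C _ _
  by_contra hne
  have := hF.inj_right hF0 hne
  omega

theorem adm_subset {q N d : ℕ} {Λ Λ' : Finset ℂ} {b : ℂ → ℕ} (h : Λ' ⊆ Λ) :
    adm q N d Λ b ≤ adm q N d Λ' b :=
  fun _ hF => ⟨hF.1, hF.2.1, fun l hl => hF.2.2.1 l (h hl), hF.2.2.2⟩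

theorem adm_succ_le_of_lt {q N d : ℕ} {Λ : Finset ℂ} {b : ℂ → ℕ}
    (hD : q * (N + 1) < 2 * d + ∑ l ∈ Λ, (N + 1 - b l)) :
    adm q (N + 1) d Λ b ≤ adm q N d Λ b :=
  fun _ hF => ⟨hF.1, hF.2.1, hF.2.2.1,
    dop_pow_eq_zero_of_lt hF.1 hF.2.1 hF.2.2.1 hF.2.2.2 hD⟩

theorem adm_zero_eq_bot {q d : ℕ} {Λ : Finset ℂ} {b : ℂ → ℕ} (hd : 0 < d) :
    adm q 0 d Λ b = ⊥ := by
  refine (Submodule.eq_bot_iff _).2 fun F hF => ?_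
  obtain ⟨e, rfl⟩ := Nat.exists_eq_add_of_lt hd
  refine eq_zero_of_dop_pt (d := e) Set.infinite_univ (by simpa using hF.1) fun y _ => ?_
  simpa using hF.2.2.2 y

/-- In the tight case the forms of larger multiplicity along the curve are spanned by products
with a trivial factor. -/
theorem adm_le_cfgSpan_of_tight {q N d : ℕ} {Λ : Finset ℂ} {b : ℂ → ℕ} {W : Finset ℂ}
    (ih : ∀ (D : ℕ) (Λ' : Finset ℂ), q * N = 2 * d + ∑ l ∈ Λ', (N - b l) + D →
      adm q N d Λ' b ≤ cfgSpan q N d Λ' b ∅)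
    (hT : q * (N + 1) = 2 * d + ∑ l ∈ Λ, (N + 1 - b l)) (hW : Disjoint Λ W) :
    adm q N d Λ b ≤ cfgSpan q (N + 1) d Λ b W := by
  set Λ' := Λ.filter fun l => b l ≤ N with hΛ'
  have hb : ∀ l ∈ Λ', b l ≤ N := fun l hl => (Finset.mem_filter.1 hl).2
  have hT' : ∑ l ∈ Λ', (N + 1 - b l) = ∑ l ∈ Λ, (N + 1 - b l) := by
    refine Finset.sum_filter_of_ne fun l _ h => ?_
    omega
  have hcardsum : ∑ l ∈ Λ', (N + 1 - b l) = ∑ l ∈ Λ', (N - b l) + Λ'.card := by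
    rw [Finset.card_eq_sum_ones, ← Finset.sum_add_distrib]
    exact Finset.sum_congr rfl fun l hl => by have := hb l hl; omega
  -- Lowering the number of factors by one lowers the left side of `hT` by `q` and the sum by at
  -- most `|Λ'|`. If `|Λ'| < q`, the strict inequality persists down to zero factors and the space
  -- is zero; otherwise the slack for `N` factors is `|Λ'| - q` and `ih` applies.
  rcases lt_or_ge Λ'.card q with hlt | hge
  · have hd : 0 < d := by
      rcases Nat.eq_zero_or_pos d with rfl | hd
      · have h1 : ∑ l ∈ Λ', (N + 1 - b l) ≤ Λ'.card * (N + 1) :=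
          Finset.sum_le_card_nsmul _ _ _ fun l _ => Nat.sub_le _ _
        have h2 : Λ'.card * (N + 1) < q * (N + 1) := Nat.mul_lt_mul_of_pos_right hlt (by omega)
        omega
      · exact hd
    have hdown : ∀ t ≤ N, adm q N d Λ b ≤ adm q (N - t) d Λ b := by
      intro t
      induction t with
      | zero => intro _; exact le_rfl
      | succ t iht =>
        intro ht
        refine (iht (by omega)).trans ?_
        obtain ⟨M, hM⟩ : ∃ M, N - t = M + 1 := ⟨N - t - 1, by omega⟩
        rw [show N - (t + 1) = M by omega, hM]
        refine adm_succ_le_of_lt ?_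
        have h1 : ∑ l ∈ Λ, (N + 1 - b l) ≤ ∑ l ∈ Λ, (M + 1 - b l) + Λ'.card * (N - M) := by
          rw [hΛ', Finset.card_filter, Finset.sum_mul, ← Finset.sum_add_distrib]
          refine Finset.sum_le_sum fun l _ => ?_
          split_ifs
          · rw [one_mul]; omega
          · omega
        have h2 : Λ'.card * (N - M) < q * (N - M) := Nat.mul_lt_mul_of_pos_right hlt (by omega)
        have h3 : q * (N + 1) = q * (M + 1) + q * (N - M) := by
          rw [← mul_add]; congr 1; omega
        omega
    refine (hdown N le_rfl).trans ?_
    rw [Nat.sub_self, adm_zero_eq_bot hd]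
    exact bot_le
  · refine (adm_subset (Finset.filter_subset _ _)).trans ((ih (Λ'.card - q) Λ' ?_).trans ?_)
    · have : q * (N + 1) = q * N + q := by ring
      omega
    refine Submodule.span_le.2 ?_
    rintro _ ⟨k, I, hI, rfl⟩
    refine Submodule.span_le.2 ?_ (cfgProd_mem_span_tight hI.card hI.sum hb hI.mult
      (by rw [hT', hT]))
    rintro _ ⟨I', hcard, hsub, hmult, rfl⟩
    -- The points that need one more root. There are exactly `q` of them, so they are the roots of
    -- an additional Hankel determinant of size `0`, which equals `1`.
    set J := Λ'.filter fun l => b l + inc I' l = N with hJ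
    have hJcard : J.card = q := by
      have h1 : J.card + ∑ l ∈ Λ', inc I' l = ∑ l ∈ Λ', (N + 1 - b l) := by
        rw [hJ, Finset.card_filter, ← Finset.sum_add_distrib]
        refine Finset.sum_congr rfl fun l hl => ?_
        have h1 := hb l hl
        have h2 := hmult l hl
        split_ifs <;> omega
      have h2 : ∑ l ∈ Λ', inc I' l + 2 * d = q * N := by
        rw [← sum_card_inter_eq, ← hI.sum, Finset.mul_sum, ← Finset.sum_add_distrib,
          Finset.sum_congr rfl fun j _ => by
            rw [Finset.inter_eq_left.2 (hsub j), hcard j]]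
        simp [mul_comm]
      have : q * (N + 1) = q * N + q := by ring
      omega
    have hinc : ∀ l, inc (Fin.cons J I' : Fin (N + 1) → Finset ℂ) l =
        (if l ∈ J then 1 else 0) + inc I' l := by
      intro l
      simp only [inc, Finset.card_filter, Fin.sum_univ_succ, Fin.cons_zero, Fin.cons_succ]
    refine Submodule.subset_span ⟨Fin.cons 0 k, Fin.cons J I', ⟨?_, ?_, ?_, ?_⟩, ?_⟩
    · intro j
      refine Fin.cases ?_ (fun j => ?_) j
      · simpa using hJcard
      · simpa using hcard j
    · simp [Fin.sum_univ_succ, hI.sum]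
    · intro l hl
      rw [hinc]
      by_cases hlb : b l ≤ N
      · have hl' : l ∈ Λ' := Finset.mem_filter.2 ⟨hl, hlb⟩
        have h1 := hmult l hl'
        by_cases hlJ : b l + inc I' l = N
        · rw [if_pos (Finset.mem_filter.2 ⟨hl', hlJ⟩)]; omega
        · omega
      · omega
    · have hΛW : Disjoint Λ' W := Finset.disjoint_of_subset_left (Finset.filter_subset _ _) hW
      intro j
      refine Fin.cases ?_ (fun j => ?_) j
      · exact Finset.disjoint_of_subset_left (Finset.filter_subset _ _) hΛW
      · exact Finset.disjoint_of_subset_left (hsub j) hΛW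
    · simp [cfgProd, Fin.prod_univ_succ]

/-- Raise every size by one: by `dop_hankel_succ`, `N` derivatives along `c` return the pulled-back
product times `N!` and the values of the weights at `c`. These are nonzero because the roots avoid
`c`, which is the purpose of the set `W` throughout. -/
theorem exists_lift {q N e : ℕ} {Λ : Finset ℂ} {b : ℂ → ℕ} {W : Finset ℂ} {c : ℂ}
    {R : MvPolynomial ℕ ℂ} (hR : R ∈ cfgSpan q N e Λ b (insert c W)) :
    ∃ G ∈ cfgSpan (q + 2) N (e + N) Λ b W, (dop (pt c) ^ N) G = proj c R := by
  induction hR using Submodule.span_induction with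
  | mem R hR =>
    obtain ⟨k, I, hI, rfl⟩ := hR
    set w : ℂ := (N.factorial : ℂ) * ∏ j, (rootPoly (I j)).eval c with hw
    have hw0 : w ≠ 0 := by
      refine mul_ne_zero (Nat.cast_ne_zero.2 N.factorial_ne_zero)
        (Finset.prod_ne_zero_iff.2 fun j _ h => ?_)
      exact Finset.disjoint_left.1 (hI.avoid j) (eval_rootPoly_eq_zero.1 h)
        (Finset.mem_insert_self c W)
    have hmem : cfgProd (fun j => k j + 1) I ∈ cfgSpan (q + 2) N (e + N) Λ b W := by
      refine Submodule.subset_span ⟨_, I, ⟨fun j => ?_, ?_, hI.mult, fun j => ?_⟩, rfl⟩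
      · have := hI.card j; omega
      · rw [Finset.sum_add_distrib, hI.sum]; simp
      · exact Finset.disjoint_of_subset_right (Finset.subset_insert c W) (hI.avoid j)
    refine ⟨w⁻¹ • cfgProd (fun j => k j + 1) I, Submodule.smul_mem _ _ hmem, ?_⟩
    have h1 := dop_pow_card_prod (a := pt c) Finset.univ
      (H := fun j => hankel (k j + 1) (rootPoly (I j))) fun j _ => dop_dop_hankel _ _ _
    rw [Finset.card_univ, Fintype.card_fin] at h1
    rw [map_smul, cfgProd, h1, Finset.prod_congr rfl fun j _ => dop_hankel_succ c _ _,
      Finset.prod_mul_distrib, cfgProd, map_prod,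
      Finset.prod_congr rfl fun j _ => (proj_hankel c _ _).symm, ← map_prod, ← mul_assoc,
      ← map_natCast (C : ℂ →+* MvPolynomial ℕ ℂ), ← C_mul, ← hw, ← MvPolynomial.smul_eq_C_mul,
      smul_smul, inv_mul_cancel₀ hw0, one_smul]
  | zero => exact ⟨0, zero_mem _, by simp⟩
  | add R R' _ _ h h' =>
    obtain ⟨G, hG, hG'⟩ := h
    obtain ⟨K, hK, hK'⟩ := h'
    exact ⟨G + K, add_mem hG hK, by rw [map_add, map_add, hG', hK']⟩
  | smul a R _ h =>
    obtain ⟨G, hG, hG'⟩ := h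
    exact ⟨a • G, Submodule.smul_mem _ _ hG, by rw [map_smul, map_smul, hG']⟩

/-- The `N`-th derivative is killed along `c` and along the tangent at `c`, hence is a pull-back.
Degree bounds descend at `y ≠ c`, where `(y - c) ^ 2` is invertible, and the bound `N` at `c` itself
follows from those at the other points. -/
theorem exists_proj_eq_mem_adm {q N e : ℕ} {Λ : Finset ℂ} {b : ℂ → ℕ} {c : ℂ} (hc : c ∉ Λ)
    {F : MvPolynomial ℕ ℂ} (hF : F ∈ adm (q + 2) N (e + N) Λ b) :
    ∃ R ∈ adm q N e Λ b, proj c R = (dop (pt c) ^ N) F := by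
  obtain ⟨h1, h2, h3, h4⟩ := hF
  obtain ⟨R, hR, hRd, hRs⟩ := exists_proj_eq (c := c) (isHomogeneous_dop_pow (pt c) h1)
    (dop_pow_supported (pt c) h2 N) (by rw [← Module.End.mul_apply, ← pow_succ', h4 c])
    (dop_pow_tanDop h4 c)
  have key : ∀ y j, y ≠ c → (dop (pt y) ^ j) F = 0 → (dop (pt y) ^ j) R = 0 := by
    intro y j hy h
    have h5 := dop_pow_proj y c j R
    have hcomm : Commute (dop (pt y) ^ j) (dop (pt c) ^ N) := (dop_commute _ _).pow_pow _ _
    rw [hR, ← Module.End.mul_apply, hcomm.eq, Module.End.mul_apply, h, map_zero, eq_comm,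
      smul_eq_zero] at h5
    refine proj_injective c ?_
    rw [h5.resolve_left (pow_ne_zero _ (pow_ne_zero _ (sub_ne_zero.2 hy))), map_zero]
  refine ⟨R, ⟨hRd, hRs, fun l hl => key l _ (fun h => hc (h ▸ hl)) (h3 l hl), ?_⟩, hR⟩
  exact dop_pow_eq_zero_of_infinite (Set.finite_singleton c).infinite_compl
    fun y hy => key y _ hy (h4 y)

/-- Induction on `N`, within it on `q`, within it on the slack `D`. Lowering the degree along a
fresh point by one costs one unit of slack; the obstruction, a top derivative along that point,
lives on a projection with `q` smaller by two. -/
theorem adm_le_cfgSpan (N q D d : ℕ) (Λ : Finset ℂ) (b : ℂ → ℕ) (W : Finset ℂ)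
    (hD : q * N = 2 * d + ∑ l ∈ Λ, (N - b l) + D) (hW : Disjoint Λ W) :
    adm q N d Λ b ≤ cfgSpan q N d Λ b W := by
  induction N generalizing q D d Λ b W with
  | zero =>
    intro F hF
    have hd : d = 0 := by omega
    subst hd
    rw [totalDegree_eq_zero_iff_eq_C.1 ((totalDegree_zero_iff_isHomogeneous ℕ).2 hF.1),
      ← mul_one (C _), ← MvPolynomial.smul_eq_C_mul]
    refine Submodule.smul_mem _ _ (Submodule.subset_span
      ⟨Fin.elim0, Fin.elim0, ⟨fun j => j.elim0, by simp, fun l _ => Nat.zero_le _,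
        fun j => j.elim0⟩, by simp [cfgProd]⟩)
  | succ N ihN =>
    induction q using Nat.strong_induction_on generalizing D d Λ b W with
    | _ q ihq =>
    -- Modulo products of Hankel determinants, the degree along a fresh point `c` drops from `N + 1`
    -- to `N`.
    have step : ∀ (D d : ℕ) (Λ : Finset ℂ) (b : ℂ → ℕ) (W : Finset ℂ),
        q * (N + 1) = 2 * d + ∑ l ∈ Λ, (N + 1 - b l) + D → Disjoint Λ W →
        ∀ F ∈ adm q (N + 1) d Λ b, ∃ c, c ∉ Λ ∧ c ∉ W ∧ ∃ G ∈ cfgSpan q (N + 1) d Λ b W,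
          F - G ∈ adm q (N + 1) d (insert c Λ) (Function.update b c N) := by
      intro D d Λ b W hD hW F hF
      obtain ⟨c, hc⟩ := Infinite.exists_notMem_finset (Λ ∪ W)
      rw [Finset.mem_union, not_or] at hc
      refine ⟨c, hc.1, hc.2, ?_⟩
      suffices ∃ G ∈ cfgSpan q (N + 1) d Λ b W, (dop (pt c) ^ (N + 1)) (F - G) = 0 by
        obtain ⟨G, hG, h⟩ := this
        obtain ⟨h1, h2, h3, h4⟩ := sub_mem hF (cfgSpan_le_adm _ _ _ _ _ _ hG)
        refine ⟨G, hG, h1, h2, fun l hl => ?_, h4⟩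
        rcases Finset.mem_insert.1 hl with rfl | hl
        · rw [Function.update_self, h]
        · rw [Function.update_of_ne (ne_of_mem_of_not_mem hl hc.1), h3 l hl]
      rcases lt_or_ge d (N + 1) with hd | hd
      · exact ⟨0, zero_mem _, by rw [sub_zero, dop_pow_eq_zero _ hF.1 hd]⟩
      rcases lt_or_ge q 2 with hq | hq
      · exact ⟨0, zero_mem _, by
          rw [sub_zero, eq_zero_of_supported_of_lt hq (by omega) hF.1 hF.2.1, map_zero]⟩
      obtain ⟨e, rfl⟩ := Nat.exists_eq_add_of_le' hd
      obtain ⟨q, rfl⟩ := Nat.exists_eq_add_of_le' hq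
      obtain ⟨R, hR, hRF⟩ := exists_proj_eq_mem_adm hc.1 hF
      -- The projection preserves the slack: `q * (N + 1)` and `2 * d` both drop by `2 * (N + 1)`.
      -- The point `c` joins the set to be avoided so that the result can be lifted.
      have hRs := ihq q (by omega) D e Λ b (insert c W) (by
        have : (q + 2) * (N + 1) = q * (N + 1) + 2 * (N + 1) := by ring
        omega) (Finset.disjoint_insert_right.2 ⟨hc.1, hW⟩) hR
      obtain ⟨G, hG, hGR⟩ := exists_lift hRs
      exact ⟨G, hG, by rw [map_sub, hGR, hRF, sub_self]⟩
    have hsum : ∀ {c : ℂ} {Λ : Finset ℂ} {b : ℂ → ℕ}, c ∉ Λ →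
        ∑ l ∈ insert c Λ, (N + 1 - Function.update b c N l) = ∑ l ∈ Λ, (N + 1 - b l) + 1 := by
      intro c Λ b hc
      rw [Finset.sum_insert hc, Function.update_self, Finset.sum_congr rfl fun l hl => by
        rw [Function.update_of_ne (ne_of_mem_of_not_mem hl hc)]]
      omega
    induction D generalizing d Λ b W with
    | zero =>
      intro F hF
      obtain ⟨c, hcΛ, -, G, hG, hFG⟩ := step 0 d Λ b W hD hW F hF
      rw [← sub_add_cancel F G]
      refine add_mem ?_ hG
      -- With the new condition at `c` the slack would be `-1`, so the degree along the whole curve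
      -- drops to `N`; then `c` is forgotten and the tight case applies.
      have h1 := adm_succ_le_of_lt (by rw [hsum hcΛ]; omega) hFG
      refine adm_le_cfgSpan_of_tight (fun D Λ' h => ihN q D d Λ' b ∅ h (Finset.disjoint_empty_right _))
        (by omega) hW ⟨h1.1, h1.2.1, fun l hl => ?_, h1.2.2.2⟩
      have h2 := h1.2.2.1 l (Finset.mem_insert_of_mem hl)
      rwa [Function.update_of_ne (ne_of_mem_of_not_mem hl hcΛ)] at h2
    | succ D ihD =>
      intro F hF
      obtain ⟨c, hcΛ, hcW, G, hG, hFG⟩ := step (D + 1) d Λ b W hD hW F hF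
      rw [← sub_add_cancel F G]
      refine add_mem ?_ hG
      have h1 := ihD d (insert c Λ) (Function.update b c N) W (by rw [hsum hcΛ]; omega)
        (Finset.disjoint_insert_left.2 ⟨hcW, hW⟩) hFG
      refine Submodule.span_mono ?_ h1
      rintro _ ⟨k, I, hI, rfl⟩
      refine ⟨k, I, ⟨hI.card, hI.sum, fun l hl => ?_, hI.avoid⟩, rfl⟩
      have h2 := hI.mult l (Finset.mem_insert_of_mem hl)
      rwa [Function.update_of_ne (ne_of_mem_of_not_mem hl hcΛ)] at h2

/-- The roots of the weights of a product of Hankel determinants can be moved into a large set. -/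
theorem cfgProd_mem_span_subset {q N d : ℕ} {Λ : Finset ℂ} {b : ℂ → ℕ} {k : Fin N → ℕ}
    {I : Fin N → Finset ℂ} (hI : IsConfig q d Λ b ∅ k I) (hΛ : q ≤ Λ.card) :
    cfgProd k I ∈ Submodule.span ℂ {F | ∃ I' : Fin N → Finset ℂ,
      IsConfig q d Λ b ∅ k I' ∧ (∀ j, I' j ⊆ Λ) ∧ F = cfgProd k I'} := by
  classical
  induction hm : ∑ j, (I j \ Λ).card using Nat.strong_induction_on generalizing I with
  | _ m ih =>
  by_cases hsub : ∀ j, I j ⊆ Λ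
  · exact Submodule.subset_span ⟨I, hI, hsub, rfl⟩
  push Not at hsub
  obtain ⟨j, hj⟩ := hsub
  obtain ⟨c, hcj, hcΛ⟩ := Finset.not_subset.1 hj
  -- As `c` lies outside `Λ`, fewer than `q - 2 * k j` points of `Λ` are roots already, so more than
  -- `2 * k j` are free.
  have hk : k j < (Λ \ I j).card := by
    have h1 : (I j ∩ Λ).card < (I j).card := by
      refine Finset.card_lt_card (Finset.ssubset_iff_of_subset Finset.inter_subset_left |>.2
        ⟨c, hcj, fun h => hcΛ (Finset.mem_inter.1 h).2⟩)
    have h2 := Finset.card_inter_add_card_sdiff Λ (I j)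
    rw [Finset.inter_comm] at h2
    have := hI.card j
    omega
  refine Submodule.span_le.2 ?_ (cfgProd_mem_span_update k I hcj Finset.sdiff_disjoint hk)
  rintro _ ⟨s, hs, rfl⟩
  obtain ⟨hsΛ, hsj⟩ := Finset.mem_sdiff.1 hs
  refine ih _ ?_ ⟨?_, hI.sum, ?_, fun _ => Finset.disjoint_empty_right _⟩ rfl
  · rw [← hm]
    refine Finset.sum_lt_sum (fun i _ => ?_) ⟨j, Finset.mem_univ j, ?_⟩
    · by_cases hij : i = j
      · subst hij
        rw [Function.update_self]
        refine Finset.card_le_card fun l hl => ?_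
        obtain ⟨hl, hlΛ⟩ := Finset.mem_sdiff.1 hl
        refine Finset.mem_sdiff.2 ⟨?_, hlΛ⟩
        rcases Finset.mem_insert.1 hl with rfl | hl
        · exact absurd hsΛ hlΛ
        · exact Finset.mem_of_mem_erase hl
      · rw [Function.update_of_ne hij]
    · rw [Function.update_self]
      refine Finset.card_lt_card (Finset.ssubset_iff_of_subset (fun l hl => ?_) |>.2
        ⟨c, Finset.mem_sdiff.2 ⟨hcj, hcΛ⟩, fun h => ?_⟩)
      · obtain ⟨hl, hlΛ⟩ := Finset.mem_sdiff.1 hl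
        refine Finset.mem_sdiff.2 ⟨?_, hlΛ⟩
        rcases Finset.mem_insert.1 hl with rfl | hl
        · exact absurd hsΛ hlΛ
        · exact Finset.mem_of_mem_erase hl
      · rcases Finset.mem_insert.1 (Finset.mem_sdiff.1 h).1 with h | h
        · exact hcΛ (h ▸ hsΛ)
        · exact (Finset.notMem_erase c _) h
  · intro i
    by_cases hij : i = j
    · subst hij
      rw [Function.update_self, Finset.card_insert_of_notMem
        fun h => hsj (Finset.mem_of_mem_erase h), Finset.card_erase_add_one hcj, hI.card]
    · rw [Function.update_of_ne hij, hI.card]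
  · intro l hl
    have h1 := inc_update I j (insert s ((I j).erase c)) l
    have h2 := hI.mult l hl
    have hlc : l ≠ c := fun h => hcΛ (h ▸ hl)
    by_cases hlj : l ∈ I j
    · rw [if_pos hlj, if_pos (Finset.mem_insert_of_mem (Finset.mem_erase.2 ⟨hlc, hlj⟩))] at h1
      omega
    · rw [if_neg hlj] at h1
      omega

/-- The forms with given multiplicities at the points of `Λ` are spanned by products of Hankel
determinants whose weights have their roots in `Λ`. -/
theorem mem_span_cfgProd {q d : ℕ} {Λ : Finset ℂ} {b : ℂ → ℕ} {F : MvPolynomial ℕ ℂ}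
    (hF : F.IsHomogeneous d) (hs : F ∈ supported ℂ {i | i + 2 ≤ q})
    (hb : ∀ l ∈ Λ, (dop (pt l) ^ (b l + 1)) F = 0) (hΛ : q ≤ Λ.card) :
    F ∈ Submodule.span ℂ {G | ∃ (N : ℕ) (k : Fin N → ℕ) (I : Fin N → Finset ℂ),
      IsConfig q d Λ b ∅ k I ∧ (∀ j, I j ⊆ Λ) ∧ G = cfgProd k I} := by
  have key : ∀ N, adm q N d Λ b ≤ Submodule.span ℂ {G | ∃ (N : ℕ) (k : Fin N → ℕ)
      (I : Fin N → Finset ℂ), IsConfig q d Λ b ∅ k I ∧ (∀ j, I j ⊆ Λ) ∧ G = cfgProd k I} := by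
    intro N
    induction N with
    | zero =>
      rcases Nat.eq_zero_or_pos d with rfl | hd
      · refine (adm_le_cfgSpan 0 q 0 0 Λ b ∅ (by simp) (Finset.disjoint_empty_right _)).trans
          (Submodule.span_mono ?_)
        rintro _ ⟨k, I, hI, rfl⟩
        exact ⟨0, k, I, hI, fun j => j.elim0, rfl⟩
      · rw [adm_zero_eq_bot hd]; exact bot_le
    | succ N ih =>
      rcases lt_or_ge (q * (N + 1)) (2 * d + ∑ l ∈ Λ, (N + 1 - b l)) with h | h
      · exact (adm_succ_le_of_lt h).trans ih
      · obtain ⟨D, hD⟩ := Nat.exists_eq_add_of_le h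
        refine (adm_le_cfgSpan (N + 1) q D d Λ b ∅ hD (Finset.disjoint_empty_right _)).trans
          (Submodule.span_le.2 ?_)
        rintro _ ⟨k, I, hI, rfl⟩
        refine Submodule.span_mono ?_ (cfgProd_mem_span_subset hI hΛ)
        rintro _ ⟨I', hI', hsub, rfl⟩
        exact ⟨N + 1, k, I', hI', hsub, rfl⟩
  -- A form of degree `d` has degree at most `d` in every direction, so the bound `N = d` is
  -- automatic.
  exact key d ⟨hF, hs, hb, fun y => dop_pow_eq_zero _ hF (Nat.lt_succ_self d)⟩

end Spanning

/-! ### Normal form of points on a rational normal curve -/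

/-- The matrix of the substitution `s ↦ s + μ t` in the vectors `(s^n, …, t^n)`. -/
def shear (n : ℕ) (μ : ℂ) : Matrix (Fin (n + 1)) (Fin (n + 1)) ℂ := fun j k =>
  if (j : ℕ) ≤ k then ((n - j).choose (k - j) : ℂ) * μ ^ ((k : ℕ) - j) else 0

theorem shear_mulVec (n : ℕ) (μ s t : ℂ) :
    (shear n μ).mulVec (veronese n s t) = veronese n (s + μ * t) t := by
  funext j
  obtain ⟨j, hj⟩ := j
  obtain ⟨m, rfl⟩ : ∃ m, n = j + m := ⟨n - j, by omega⟩
  have h1 : ∀ k : Fin (j + m + 1), shear (j + m) μ ⟨j, hj⟩ k * veronese (j + m) s t k =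
      (fun k : ℕ => (if j ≤ k then ((j + m - j).choose (k - j) : ℂ) * μ ^ (k - j) else 0) *
        (s ^ (j + m - k) * t ^ k)) k := fun k => rfl
  rw [Matrix.mulVec, dotProduct, Finset.sum_congr rfl fun k _ => h1 k,
    Fin.sum_univ_eq_sum_range (fun k : ℕ =>
      (if j ≤ k then ((j + m - j).choose (k - j) : ℂ) * μ ^ (k - j) else 0) *
        (s ^ (j + m - k) * t ^ k)), show Finset.range (j + m + 1) = Finset.range (j + (m + 1)) from rfl,
    Finset.sum_range_add, Finset.sum_eq_zero, zero_add]
  · simp only [veronese, Nat.add_sub_cancel_left]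
    rw [add_comm s, add_pow, Finset.sum_mul]
    refine Finset.sum_congr rfl fun k _ => ?_
    rw [if_pos (Nat.le_add_right j k), Nat.add_sub_add_left, mul_pow, pow_add]
    ring
  · intro k hk
    rw [Finset.mem_range] at hk
    rw [if_neg (by omega), zero_mul]

theorem shear_mulVec_injective (n : ℕ) (μ : ℂ) :
    Function.Injective (shear n μ).mulVec := by
  have hdet : (shear n μ).det = 1 := by
    rw [Matrix.det_of_isUpperTriangular]
    · exact Finset.prod_eq_one fun j _ => by simp [shear]
    · intro i j hij
      have : ¬ ((i : ℕ) ≤ j) := not_le.mpr hij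
      simp [shear, this]
  exact Matrix.mulVec_injective_of_isUnit
    ((Matrix.isUnit_iff_isUnit_det _).2 (hdet ▸ isUnit_one))

/-- The point `(1, y, …, y^n)` of the moment curve. -/
def mom (n : ℕ) (y : ℂ) : Vec n := fun j => y ^ (j : ℕ)

theorem veronese_eq_smul_mom (n : ℕ) {s : ℂ} (hs : s ≠ 0) (t : ℂ) :
    veronese n s t = s ^ n • mom n (t / s) := by
  funext j
  simp only [veronese, mom, Pi.smul_apply, smul_eq_mul, div_pow]
  rw [← pow_sub_mul_pow s (show (j : ℕ) ≤ n by omega)]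
  have := pow_ne_zero (j : ℕ) hs
  field_simp

/-- A shear with `μ` different from all the ratios `s i / t i` moves every `p i` away from the point
at infinity of the moment curve. -/
theorem exists_normal_form {n r : ℕ} {C : Set (ℙ ℂ (Vec n))} (hC : IsRationalNormalCurve C)
    {p : Fin r → ℙ ℂ (Vec n)} (hp : Function.Injective p) (hpC : ∀ i, p i ∈ C) :
    ∃ (B : Vec n ≃ₗ[ℂ] Vec n) (lam : Fin r → ℂ), Function.Injective lam ∧
      ∀ i, (p i).submodule = Submodule.span ℂ {B (mom n (lam i))} := by
  obtain ⟨A, hA⟩ := hC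
  choose s t hst hspan using fun i => (hA (p i)).1 (hpC i)
  obtain ⟨μ, hμ⟩ : ∃ μ : ℂ, μ ∉ Set.range fun i => s i / t i :=
    (Set.finite_range _).exists_notMem
  have hs' : ∀ i, s i - μ * t i ≠ 0 := by
    intro i h
    by_cases ht : t i = 0
    · rw [ht, mul_zero, sub_zero] at h
      exact (hst i).elim (fun h' => h' h) fun h' => h' ht
    · exact hμ ⟨i, by rw [div_eq_iff ht]; exact sub_eq_zero.1 h⟩
  let U : Vec n ≃ₗ[ℂ] Vec n := LinearEquiv.ofInjectiveEndo (Matrix.mulVecLin (shear n μ))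
    (shear_mulVec_injective n μ)
  have hU : ∀ x, U x = (shear n μ).mulVec x := fun x => rfl
  have key : ∀ i, (p i).submodule =
      Submodule.span ℂ {(U.trans A) (mom n (t i / (s i - μ * t i)))} := by
    intro i
    have h1 : veronese n (s i) (t i) =
        (s i - μ * t i) ^ n • U (mom n (t i / (s i - μ * t i))) := by
      rw [← map_smul, ← veronese_eq_smul_mom n (hs' i), hU, shear_mulVec, sub_add_cancel]
    rw [hspan i, h1, map_smul, LinearEquiv.trans_apply]
    exact Submodule.span_singleton_smul_eq (IsUnit.mk0 _ (pow_ne_zero n (hs' i))) _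
  refine ⟨U.trans A, _, fun i j hij => hp ?_, key⟩
  apply Projectivization.submodule_injective
  rw [key i, key j, show t i / (s i - μ * t i) = t j / (s j - μ * t j) from hij]

/-! ### Avoiding finitely many subspaces -/

theorem exists_linear_form {n : ℕ} {V : Submodule ℂ (Vec n)} (hV : V ≠ ⊤) :
    ∃ ψ : MvPolynomial (Fin (n + 1)) ℂ, ψ ≠ 0 ∧ ∀ x ∈ V, eval x ψ = 0 := by
  obtain ⟨f, hf, hV⟩ := Submodule.exists_le_ker_of_lt_top V (lt_top_iff_ne_top.2 hV)
  refine ⟨∑ j, C (f (Pi.single j 1)) * X j, fun h0 => hf ?_, fun x hx => ?_⟩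
  · refine LinearMap.pi_ext' fun j => LinearMap.ext_ring ?_
    have := congrArg (eval (Pi.single j (1 : ℂ))) h0
    simpa [Pi.single_apply] using this
  · have h2 : f x = ∑ j, f (Pi.single j 1) * x j := by
      conv_lhs => rw [LinearMap.pi_apply_eq_sum_univ f x]
      refine Finset.sum_congr rfl fun j _ => ?_
      rw [smul_eq_mul, mul_comm]
      congr 2
      funext k
      simp [Pi.single_apply, eq_comm]
    simpa [← h2] using hV hx

theorem exists_ne_zero_avoiding {n : ℕ} {ι : Type*} [Fintype ι]
    (V : ι → Submodule ℂ (Vec n)) (hV : ∀ i, V i ≠ ⊤) :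
    ∃ ψ : MvPolynomial (Fin (n + 1)) ℂ, ψ ≠ 0 ∧ ∀ x, eval x ψ ≠ 0 → ∀ i, x ∉ V i := by
  choose ψ hψ h using fun i => exists_linear_form (hV i)
  refine ⟨∏ i, ψ i, Finset.prod_ne_zero_iff.2 fun i _ => hψ i, fun x hx i hi => hx ?_⟩
  rw [map_prod]
  exact Finset.prod_eq_zero (Finset.mem_univ i) (h i x hi)

/-- Multiply by a nonzero product of linear forms vanishing on the `V i`; the products agree
everywhere. -/
theorem eq_of_eval_eq_avoiding {n : ℕ} {ι : Type*} [Fintype ι]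
    {V : ι → Submodule ℂ (Vec n)} (hV : ∀ i, V i ≠ ⊤) {P Q : MvPolynomial (Fin (n + 1)) ℂ}
    (h : ∀ x, (∀ i, x ∉ V i) → eval x P = eval x Q) : P = Q := by
  obtain ⟨ψ, hψ, hav⟩ := exists_ne_zero_avoiding V hV
  refine mul_right_cancel₀ hψ (MvPolynomial.funext fun x => ?_)
  rw [map_mul, map_mul]
  by_cases hx : eval x ψ = 0
  · rw [hx, mul_zero, mul_zero]
  · rw [h x (hav x hx)]

theorem exists_avoiding {n : ℕ} {ι : Type*} [Fintype ι]
    {V : ι → Submodule ℂ (Vec n)} (hV : ∀ i, V i ≠ ⊤) : ∃ x, ∀ i, x ∉ V i := by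
  by_contra! hcon
  have := eq_of_eval_eq_avoiding hV (P := 0) (Q := 1) fun x hx =>
    absurd (hcon x) (by push Not; exact hx)
  exact zero_ne_one this

theorem finrank_span_singleton_le {V : Type*} [AddCommGroup V] [Module ℂ V] (x : V) :
    Module.finrank ℂ (Submodule.span ℂ {x}) ≤ 1 := by
  have := finrank_span_le_card (R := ℂ) ({x} : Set V)
  rwa [Set.toFinset_singleton, Finset.card_singleton] at this

theorem ne_top_of_finrank_le {n m : ℕ} (hm : m ≤ n) {V : Submodule ℂ (Vec n)}
    (h : Module.finrank ℂ V ≤ m) : V ≠ ⊤ := by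
  rintro rfl
  rw [finrank_top, Module.finrank_fin_fun] at h
  omega

/-! ### Functions that are locally quotients of polynomials -/

/-- The restriction of a polynomial to the parametrized line `s ↦ a + s b`. -/
def along {σ : Type*} (a b : σ → ℂ) : MvPolynomial σ ℂ →ₐ[ℂ] Polynomial ℂ :=
  aeval fun i => Polynomial.C (a i) + Polynomial.C (b i) * Polynomial.X

theorem eval_along {σ : Type*} (a b : σ → ℂ) (P : MvPolynomial σ ℂ) (s : ℂ) :
    (along a b P).eval s = eval (a + s • b) P := by
  have h : (Polynomial.aeval s).comp (along a b) = aeval (a + s • b) := by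
    refine MvPolynomial.algHom_ext fun i => ?_
    rw [AlgHom.comp_apply, along, aeval_X, aeval_X]
    simp [mul_comm (b i)]
  rw [← Polynomial.coe_aeval_eq_eval, ← coe_aeval_eq_eval, ← h]
  rfl

/-- If `w` avoids every `V i + ℂ x`, the line from `x` to `w` misses all `V i`, so a nonconstant
restriction of `Q` would have a zero there. The sums are proper since `n ≥ 2`. -/
theorem eq_C_of_eval_ne_zero {n : ℕ} (hn : 2 ≤ n) {ι : Type*} [Fintype ι]
    {V : ι → Submodule ℂ (Vec n)} (hV : ∀ i, Module.finrank ℂ (V i) ≤ 1)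
    {Q : MvPolynomial (Fin (n + 1)) ℂ} (hQ : ∀ x, (∀ i, x ∉ V i) → eval x Q ≠ 0) :
    ∃ c, Q = C c := by
  obtain ⟨x, hx⟩ := exists_avoiding fun i => ne_top_of_finrank_le (by omega) (hV i)
  have hW : ∀ i, V i ⊔ Submodule.span ℂ {x} ≠ ⊤ := fun i => by
    refine ne_top_of_finrank_le hn ((Submodule.finrank_add_le_finrank_add_finrank _ _).trans ?_)
    have := finrank_span_singleton_le x
    have := hV i
    omega
  refine ⟨eval x Q, eq_of_eval_eq_avoiding hW fun w hw => ?_⟩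
  rw [eval_C]
  obtain ⟨q, hq⟩ : ∃ q : Polynomial ℂ, ∀ s, q.eval s = eval (x + s • (w - x)) Q :=
    ⟨_, eval_along x (w - x) Q⟩
  have hdeg : q.degree = 0 := by
    by_contra hne
    obtain ⟨s, hs⟩ := IsAlgClosed.exists_root q hne
    rw [Polynomial.IsRoot.def, hq] at hs
    refine hQ _ (fun i hi => ?_) hs
    by_cases h0 : s = 0
    · exact hx i (by simpa [h0] using hi)
    · refine hw i ?_
      have h1 : w = s⁻¹ • (x + s • (w - x)) + (1 - s⁻¹) • x := by
        rw [smul_add, smul_smul, inv_mul_cancel₀ h0, one_smul, sub_smul, one_smul]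
        abel
      rw [h1]
      exact Submodule.add_mem_sup (Submodule.smul_mem _ _ hi)
        (Submodule.smul_mem _ _ (Submodule.mem_span_singleton_self x))
  rw [Polynomial.eq_C_of_degree_eq_zero hdeg] at hq
  have h0 := hq 0
  have h1 := hq 1
  simp only [Polynomial.eval_C, zero_smul, add_zero, one_smul, add_sub_cancel] at h0 h1
  rw [← h0, ← h1]

/-- Hartogs' principle through unique factorization: the denominator of the reduced fraction divides
every local denominator, so it has no zero outside the `V i` and is constant. -/
theorem exists_polynomial_of_local_quotient {n : ℕ} (hn : 2 ≤ n) {ι : Type*} [Fintype ι]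
    {V : ι → Submodule ℂ (Vec n)} (hV : ∀ i, Module.finrank ℂ (V i) ≤ 1) {f : Vec n → ℂ}
    (hf : ∀ x, (∀ i, x ∉ V i) → ∃ P Q : MvPolynomial (Fin (n + 1)) ℂ, eval x Q ≠ 0 ∧
      ∀ w, (∀ i, w ∉ V i) → eval w Q ≠ 0 → f w = eval w P / eval w Q) :
    ∃ G : MvPolynomial (Fin (n + 1)) ℂ, ∀ x, (∀ i, x ∉ V i) → f x = eval x G := by
  have hV' : ∀ i, V i ≠ ⊤ := fun i => ne_top_of_finrank_le (by omega) (hV i)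
  obtain ⟨x₀, hx₀⟩ := exists_avoiding hV'
  obtain ⟨P, Q, hQ, hPQ⟩ := hf x₀ hx₀
  have hQ0 : Q ≠ 0 := by rintro rfl; simp at hQ
  obtain ⟨P', Q', c, hrel, rfl, rfl⟩ := UniqueFactorizationMonoid.exists_reduced_factors' P Q hQ0
  have key : ∀ x, (∀ i, x ∉ V i) → eval x Q' ≠ 0 ∧ f x * eval x Q' = eval x P' := by
    intro x hx
    obtain ⟨P₁, Q₁, hQ₁, hPQ₁⟩ := hf x hx
    have hQ₁0 : Q₁ ≠ 0 := by rintro rfl; simp at hQ₁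
    have h1 : (c * P' * Q₁) * ((c * Q') * Q₁) = P₁ * (c * Q') * ((c * Q') * Q₁) := by
      refine eq_of_eval_eq_avoiding hV' fun w hw => ?_
      by_cases h0 : eval w ((c * Q') * Q₁) = 0
      · rw [map_mul, h0, map_mul _ _ ((c * Q') * Q₁), h0, mul_zero, mul_zero]
      · rw [map_mul] at h0
        have h2 := hPQ w hw (left_ne_zero_of_mul h0)
        rw [hPQ₁ w hw (right_ne_zero_of_mul h0), div_eq_div_iff (right_ne_zero_of_mul h0)
          (left_ne_zero_of_mul h0)] at h2
        rw [map_mul, map_mul _ _ ((c * Q') * Q₁), map_mul _ (c * P') Q₁,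
          map_mul _ P₁ (c * Q'), h2]
    have h2 := mul_right_cancel₀ (mul_ne_zero hQ0 hQ₁0) h1
    have h3 : P' * Q₁ = P₁ * Q' := by
      refine mul_left_cancel₀ (left_ne_zero_of_mul hQ0) ?_
      rw [← mul_assoc, h2]; ring
    have h4 : Q' ∣ Q₁ := hrel.symm.dvd_of_dvd_mul_left ⟨P₁, by rw [h3, mul_comm]⟩
    have h5 : eval x Q' ≠ 0 := by
      obtain ⟨R, rfl⟩ := h4
      rw [map_mul] at hQ₁
      exact left_ne_zero_of_mul hQ₁
    refine ⟨h5, ?_⟩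
    have h6 := congrArg (eval x) h3
    rw [map_mul, map_mul] at h6
    rw [hPQ₁ x hx hQ₁]
    field_simp
    rw [← h6, mul_comm]
  obtain ⟨a, rfl⟩ := eq_C_of_eval_ne_zero hn hV fun x hx => (key x hx).1
  refine ⟨C a⁻¹ * P', fun x hx => ?_⟩
  obtain ⟨h1, h2⟩ := key x hx
  rw [eval_C] at h1 h2
  rw [map_mul, eval_C, ← h2]
  field_simp

/-! ### The multicone -/

section Cone

variable {n r : ℕ} {p : Fin r → ℙ ℂ (Vec n)}

theorem mem_cone {z : Ambient p} :
    z ∈ cone p ↔ z.1 ≠ 0 ∧ (∀ i, z.2 i ≠ 0) ∧ ∃ t, IsExcEq p z t := by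
  constructor
  · rintro ⟨h, h', hz⟩
    refine ⟨h, h', ?_⟩
    have : ∀ i, ∃ t : ℂ, (p i).submodule.mkQ z.1 = t • z.2 i := by
      intro i
      have h1 := hz i
      simp only [Projectivization.submodule_mk] at h1
      obtain ⟨t, ht⟩ := Submodule.mem_span_singleton.1
        (h1 (Submodule.mem_map_of_mem (Submodule.mem_span_singleton_self z.1)))
      exact ⟨t, ht.symm⟩
    choose t ht using this
    exact ⟨t, ht⟩
  · rintro ⟨h, h', t, ht⟩
    refine ⟨h, h', fun i => ?_⟩
    simp only [Projectivization.submodule_mk]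
    rw [Submodule.map_span_le]
    intro x hx
    rw [Set.mem_singleton_iff.1 hx, ht i]
    exact Submodule.smul_mem _ _ (Submodule.mem_span_singleton_self _)

theorem IsExcEq.unique {z : Ambient p} (hz : z ∈ cone p) {t t' : Fin r → ℂ}
    (ht : IsExcEq p z t) (ht' : IsExcEq p z t') : t = t' := by
  funext i
  exact smul_left_injective ℂ ((mem_cone.1 hz).2.1 i) ((ht i).symm.trans (ht' i))

/-- The coordinates on the blow-up of the points outside of the exceptional divisors. -/
def liftCone (p : Fin r → ℙ ℂ (Vec n)) : Vec n →ₗ[ℂ] Ambient p :=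
  LinearMap.prod LinearMap.id (LinearMap.pi fun i => (p i).submodule.mkQ)

theorem isExcEq_liftCone (x : Vec n) : IsExcEq p (liftCone p x) 1 :=
  fun _ => (one_smul _ _).symm

theorem liftCone_mem_cone (x : Off p) : liftCone p x.1 ∈ cone p :=
  mem_cone.2 ⟨x.2.1, fun i h => x.2.2 i ((Submodule.Quotient.mk_eq_zero _).1 h), _,
    isExcEq_liftCone x.1⟩

theorem polyFun_comp_linearMap {W : Type} [AddCommGroup W] [Module ℂ W] {m : ℕ}
    (φ : Vec m →ₗ[ℂ] W) {P : W → ℂ} (hP : P ∈ polyFun W) :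
    ∃ P' : MvPolynomial (Fin (m + 1)) ℂ, ∀ x, eval x P' = P (φ x) := by
  induction hP using Algebra.adjoin_induction with
  | mem f hf =>
    obtain ⟨ψ, rfl⟩ := hf
    refine ⟨∑ j, C ((ψ ∘ₗ φ) (Pi.single j 1)) * X j, fun x => ?_⟩
    have h := LinearMap.pi_apply_eq_sum_univ (ψ ∘ₗ φ) x
    rw [LinearMap.comp_apply] at h
    simp only []
    rw [h, map_sum]
    refine Finset.sum_congr rfl fun j _ => ?_
    rw [map_mul, eval_C, eval_X, smul_eq_mul, mul_comm]
    congr 2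
    funext k
    simp [Pi.single_apply, eq_comm]
  | algebraMap c => exact ⟨C c, fun x => eval_C c⟩
  | add f g _ _ hf hg =>
    obtain ⟨P, hP⟩ := hf
    obtain ⟨Q, hQ⟩ := hg
    exact ⟨P + Q, fun x => by rw [map_add, hP, hQ]; rfl⟩
  | mul f g _ _ hf hg =>
    obtain ⟨P, hP⟩ := hf
    obtain ⟨Q, hQ⟩ := hg
    exact ⟨P * Q, fun x => by rw [map_mul, hP, hQ]; rfl⟩

theorem polyFun_comp_line {W : Type} [AddCommGroup W] [Module ℂ W] (a b : W) {P : W → ℂ}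
    (hP : P ∈ polyFun W) : ∃ P' : Polynomial ℂ, ∀ s, P'.eval s = P (a + s • b) := by
  induction hP using Algebra.adjoin_induction with
  | mem f hf =>
    obtain ⟨ψ, rfl⟩ := hf
    exact ⟨Polynomial.C (ψ a) + Polynomial.X * Polynomial.C (ψ b),
      fun s => by simp [mul_comm s]⟩
  | algebraMap c => exact ⟨Polynomial.C c, fun x => Polynomial.eval_C⟩
  | add f g _ _ hf hg =>
    obtain ⟨P, hP⟩ := hf
    obtain ⟨Q, hQ⟩ := hg
    exact ⟨P + Q, fun x => by rw [Polynomial.eval_add, hP, hQ]; rfl⟩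
  | mul f g _ _ hf hg =>
    obtain ⟨P, hP⟩ := hf
    obtain ⟨Q, hQ⟩ := hg
    exact ⟨P * Q, fun x => by rw [Polynomial.eval_mul, hP, hQ]; rfl⟩

theorem finrank_point (i : Fin r) : Module.finrank ℂ (p i).submodule ≤ 1 :=
  (p i).finrank_submodule.le

/-- Points outside of all the `p i`, as elements of `Off p`. -/
def offMk (hr : 0 < r) (x : Vec n) (hx : ∀ i, x ∉ (p i).submodule) : Off p :=
  ⟨x, fun h => hx ⟨0, hr⟩ (h ▸ Submodule.zero_mem _), hx⟩

theorem exists_polynomial_of_mem_H0 (hn : 2 ≤ n) (hr : 0 < r) {D : Div r} {F : Off p → ℂ}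
    (hF : F ∈ H0 p D) : ∃ G : MvPolynomial (Fin (n + 1)) ℂ, ∀ x : Off p, F x = eval x.1 G := by
  classical
  obtain ⟨-, g, hg, hgF⟩ := hF
  let f : Vec n → ℂ := fun x => if h : ∀ i, x ∉ (p i).submodule then F (offMk hr x h) else 0
  have hf : ∀ x : Off p, f x.1 = F x := fun x => by
    simp only [f, dif_pos x.2.2]
    rfl
  have hfg : ∀ x : Off p, f x.1 = g (liftCone p x.1) := fun x => by
    rw [hf, hgF _ (liftCone_mem_cone x) 1 (isExcEq_liftCone x.1) x rfl]
    simp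
  obtain ⟨G, hG⟩ := exists_polynomial_of_local_quotient hn (V := fun i => (p i).submodule)
    finrank_point (f := f) fun x hx => by
      obtain ⟨P, hP, Q, hQ, hne, h⟩ := hg _ (liftCone_mem_cone (offMk hr x hx))
      obtain ⟨P', hP'⟩ := polyFun_comp_linearMap (liftCone p) hP
      obtain ⟨Q', hQ'⟩ := polyFun_comp_linearMap (liftCone p) hQ
      refine ⟨P', Q', by rw [hQ']; exact hne, fun w hw hwQ => ?_⟩
      rw [hQ'] at hwQ
      rw [hP', hQ']
      exact (hfg (offMk hr w hw)).trans (h _ (liftCone_mem_cone (offMk hr w hw)) hwQ)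
  exact ⟨G, fun x => by rw [← hf, hG x.1 x.2.2]⟩

theorem coeff_aeval_scale {σ : Type*} (c : ℂ) (P : MvPolynomial σ ℂ) (m : σ →₀ ℕ) :
    coeff m (aeval (fun i => C c * X i : σ → MvPolynomial σ ℂ) P) =
      c ^ m.degree * coeff m P := by
  classical
  induction P using MvPolynomial.induction_on' with
  | add p q hp hq => rw [map_add, coeff_add, hp, hq, coeff_add, mul_add]
  | monomial s a =>
    have : aeval (fun i => C c * X i : σ → MvPolynomial σ ℂ) (monomial s a) =
        monomial s (c ^ s.degree * a) := by
      rw [aeval_monomial, Finsupp.prod, Finset.prod_congr rfl fun i _ => mul_pow _ _ _,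
        Finset.prod_mul_distrib, Finset.prod_pow_eq_pow_sum, monomial_eq, ← C_pow,
        ← mul_assoc, algebraMap_eq, ← C_mul, mul_comm a]
      rfl
    rw [this, coeff_monomial, coeff_monomial]
    split_ifs with h
    · rw [h]
    · rw [mul_zero]

/-- Scaling by `2` alone separates the degrees, since the powers of `2` are distinct. -/
theorem degree_eq_of_eval_smul {m : ℕ} {ι : Type*} [Fintype ι] {V : ι → Submodule ℂ (Vec m)}
    (hV : ∀ i, V i ≠ ⊤) {G : MvPolynomial (Fin (m + 1)) ℂ} {d : ℤ}
    (h : ∀ x, (∀ i, x ∉ V i) → eval ((2 : ℂ) • x) G = (2 : ℂ) ^ d * eval x G)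
    {s : Fin (m + 1) →₀ ℕ} (hs : coeff s G ≠ 0) : (s.degree : ℤ) = d := by
  have h1 : aeval (fun i => C 2 * X i : _ → MvPolynomial (Fin (m + 1)) ℂ) G =
      C ((2 : ℂ) ^ d) * G := by
    refine eq_of_eval_eq_avoiding hV fun x hx => ?_
    rw [map_mul, eval_C, ← h x hx, ← coe_aeval_eq_eval, ← coe_aeval_eq_eval]
    have h2 : (aeval x : MvPolynomial (Fin (m + 1)) ℂ →ₐ[ℂ] ℂ).comp
        (aeval (fun i => C 2 * X i : _ → MvPolynomial (Fin (m + 1)) ℂ)) =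
        aeval ((2 : ℂ) • x) := MvPolynomial.algHom_ext fun i => by simp
    exact DFunLike.congr_fun h2 G
  have h3 := congrArg (coeff s) h1
  rw [coeff_aeval_scale, coeff_C_mul] at h3
  have h4 := mul_right_cancel₀ hs h3
  rw [← zpow_natCast] at h4
  have h5 := congrArg norm h4
  rw [norm_zpow, norm_zpow, Complex.norm_two] at h5
  exact zpow_right_injective₀ (by norm_num) (by norm_num) h5

end Cone

/-! ### Taylor expansion along lines -/

theorem eval_smul_of_isHomogeneous {σ : Type*} {P : MvPolynomial σ ℂ} {d : ℕ}
    (hP : P.IsHomogeneous d) (c : ℂ) (x : σ → ℂ) : eval (c • x) P = c ^ d * eval x P := by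
  have h1 : aeval (fun i => C c * X i : σ → MvPolynomial σ ℂ) P = C (c ^ d) * P := by
    ext m
    rw [coeff_aeval_scale, coeff_C_mul]
    by_cases hm : coeff m P = 0
    · rw [hm, mul_zero, mul_zero]
    · rw [show m.degree = d from (DFunLike.congr_fun Finsupp.degree_eq_weight_one m).trans (hP hm)]
  have h2 : (aeval x : MvPolynomial σ ℂ →ₐ[ℂ] ℂ).comp
      (aeval (fun i => C c * X i : σ → MvPolynomial σ ℂ)) = aeval (c • x) :=
    MvPolynomial.algHom_ext fun i => by simp
  rw [← coe_aeval_eq_eval, ← h2]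
  change aeval x (aeval (fun i => C c * X i : σ → MvPolynomial σ ℂ) P) = _
  rw [h1, map_mul, ← coe_aeval_eq_eval]
  simp

theorem natDegree_along_le {σ : Type*} {P : MvPolynomial σ ℂ} {d : ℕ}
    (hP : P.IsHomogeneous d) (a b : σ → ℂ) : (along a b P).natDegree ≤ d := by
  have := aeval_natDegree_le P hP.totalDegree_le
    (fun i => Polynomial.C (a i) + Polynomial.C (b i) * Polynomial.X) (n := 1) fun i => by
      rw [add_comm]; exact Polynomial.natDegree_linear_le
  rwa [mul_one] at this

theorem reflect_along {σ : Type*} {P : MvPolynomial σ ℂ} {d : ℕ} (hP : P.IsHomogeneous d)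
    (a b : σ → ℂ) : Polynomial.reflect d (along a b P) = along b a P := by
  refine mul_right_cancel₀ (Polynomial.X_ne_zero) (Polynomial.funext fun s => ?_)
  rw [Polynomial.eval_mul, Polynomial.eval_mul, Polynomial.eval_X]
  by_cases hs : s = 0
  · rw [hs, mul_zero, mul_zero]
  · congr 1
    have hs' : s⁻¹ ≠ 0 := inv_ne_zero hs
    let _ := invertibleOfNonzero hs'
    have h := Polynomial.eval₂_reflect_mul_pow (RingHom.id ℂ) s⁻¹ d (along a b P)
      (natDegree_along_le hP a b)
    rw [invOf_eq_inv, inv_inv, Polynomial.eval₂_id, Polynomial.eval₂_id, eval_along] at h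
    rw [eval_along, show b + s • a = s • (a + s⁻¹ • b) by
      rw [smul_add, smul_smul, mul_inv_cancel₀ hs, one_smul, add_comm],
      eval_smul_of_isHomogeneous hP, ← h, mul_comm, mul_assoc, ← mul_pow, inv_mul_cancel₀ hs,
      one_pow, mul_one]

/-- Exchanging base point and direction reverses the expansion of a form, so an order of vanishing
at a point becomes a degree bound in its direction. -/
theorem coeff_along_comm {σ : Type*} {P : MvPolynomial σ ℂ} {d : ℕ} (hP : P.IsHomogeneous d)
    (a b : σ → ℂ) {k : ℕ} (hk : k ≤ d) :
    (along a b P).coeff k = (along b a P).coeff (d - k) := by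
  rw [← reflect_along hP b a, Polynomial.coeff_reflect, Polynomial.revAt_le hk]

theorem derivative_along (z a : ℕ → ℂ) (P : MvPolynomial ℕ ℂ) :
    Polynomial.derivative (along z a P) = along z a (dop a P) := by
  have h : ∀ c, along z a (C c) = Polynomial.C c := fun c => by
    rw [along, ← algebraMap_eq, AlgHom.commutes]; rfl
  induction P using MvPolynomial.induction_on with
  | C c =>
    rw [dop_C, map_zero, h, Polynomial.derivative_C]
  | add P Q hP hQ => rw [map_add, map_add, hP, hQ, map_add, map_add]
  | mul_X P i hP =>
    have hX : along z a (X i) = Polynomial.C (z i) + Polynomial.C (a i) * Polynomial.X := by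
      rw [along, aeval_X]
    rw [dop_mul, dop_X, map_mul (along z a), map_add, map_mul (along z a), map_mul (along z a), h,
      Polynomial.derivative_mul, hP, hX]
    simp [add_comm]

theorem coeff_along (z a : ℕ → ℂ) (P : MvPolynomial ℕ ℂ) (k : ℕ) :
    (k.factorial : ℂ) * (along z a P).coeff k = eval z ((dop a ^ k) P) := by
  have h : ∀ k, Polynomial.derivative^[k] (along z a P) = along z a ((dop a ^ k) P) := by
    intro k
    induction k with
    | zero => rfl
    | succ k ih =>
      rw [Function.iterate_succ_apply', ih, derivative_along, pow_succ', Module.End.mul_apply]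
  have h1 := Polynomial.coeff_iterate_derivative (k := k) (along z a P) 0
  rw [h, Polynomial.coeff_zero_eq_eval_zero, eval_along, zero_smul, add_zero, zero_add,
    Nat.descFactorial_self, nsmul_eq_mul] at h1
  exact h1.symm

theorem eval_add_smul_eq_sum (z a : ℕ → ℂ) {P : MvPolynomial ℕ ℂ} {b : ℕ}
    (hP : ∀ k, b < k → (dop a ^ k) P = 0) (s : ℂ) :
    eval (z + s • a) P =
      ∑ k ∈ Finset.range (b + 1), (k.factorial : ℂ)⁻¹ * eval z ((dop a ^ k) P) * s ^ k := by
  rw [← eval_along, Polynomial.eval_eq_sum_range' (n := b + 1)]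
  · refine Finset.sum_congr rfl fun k _ => ?_
    rw [← coeff_along, inv_mul_cancel_left₀ (Nat.cast_ne_zero.2 k.factorial_ne_zero)]
  · rw [Nat.lt_succ_iff, Polynomial.natDegree_le_iff_coeff_eq_zero]
    intro k hk
    have := coeff_along z a P k
    rw [hP k hk, map_zero] at this
    exact (mul_eq_zero.1 this).resolve_left (Nat.cast_ne_zero.2 k.factorial_ne_zero)

/-! ### Sections of a divisor as polynomials in the moments -/

/-- Extension by zero of a vector. -/
def extVec (n : ℕ) : Vec n →ₗ[ℂ] (ℕ → ℂ) :=
  LinearMap.pi fun i => if h : i < n + 1 then LinearMap.proj ⟨i, h⟩ else 0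

theorem extVec_apply {n : ℕ} (z : Vec n) (j : Fin (n + 1)) : extVec n z j = z j := by
  simp only [extVec, LinearMap.pi_apply, dif_pos j.2, LinearMap.proj_apply]

theorem eval_extVec_rename {n : ℕ} (z : Vec n) (G : MvPolynomial (Fin (n + 1)) ℂ) :
    eval (extVec n z) (rename Fin.val G) = eval z G := by
  rw [eval_rename]
  congr 2
  funext j
  exact extVec_apply z j

theorem eval_congr_of_supported {n : ℕ} {P : MvPolynomial ℕ ℂ}
    (hP : P ∈ supported ℂ {i | i + 2 ≤ n + 2}) {z w : ℕ → ℂ} (h : ∀ i ≤ n, z i = w i) :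
    eval z P = eval w P := by
  refine eval₂Hom_congr' rfl (fun i hi _ => h i ?_) rfl
  exact Nat.le_of_add_le_add_right (mem_supported.1 hP hi)

theorem rename_val_supported {n : ℕ} (G : MvPolynomial (Fin (n + 1)) ℂ) :
    rename Fin.val G ∈ supported ℂ {i | i + 2 ≤ n + 2} := by
  classical
  rw [mem_supported]
  intro i hi
  obtain ⟨j, -, rfl⟩ := Finset.mem_image.1 (vars_rename _ _ hi)
  have := j.2
  simp only [Set.mem_ofPred_eq]
  omega

theorem eval_mem_polyFun {W : Type} [AddCommGroup W] [Module ℂ W] {σ : Type*}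
    (φ : W →ₗ[ℂ] (σ → ℂ)) (P : MvPolynomial σ ℂ) : (fun w => eval (φ w) P) ∈ polyFun W := by
  induction P using MvPolynomial.induction_on with
  | C c =>
    simp only [eval_C]
    exact (polyFun W).algebraMap_mem c
  | add P Q hP hQ =>
    simp only [map_add]
    exact add_mem hP hQ
  | mul_X P i hP =>
    have : (fun w => φ w i) ∈ polyFun W := Algebra.subset_adjoin ⟨LinearMap.proj i ∘ₗ φ, rfl⟩
    simp only [map_mul, eval_X]
    exact mul_mem hP this

section Sections

variable {n r : ℕ} {p : Fin r → ℙ ℂ (Vec n)}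

/-- The function on the complement of the `p i` given by a polynomial in the moments, in the
coordinates defined by `B`. -/
def sec (p : Fin r → ℙ ℂ (Vec n)) (B : Vec n ≃ₗ[ℂ] Vec n) :
    MvPolynomial ℕ ℂ →ₐ[ℂ] (Off p → ℂ) :=
  AlgHom.pi fun x => aeval (extVec n (B.symm x.1))

theorem sec_apply (B : Vec n ≃ₗ[ℂ] Vec n) (P : MvPolynomial ℕ ℂ) (x : Off p) :
    sec p B P x = eval (extVec n (B.symm x.1)) P := by
  rw [← coe_aeval_eq_eval]; rfl

theorem exists_sec_eq_of_mem_H0 (hn : 2 ≤ n) (hr : 0 < r) (B : Vec n ≃ₗ[ℂ] Vec n) {D : Div r}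
    {F : Off p → ℂ} (hF : F ∈ H0 p D) :
    ∃ G : MvPolynomial (Fin (n + 1)) ℂ, F = sec p B (rename Fin.val G) := by
  obtain ⟨G, hG⟩ := exists_polynomial_of_mem_H0 hn hr hF
  obtain ⟨G', hG'⟩ := polyFun_comp_linearMap B.toLinearMap
    (eval_mem_polyFun (LinearMap.id : Vec n →ₗ[ℂ] Vec n) G)
  refine ⟨G', ?_⟩
  funext x
  rw [sec_apply, eval_extVec_rename, hG', hG]
  simp

variable {B : Vec n ≃ₗ[ℂ] Vec n} {lam : Fin r → ℂ}

theorem mem_point_iff (hB : ∀ i, (p i).submodule = Submodule.span ℂ {B (mom n (lam i))})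
    (i : Fin r) (z : Vec n) : B z ∈ (p i).submodule ↔ z ∈ Submodule.span ℂ {mom n (lam i)} := by
  rw [hB i, Submodule.mem_span_singleton, Submodule.mem_span_singleton]
  refine exists_congr fun c => ?_
  rw [← map_smul, B.injective.eq_iff]

theorem span_mom_ne_top (hn : 2 ≤ n) (y : ℂ) : Submodule.span ℂ {mom n y} ≠ ⊤ :=
  ne_top_of_finrank_le (by omega) (finrank_span_singleton_le _)

theorem span_mom_sup_ne_top (hn : 2 ≤ n) (y y' : ℂ) :
    Submodule.span ℂ {mom n y} ⊔ Submodule.span ℂ {mom n y'} ≠ ⊤ := by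
  refine ne_top_of_finrank_le hn ((Submodule.finrank_add_le_finrank_add_finrank _ _).trans ?_)
  have := finrank_span_singleton_le (mom n y)
  have := finrank_span_singleton_le (mom n y')
  omega

theorem isHomogeneous_of_mem_H0 (hn : 2 ≤ n) (hr : 0 < r)
    (hB : ∀ i, (p i).submodule = Submodule.span ℂ {B (mom n (lam i))}) {D : Div r}
    {G : MvPolynomial (Fin (n + 1)) ℂ} (hF : sec p B (rename Fin.val G) ∈ H0 p D)
    {s : Fin (n + 1) →₀ ℕ} (hs : coeff s G ≠ 0) : (s.degree : ℤ) = D.1 := by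
  refine degree_eq_of_eval_smul (fun i => span_mom_ne_top hn (lam i)) (fun z hz => ?_) hs
  have hz' : ∀ i, B z ∉ (p i).submodule := fun i => by rw [mem_point_iff hB]; exact hz i
  have hz2 : ∀ i, B ((2 : ℂ) • z) ∉ (p i).submodule := fun i => by
    rw [map_smul, Submodule.smul_mem_iff _ two_ne_zero]; exact hz' i
  have := hF.1 2 (offMk hr _ hz') (offMk hr _ hz2) two_ne_zero (map_smul _ _ _)
  rw [sec_apply, sec_apply, eval_extVec_rename, eval_extVec_rename] at this
  simpa [offMk] using this

end Sections

/-! ### Orders of vanishing of sections at the blown-up points -/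

section Multiplicity

variable {n r : ℕ} {p : Fin r → ℙ ℂ (Vec n)} {B : Vec n ≃ₗ[ℂ] Vec n} {lam : Fin r → ℂ}

theorem mom_ne_zero (y : ℂ) : mom n y ≠ 0 := fun h => by
  simpa [mom] using congrFun h 0

theorem eq_of_mom_mem_span (hn : 2 ≤ n) {y y' : ℂ} (h : mom n y ∈ Submodule.span ℂ {mom n y'}) :
    y = y' := by
  obtain ⟨c, hc⟩ := Submodule.mem_span_singleton.1 h
  have h0 : c = 1 := by simpa [mom] using congrFun hc 0
  have h1 := congrFun hc ⟨1, by omega⟩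
  simpa [mom, h0, eq_comm] using h1

theorem add_smul_notMem_span {y y' : ℂ} {z : Vec n}
    (hz : z ∉ Submodule.span ℂ {mom n y} ⊔ Submodule.span ℂ {mom n y'}) {s : ℂ} (hs : s ≠ 0) :
    mom n y + s • z ∉ Submodule.span ℂ {mom n y'} := by
  intro h
  refine hz ?_
  have h1 : z = -s⁻¹ • mom n y + s⁻¹ • (mom n y + s • z) := by
    rw [smul_add, smul_smul, inv_mul_cancel₀ hs, one_smul, neg_smul]
    abel
  rw [h1]
  exact Submodule.add_mem_sup (Submodule.smul_mem _ _ (Submodule.mem_span_singleton_self _))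
    (Submodule.smul_mem _ _ h)

/-- A line in the multicone that crosses `E i` in the direction `z`: in the `i`-th component the
class of `s • z` is divided by `s`, so that `s` is the equation of `E i` and all other equations
equal `1`. -/
theorem exists_curve (hn : 2 ≤ n) (hlam : Function.Injective lam)
    (hB : ∀ i, (p i).submodule = Submodule.span ℂ {B (mom n (lam i))}) {i : Fin r} {z : Vec n}
    (hz : ∀ j, z ∉ Submodule.span ℂ {mom n (lam i)} ⊔ Submodule.span ℂ {mom n (lam j)}) :
    ∃ a b : Ambient p, ∀ s : ℂ, (a + s • b).1 = B (mom n (lam i) + s • z) ∧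
      (IsExcEq p (a + s • b) fun j => if j = i then s else 1) ∧ a + s • b ∈ cone p ∧
      (s ≠ 0 → ∀ j, B (mom n (lam i) + s • z) ∉ (p j).submodule) := by
  set v := mom n (lam i) with hv
  have hnot : ∀ (s : ℂ) (j : Fin r), s ≠ 0 ∨ j ≠ i → B (v + s • z) ∉ (p j).submodule := by
    intro s j h
    rw [mem_point_iff hB]
    by_cases hs : s = 0
    · rw [hs, zero_smul, add_zero]
      exact fun hmem => (h.resolve_left (not_not.2 hs)) (hlam (eq_of_mom_mem_span hn hmem)).symm
    · exact add_smul_notMem_span (hz j) hs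
  have hvi : (p i).submodule.mkQ (B v) = 0 := by
    rw [Submodule.mkQ_apply, Submodule.Quotient.mk_eq_zero, mem_point_iff hB]
    exact Submodule.mem_span_singleton_self _
  let a : Ambient p := (B v, fun j => if j = i then (p j).submodule.mkQ (B z)
    else (p j).submodule.mkQ (B v))
  let b : Ambient p := (B z, fun j => if j = i then 0 else (p j).submodule.mkQ (B z))
  have h1 : ∀ s : ℂ, (a + s • b).1 = B (v + s • z) := fun s => by
    simp [a, b]
  have h2 : ∀ (s : ℂ) (j : Fin r), (a + s • b).2 j = if j = i then (p j).submodule.mkQ (B z)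
      else (p j).submodule.mkQ (B (v + s • z)) := fun s j => by
    by_cases h : j = i <;> simp [a, b, h]
  have hexc : ∀ s : ℂ, IsExcEq p (a + s • b) fun j => if j = i then s else 1 := by
    intro s j
    rw [h1, h2]
    beta_reduce
    by_cases h : j = i
    · subst h
      rw [if_pos rfl, if_pos rfl, map_add, map_smul, map_add, map_smul, hvi, zero_add]
    · rw [if_neg h, if_neg h, one_smul]
  have hcone : ∀ s : ℂ, a + s • b ∈ cone p := by
    intro s
    refine mem_cone.2 ⟨?_, fun j => ?_, _, hexc s⟩
    · rw [h1]
      by_cases hs : s = 0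
      · rw [hs, zero_smul, add_zero]
        exact (LinearEquiv.map_ne_zero_iff B).2 (mom_ne_zero _)
      · exact fun h => hnot s i (Or.inl hs) (h ▸ Submodule.zero_mem _)
    · rw [h2]
      by_cases h : j = i
      · rw [if_pos h, h, Submodule.mkQ_apply, Ne, Submodule.Quotient.mk_eq_zero, mem_point_iff hB]
        exact fun hmem => hz i (Submodule.mem_sup_left hmem)
      · rw [if_neg h, Submodule.mkQ_apply, Ne, Submodule.Quotient.mk_eq_zero]
        exact hnot s j (Or.inr h)
  exact ⟨a, b, fun s => ⟨h1 s, hexc s, hcone s, fun hs j => hnot s j (Or.inl hs)⟩⟩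

/-- Restriction of a section to a line through `p i` shows its multiplicity there. -/
theorem X_pow_dvd_along (hn : 2 ≤ n) (hr : 0 < r) (hlam : Function.Injective lam)
    (hB : ∀ i, (p i).submodule = Submodule.span ℂ {B (mom n (lam i))}) {D : Div r}
    {G : MvPolynomial (Fin (n + 1)) ℂ} (hF : sec p B (rename Fin.val G) ∈ H0 p D)
    {i : Fin r} {m : ℕ} (hm : D.2 i = -m) {z : Vec n}
    (hz : ∀ j, z ∉ Submodule.span ℂ {mom n (lam i)} ⊔ Submodule.span ℂ {mom n (lam j)}) :
    Polynomial.X ^ m ∣ along (mom n (lam i)) z G := by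
  obtain ⟨-, g, hg, hgF⟩ := hF
  obtain ⟨a, b, hab⟩ := exists_curve hn hlam hB hz
  set v := mom n (lam i) with hv
  obtain ⟨P, hP, Q, hQ, hQ0, hPQ⟩ := hg _ (hab 0).2.2.1
  obtain ⟨P', hP'⟩ := polyFun_comp_line a b hP
  obtain ⟨Q', hQ'⟩ := polyFun_comp_line a b hQ
  rw [← hQ'] at hQ0
  have hQne : Q' ≠ 0 := by rintro rfl; simp at hQ0
  have key : along v z G * Q' = P' * Polynomial.X ^ m := by
    refine mul_right_cancel₀ (mul_ne_zero hQne Polynomial.X_ne_zero)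
      (Polynomial.funext fun s => ?_)
    rw [Polynomial.eval_mul (p := along v z G * Q'),
      Polynomial.eval_mul (p := P' * Polynomial.X ^ m)]
    by_cases hs : (Q' * Polynomial.X).eval s = 0
    · rw [hs, mul_zero, mul_zero]
    · rw [Polynomial.eval_mul, Polynomial.eval_X] at hs
      have hs0 : s ≠ 0 := right_ne_zero_of_mul hs
      have hQs : Q (a + s • b) ≠ 0 := by rw [← hQ']; exact left_ne_zero_of_mul hs
      have h3 := hPQ _ (hab s).2.2.1 hQs
      rw [hgF _ (hab s).2.2.1 _ (hab s).2.1 (offMk hr _ ((hab s).2.2.2 hs0)) (hab s).1,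
        Finset.prod_eq_single i (fun j _ hj => by rw [if_neg hj, one_zpow]) (by simp),
        if_pos rfl, hm, zpow_neg, zpow_natCast, sec_apply, eval_extVec_rename, ← hP', ← hQ'] at h3
      have h4 : eval (v + s • z) G * (s ^ m)⁻¹ = P'.eval s / Q'.eval s := by
        simpa [offMk] using h3
      congr 1
      rw [Polynomial.eval_mul, Polynomial.eval_mul, eval_along, Polynomial.eval_pow,
        Polynomial.eval_X]
      have h5 := left_ne_zero_of_mul hs
      have h6 := pow_ne_zero m hs0
      field_simp at h4
      rw [h4, mul_comm]
  have hdvd : Polynomial.X ^ m ∣ along v z G * Q' := by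
    rw [key]
    exact dvd_mul_left _ _
  refine Polynomial.prime_X.pow_dvd_of_dvd_mul_right m ?_ hdvd
  rwa [Polynomial.X_dvd_iff, Polynomial.coeff_zero_eq_eval_zero]

theorem along_rename {n : ℕ} (z a : ℕ → ℂ) (G : MvPolynomial (Fin (n + 1)) ℂ) :
    along z a (rename Fin.val G) = along (fun j : Fin (n + 1) => z j) (fun j => a j) G := by
  rw [along, aeval_rename]
  rfl

theorem exists_rename_eq {n : ℕ} {P : MvPolynomial ℕ ℂ}
    (hP : P ∈ supported ℂ {i | i + 2 ≤ n + 2}) :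
    ∃ G : MvPolynomial (Fin (n + 1)) ℂ, rename Fin.val G = P := by
  refine exists_rename_eq_of_vars_subset_range P Fin.val Fin.val_injective fun i hi => ?_
  have : i + 2 ≤ n + 2 := mem_supported.1 hP hi
  exact ⟨⟨i, by omega⟩, rfl⟩

/-- By `coeff_along_comm`, the coefficient of order `k` in the direction of the point is the
coefficient of order `d - k` on a general line through it, which vanishes because `d - k < -e i`. -/
theorem dop_pow_eq_zero_of_mem_H0 (hn : 2 ≤ n) (hr : 0 < r) (hlam : Function.Injective lam)
    (hB : ∀ i, (p i).submodule = Submodule.span ℂ {B (mom n (lam i))}) {d : ℕ} {e : Fin r → ℤ}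
    {G : MvPolynomial (Fin (n + 1)) ℂ} (hG : G.IsHomogeneous d)
    (hF : sec p B (rename Fin.val G) ∈ H0 p ((d : ℤ), e)) (i : Fin r) {k : ℕ}
    (hk : d + e i < k) : (dop (pt (lam i)) ^ k) (rename Fin.val G) = 0 := by
  rcases lt_or_ge d k with hdk | hdk
  · exact dop_pow_eq_zero _ hG.rename_isHomogeneous hdk
  obtain ⟨m, hm⟩ : ∃ m : ℕ, e i = -m := ⟨(-e i).toNat, by omega⟩
  obtain ⟨Q, hQ⟩ := exists_rename_eq (dop_pow_supported (pt (lam i)) (rename_val_supported G) (j := k))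
  rw [← hQ]
  suffices h : Q = 0 by rw [h, map_zero]
  refine eq_of_eval_eq_avoiding (fun j => span_mom_sup_ne_top hn (lam i) (lam j)) fun z hz => ?_
  rw [map_zero, ← eval_extVec_rename, hQ, ← coeff_along, along_rename]
  simp only [extVec_apply]
  change _ * (along z (mom n (lam i)) G).coeff k = 0
  rw [coeff_along_comm hG _ _ hdk, Polynomial.X_pow_dvd_iff.1
    (X_pow_dvd_along hn hr hlam hB hF hm hz) _ (by omega), mul_zero]

end Multiplicity

/-! ### Local regularity -/

section RegAt

variable {W : Type} [AddCommGroup W] [Module ℂ W] {S : Set W} {z : W}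

/-- The functions that are quotients of polynomials on `S` near `z`. -/
def regAt (S : Set W) (z : W) : Subalgebra ℂ (W → ℂ) where
  carrier := {g | ∃ P ∈ polyFun W, ∃ Q ∈ polyFun W,
    Q z ≠ 0 ∧ ∀ w ∈ S, Q w ≠ 0 → g w = P w / Q w}
  add_mem' := by
    rintro f g ⟨P, hP, Q, hQ, hQz, h⟩ ⟨P', hP', Q', hQ', hQz', h'⟩
    refine ⟨P * Q' + Q * P', add_mem (mul_mem hP hQ') (mul_mem hQ hP'), Q * Q', mul_mem hQ hQ',
      mul_ne_zero hQz hQz', fun w hw hne => ?_⟩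
    have h1 : Q w ≠ 0 := left_ne_zero_of_mul hne
    have h2 : Q' w ≠ 0 := right_ne_zero_of_mul hne
    simp only [Pi.add_apply, Pi.mul_apply, h w hw h1, h' w hw h2]
    exact div_add_div _ _ h1 h2
  mul_mem' := by
    rintro f g ⟨P, hP, Q, hQ, hQz, h⟩ ⟨P', hP', Q', hQ', hQz', h'⟩
    refine ⟨P * P', mul_mem hP hP', Q * Q', mul_mem hQ hQ',
      mul_ne_zero hQz hQz', fun w hw hne => ?_⟩
    have h1 : Q w ≠ 0 := left_ne_zero_of_mul hne
    have h2 : Q' w ≠ 0 := right_ne_zero_of_mul hne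
    simp only [Pi.mul_apply, h w hw h1, h' w hw h2]
    exact div_mul_div_comm _ _ _ _
  algebraMap_mem' c := ⟨_, (polyFun W).algebraMap_mem c, 1, (polyFun W).one_mem, one_ne_zero,
    fun w _ _ => by simp⟩

theorem mem_regAt_of_polyFun {P : W → ℂ} (hP : P ∈ polyFun W) : P ∈ regAt S z :=
  ⟨P, hP, 1, (polyFun W).one_mem, one_ne_zero, fun w _ _ => by simp⟩

theorem exists_ne_zero_near {f : W → ℂ} (hf : f ∈ regAt S z) (hz : z ∈ S) (h0 : f z ≠ 0) :
    ∃ R ∈ polyFun W, R z ≠ 0 ∧ ∀ w ∈ S, R w ≠ 0 → f w ≠ 0 := by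
  obtain ⟨P, hP, Q, hQ, hQz, h⟩ := hf
  rw [h z hz hQz] at h0
  refine ⟨P * Q, mul_mem hP hQ, mul_ne_zero (div_ne_zero_iff.1 h0).1 hQz, fun w hw hne => ?_⟩
  rw [h w hw (right_ne_zero_of_mul hne)]
  exact div_ne_zero (left_ne_zero_of_mul hne) (right_ne_zero_of_mul hne)

theorem inv_mem_regAt {f : W → ℂ} (hf : f ∈ regAt S z) (hz : z ∈ S) (h0 : f z ≠ 0) :
    (fun w => (f w)⁻¹) ∈ regAt S z := by
  obtain ⟨P, hP, Q, hQ, hQz, h⟩ := hf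
  rw [h z hz hQz] at h0
  refine ⟨Q * Q, mul_mem hQ hQ, P * Q, mul_mem hP hQ, mul_ne_zero (div_ne_zero_iff.1 h0).1 hQz,
    fun w hw hne => ?_⟩
  have h1 := right_ne_zero_of_mul hne
  simp only [Pi.mul_apply, h w hw h1]
  rw [inv_div, mul_div_mul_right _ _ h1]

theorem zpow_mem_regAt {f : W → ℂ} (hf : f ∈ regAt S z) (hz : z ∈ S) (h0 : f z ≠ 0) (e : ℤ) :
    (fun w => f w ^ e) ∈ regAt S z := by
  obtain ⟨m, rfl | rfl⟩ := e.eq_nat_or_neg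
  · simp only [zpow_natCast]
    exact pow_mem hf m
  · simp only [zpow_neg, zpow_natCast, ← inv_pow]
    exact pow_mem (inv_mem_regAt hf hz h0) m

theorem mem_regAt_congr {f g R : W → ℂ} (hf : f ∈ regAt S z) (hR : R ∈ polyFun W) (hRz : R z ≠ 0)
    (h : ∀ w ∈ S, R w ≠ 0 → g w = f w) : g ∈ regAt S z := by
  obtain ⟨P, hP, Q, hQ, hQz, h'⟩ := hf
  refine ⟨P * R, mul_mem hP hR, Q * R, mul_mem hQ hR, mul_ne_zero hQz hRz, fun w hw hne => ?_⟩
  have h1 := right_ne_zero_of_mul hne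
  rw [h w hw h1, h' w hw (left_ne_zero_of_mul hne), Pi.mul_apply, Pi.mul_apply,
    mul_div_mul_right _ _ h1]

end RegAt

/-! ### Polynomials with prescribed multiplicities are sections -/

/-- The Taylor term of order `k` in the direction `a` carries `t ^ (d - k)`; multiplied by `t ^ (b -
d)` it becomes `t ^ (b - k)` with `k ≤ b`, which extends to `t = 0`. -/
theorem eval_mul_zpow {P : MvPolynomial ℕ ℂ} {d b : ℕ} (hP : P.IsHomogeneous d) {a : ℕ → ℂ}
    (h : ∀ k, b < k → (dop a ^ k) P = 0) (y : ℕ → ℂ) {t : ℂ} (ht : t ≠ 0) (s : ℂ) :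
    eval (t • y + s • a) P * t ^ ((b : ℤ) - d) = ∑ k ∈ Finset.range (b + 1),
      (k.factorial : ℂ)⁻¹ * eval y ((dop a ^ k) P) * s ^ k * t ^ (b - k) := by
  rw [eval_add_smul_eq_sum _ _ h, Finset.sum_mul]
  refine Finset.sum_congr rfl fun k hk => ?_
  have hk' : k ≤ b := Nat.lt_succ_iff.1 (Finset.mem_range.1 hk)
  rcases lt_or_ge d k with hdk | hdk
  · simp [dop_pow_eq_zero a hP hdk]
  · have h1 : ((dop a ^ k) P).IsHomogeneous (d - k) :=
      isHomogeneous_dop_pow a (by rwa [Nat.sub_add_cancel hdk])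
    rw [eval_smul_of_isHomogeneous h1]
    have h2 : t ^ (d - k) * t ^ ((b : ℤ) - d) = t ^ (b - k) := by
      rw [← zpow_natCast, ← zpow_natCast, ← zpow_add₀ ht]
      congr 1
      omega
    rw [← h2]
    ring

section Extension

variable {n r : ℕ} {p : Fin r → ℙ ℂ (Vec n)}

open Classical in
/-- The equations of the exceptional divisors, as functions on the multicone. -/
def exc (z : Ambient p) : Fin r → ℂ := if h : ∃ t, IsExcEq p z t then h.choose else 0

theorem isExcEq_exc {z : Ambient p} (hz : z ∈ cone p) : IsExcEq p z (exc z) := by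
  have h := (mem_cone.1 hz).2.2
  rw [exc, dif_pos h]
  exact h.choose_spec

theorem exc_mem_regAt {z : Ambient p} (hz : z ∈ cone p) (i : Fin r) :
    (fun w => exc w i) ∈ regAt (cone p) z := by
  obtain ⟨φ, hφ⟩ : ∃ φ : Module.Dual ℂ (Dir p i), φ (z.2 i) ≠ 0 := by
    by_contra! hcon
    exact (mem_cone.1 hz).2.1 i ((Module.forall_dual_apply_eq_zero_iff ℂ _).1 hcon)
  refine ⟨fun w => φ ((p i).submodule.mkQ w.1),
    Algebra.subset_adjoin ⟨φ ∘ₗ (p i).submodule.mkQ ∘ₗ LinearMap.fst ℂ _ _, rfl⟩,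
    fun w => φ (w.2 i),
    Algebra.subset_adjoin ⟨φ ∘ₗ LinearMap.proj i ∘ₗ LinearMap.snd ℂ _ _, rfl⟩, hφ,
    fun w hw hne => ?_⟩
  beta_reduce at hne ⊢
  rw [isExcEq_exc hw i, map_smul, smul_eq_mul, mul_div_cancel_right₀ _ hne]

/-- At most one exceptional equation vanishes at a point of the multicone. Near it the others are
units, and the corresponding `K i` provides the extension. -/
theorem exists_glue (hT : ∀ z ∈ cone p, ∃ i, ∀ j, j ≠ i → exc z j ≠ 0) (e : Fin r → ℤ)
    (f : Ambient p → ℂ) (K : Fin r → Ambient p → ℂ)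
    (hreg : ∀ i, ∀ z ∈ cone p, K i ∈ regAt (cone p) z)
    (hK : ∀ i, ∀ z ∈ cone p, exc z i ≠ 0 → K i z = f z * exc z i ^ e i) :
    ∃ g, IsRegularOn (cone p) g ∧
      ∀ z ∈ cone p, (∀ i, exc z i ≠ 0) → g z = f z * ∏ i, exc z i ^ e i := by
  classical
  let g : Ambient p → ℂ := fun z =>
    if h : ∃ i, exc z i = 0 then K h.choose z * ∏ j ∈ Finset.univ.erase h.choose, exc z j ^ e j
    else f z * ∏ i, exc z i ^ e i
  have hg : ∀ z ∈ cone p, ∀ i, (∀ j, j ≠ i → exc z j ≠ 0) →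
      g z = K i z * ∏ j ∈ Finset.univ.erase i, exc z j ^ e j := by
    intro z hz i hi
    by_cases h : ∃ i, exc z i = 0
    · have h1 : h.choose = i := by
        by_contra hne
        exact hi _ hne h.choose_spec
      simp only [g, dif_pos h, h1]
    · simp only [g, dif_neg h]
      push Not at h
      rw [hK i z hz (h i), mul_assoc, Finset.mul_prod_erase _ (fun j => exc z j ^ e j)
        (Finset.mem_univ i)]
  refine ⟨g, fun z hz => ?_, fun z hz h => ?_⟩
  · obtain ⟨i, hi⟩ := hT z hz
    have h1 : (fun w : Ambient p => ∏ j ∈ Finset.univ.erase i, exc w j) ∈ regAt (cone p) z := by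
      have := prod_mem (S := regAt (cone p) z) (t := Finset.univ.erase i)
        (f := fun j w => exc w j) fun j _ => exc_mem_regAt hz j
      convert this using 1
      funext w
      rw [Finset.prod_apply]
    have h2 : (fun w : Ambient p => ∏ j ∈ Finset.univ.erase i, exc w j ^ e j) ∈
        regAt (cone p) z := by
      have := prod_mem (S := regAt (cone p) z) (t := Finset.univ.erase i)
        (f := fun j w => exc w j ^ e j) fun j hj =>
          zpow_mem_regAt (exc_mem_regAt hz j) hz (hi j (Finset.ne_of_mem_erase hj)) (e j)
      convert this using 1
      funext w
      rw [Finset.prod_apply]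
    obtain ⟨R, hR, hRz, hRw⟩ := exists_ne_zero_near h1 hz
      (Finset.prod_ne_zero_iff.2 fun j hj => hi j (Finset.ne_of_mem_erase hj))
    exact mem_regAt_congr (mul_mem (hreg i z hz) h2) hR hRz fun w hw hne =>
      hg w hw i fun j hj => Finset.prod_ne_zero_iff.1 (hRw w hw hne) j
        (Finset.mem_erase.2 ⟨hj, Finset.mem_univ j⟩)
  · have : ¬ ∃ i, exc z i = 0 := by push Not; exact h
    simp only [g, dif_neg this]

variable {B : Vec n ≃ₗ[ℂ] Vec n} {lam : Fin r → ℂ}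

theorem exists_forall_exc_ne_zero (hn : 2 ≤ n) (hr : 0 < r) (hlam : Function.Injective lam)
    (hB : ∀ i, (p i).submodule = Submodule.span ℂ {B (mom n (lam i))}) {z : Ambient p}
    (hz : z ∈ cone p) : ∃ i, ∀ j, j ≠ i → exc z j ≠ 0 := by
  have hmem : ∀ i, exc z i = 0 → z.1 ∈ (p i).submodule := fun i hi => by
    have := isExcEq_exc hz i
    rwa [hi, zero_smul, Submodule.mkQ_apply, Submodule.Quotient.mk_eq_zero] at this
  by_cases h : ∃ i, exc z i = 0
  · obtain ⟨i, hi⟩ := h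
    refine ⟨i, fun j hj hj0 => hj ?_⟩
    have h1 := hmem i hi
    rw [hB i, Submodule.mem_span_singleton] at h1
    obtain ⟨c, hc⟩ := h1
    have hc0 : c ≠ 0 := by
      rintro rfl
      exact (mem_cone.1 hz).1 (by rw [← hc, zero_smul])
    have h2 := hmem j hj0
    rw [← hc, Submodule.smul_mem_iff _ hc0, mem_point_iff hB] at h2
    exact (hlam (eq_of_mom_mem_span hn h2)).symm
  · push Not at h
    exact ⟨⟨0, hr⟩, fun j _ => h j⟩

/-- A linear section of the quotient map. The component along the point is read off in coordinate
`0`, where `mom n y` has entry `1`. -/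
theorem exists_splitting
    (hB : ∀ i, (p i).submodule = Submodule.span ℂ {B (mom n (lam i))}) (i : Fin r) :
    ∃ (σ : Dir p i →ₗ[ℂ] Vec n) (α : Vec n →ₗ[ℂ] ℂ), ∀ x,
      B.symm x = B.symm (σ ((p i).submodule.mkQ x)) + α x • mom n (lam i) := by
  obtain ⟨σ, hσ⟩ := (p i).submodule.mkQ.exists_rightInverse_of_surjective
    (Submodule.range_mkQ _)
  refine ⟨σ, LinearMap.proj 0 ∘ₗ B.symm.toLinearMap ∘ₗ
    (LinearMap.id - σ ∘ₗ (p i).submodule.mkQ), fun x => ?_⟩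
  have h1 : x - σ ((p i).submodule.mkQ x) ∈ (p i).submodule := by
    rw [← Submodule.Quotient.mk_eq_zero, ← Submodule.mkQ_apply, map_sub, sub_eq_zero]
    exact (LinearMap.congr_fun hσ ((p i).submodule.mkQ x)).symm
  obtain ⟨c, hc⟩ := Submodule.mem_span_singleton.1 ((hB i).le h1)
  have h2 : B.symm (x - σ ((p i).submodule.mkQ x)) = c • mom n (lam i) := by
    rw [← hc, map_smul, B.symm_apply_apply]
  have h3 : B.symm (x - σ ((p i).submodule.mkQ x)) 0 = c := by
    rw [h2]; simp [mom]
  change B.symm x = _ + (B.symm (x - σ ((p i).submodule.mkQ x)) 0) • mom n (lam i)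
  rw [h3, ← h2, map_sub]
  abel

/-- The coordinates of the direction at `p i`. -/
def dirCoord (i : Fin r) : Ambient p →ₗ[ℂ] Dir p i where
  toFun z := z.2 i
  map_add' _ _ := rfl
  map_smul' _ _ := rfl

/-- With `t` the equation of `E i`, `y` the lifted direction and `v` the point, the coordinates are
`t y + α v`, and `eval_mul_zpow` expresses the product through regular functions. -/
theorem exists_local_extension
    (hB : ∀ i, (p i).submodule = Submodule.span ℂ {B (mom n (lam i))}) (i : Fin r) {d b : ℕ}
    {P : MvPolynomial ℕ ℂ} (hP : P.IsHomogeneous d) (hs : P ∈ supported ℂ {i | i + 2 ≤ n + 2})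
    (h : ∀ k, b < k → (dop (pt (lam i)) ^ k) P = 0) :
    ∃ K : Ambient p → ℂ, (∀ z ∈ cone p, K ∈ regAt (cone p) z) ∧ ∀ z ∈ cone p, exc z i ≠ 0 →
      K z = eval (extVec n (B.symm z.1)) P * exc z i ^ ((b : ℤ) - d) := by
  obtain ⟨σ, α, hσ⟩ := exists_splitting hB i
  refine ⟨∑ k ∈ Finset.range (b + 1), (algebraMap ℂ (Ambient p → ℂ) (k.factorial : ℂ)⁻¹) *
      (fun z => eval (extVec n (B.symm (σ (z.2 i)))) ((dop (pt (lam i)) ^ k) P)) *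
      (fun z => α z.1) ^ k * (fun z => exc z i) ^ (b - k), fun z hz => ?_, fun z hz hne => ?_⟩
  · have hα : (fun z : Ambient p => α z.1) ∈ polyFun (Ambient p) :=
      Algebra.subset_adjoin ⟨α ∘ₗ LinearMap.fst ℂ _ _, rfl⟩
    refine sum_mem fun k _ => ?_
    have hk : (fun z : Ambient p => eval (extVec n (B.symm (σ (z.2 i))))
        ((dop (pt (lam i)) ^ k) P)) ∈ polyFun (Ambient p) :=
      eval_mem_polyFun (extVec n ∘ₗ B.symm.toLinearMap ∘ₗ σ ∘ₗ dirCoord i) _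
    exact mul_mem (mul_mem (mul_mem (Subalgebra.algebraMap_mem _ _) (mem_regAt_of_polyFun hk))
      (pow_mem (mem_regAt_of_polyFun hα) k)) (pow_mem (exc_mem_regAt hz i) _)
  · have h1 : eval (extVec n (B.symm z.1)) P =
        eval (exc z i • extVec n (B.symm (σ (z.2 i))) + α z.1 • pt (lam i)) P := by
      refine eval_congr_of_supported hs fun j hj => ?_
      rw [hσ z.1, isExcEq_exc hz i, map_smul, map_smul, map_add, map_smul, map_smul]
      have : extVec n (mom n (lam i)) j = pt (lam i) j :=
        extVec_apply (mom n (lam i)) ⟨j, Nat.lt_succ_iff.2 hj⟩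
      simp [this]
    rw [h1, eval_mul_zpow hP h _ hne, Finset.sum_apply]
    rfl

theorem sec_mem_H0 (hn : 2 ≤ n) (hr : 0 < r) (hlam : Function.Injective lam)
    (hB : ∀ i, (p i).submodule = Submodule.span ℂ {B (mom n (lam i))}) {d : ℕ} {e : Fin r → ℤ}
    {P : MvPolynomial ℕ ℂ} (hP : P.IsHomogeneous d) (hs : P ∈ supported ℂ {i | i + 2 ≤ n + 2})
    (h : ∀ i (k : ℕ), d + e i < k → (dop (pt (lam i)) ^ k) P = 0) :
    sec p B P ∈ H0 p ((d : ℤ), e) := by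
  -- A negative bound forces `P = 0`, by the hypothesis for `k = 0`.
  by_cases hneg : ∃ i, d + e i < 0
  · obtain ⟨i, hi⟩ := hneg
    have : P = 0 := by simpa using h i 0 (by simpa using hi)
    rw [this, map_zero]
    exact Submodule.zero_mem _
  push Not at hneg
  have hb : ∀ i, ∃ b : ℕ, e i = b - d := fun i => ⟨(d + e i).toNat, by have := hneg i; omega⟩
  choose b hb using hb
  choose K hreg hK using fun i => exists_local_extension hB i hP hs (b := b i)
    fun k hk => h i k (by rw [hb i]; omega)
  obtain ⟨g, hg, hgf⟩ := exists_glue (p := p)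
    (fun z hz => exists_forall_exc_ne_zero hn hr hlam hB hz) e
    (fun z => eval (extVec n (B.symm z.1)) P) K hreg
    (fun i z hz hne => by rw [hK i z hz hne, hb i])
  refine ⟨fun c x x' hc hx => ?_, g, hg, fun z hz t ht x hx => ?_⟩
  · rw [sec_apply, sec_apply, hx, map_smul, map_smul, eval_smul_of_isHomogeneous hP, zpow_natCast]
  · have ht' := IsExcEq.unique hz ht (isExcEq_exc hz)
    subst ht'
    rw [hgf z hz fun i => exc_ne_zero ht x hx i, sec_apply]
    simp only [hx]

end Extension

/-! ### Sections given by Hankel determinants -/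

section Hankel

variable {n r : ℕ} {p : Fin r → ℙ ℂ (Vec n)} {B : Vec n ≃ₗ[ℂ] Vec n} {lam : Fin r → ℂ}

theorem minimalDivisor_eq (k : ℕ) (I : Finset (Fin r)) :
    minimalDivisor k I = ((k : ℤ), fun i => (if i ∈ I then 0 else 1) - (k : ℤ)) := by
  have h : ∀ J : Finset (Fin r),
      ∑ i ∈ J, E i = ((0 : ℤ), fun i => if i ∈ J then (1 : ℤ) else 0) := by
    intro J
    refine Prod.ext ?_ ?_
    · rw [Prod.fst_sum]; simp [E]
    · rw [Prod.snd_sum]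
      funext i
      simp [E, Finset.sum_apply, Pi.single_apply]
  rw [minimalDivisor, h, h]
  refine Prod.ext ?_ ?_
  · simp [H]
  · funext i
    by_cases hi : i ∈ I <;> simp [H, hi]

/-- The section of a minimal divisor given by a Hankel determinant. -/
def hankelSec (p : Fin r → ℙ ℂ (Vec n)) (B : Vec n ≃ₗ[ℂ] Vec n) (lam : Fin r → ℂ) (k : ℕ)
    (I : Finset (Fin r)) : Off p → ℂ := sec p B (hankel k (rootPoly (I.image lam)))

theorem hankel_image_supported (hlam : Function.Injective lam) {k : ℕ} {I : Finset (Fin r)}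
    (hI : I.card + 2 * k = n + 2) :
    hankel k (rootPoly (I.image lam)) ∈ supported ℂ {i | i + 2 ≤ n + 2} :=
  hankel_mem_supported (by rw [natDegree_rootPoly, Finset.card_image_of_injective _ hlam, hI])

theorem hankelSec_mem_H0 (hn : 2 ≤ n) (hr : 0 < r) (hlam : Function.Injective lam)
    (hB : ∀ i, (p i).submodule = Submodule.span ℂ {B (mom n (lam i))}) {k : ℕ}
    {I : Finset (Fin r)} (hI : I.card + 2 * k = n + 2) :
    hankelSec p B lam k I ∈ H0 p (minimalDivisor k I) := by
  rw [minimalDivisor_eq]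
  refine sec_mem_H0 hn hr hlam hB (isHomogeneous_hankel _ _) (hankel_image_supported hlam hI)
    fun i m hm => ?_
  by_cases hi : i ∈ I
  · obtain ⟨m, rfl⟩ : ∃ m', m = m' + 1 := ⟨m - 1, by rw [if_pos hi] at hm; omega⟩
    rw [pow_succ, Module.End.mul_apply, dop_hankel_eq_zero (Or.inr (eval_rootPoly_eq_zero.2
      (Finset.mem_image_of_mem lam hi))), map_zero]
  · obtain ⟨m, rfl⟩ : ∃ m', m = m' + 2 := ⟨m - 2, by rw [if_neg hi] at hm; omega⟩
    rw [pow_add, pow_two, Module.End.mul_apply, Module.End.mul_apply, dop_dop_hankel, map_zero]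

theorem one_mem_H0_E (hn : 2 ≤ n) (hr : 0 < r) (hlam : Function.Injective lam)
    (hB : ∀ i, (p i).submodule = Submodule.span ℂ {B (mom n (lam i))}) (i : Fin r) :
    (1 : Off p → ℂ) ∈ H0 p (E i) := by
  have := sec_mem_H0 hn hr hlam hB (d := 0) (e := Pi.single i 1) (P := 1)
    (isHomogeneous_one _ _) (one_mem _) fun j m hm => by
      obtain ⟨m, rfl⟩ : ∃ m', m = m' + 1 := ⟨m - 1, by
        have : (0 : ℤ) ≤ (Pi.single i 1 : Fin r → ℤ) j := by
          rw [Pi.single_apply]; split_ifs <;> simp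
        push_cast at hm
        omega⟩
      rw [pow_succ, Module.End.mul_apply, ← C_1, dop_C, map_zero]
  rw [map_one] at this
  exact this

theorem sec_ne_zero (hn : 2 ≤ n) (hr : 0 < r)
    (hB : ∀ i, (p i).submodule = Submodule.span ℂ {B (mom n (lam i))}) {P : MvPolynomial ℕ ℂ}
    (hs : P ∈ supported ℂ {i | i + 2 ≤ n + 2}) (hP : P ≠ 0) : sec p B P ≠ 0 := by
  intro h
  obtain ⟨G, rfl⟩ := exists_rename_eq hs
  refine hP ?_
  suffices hG : G = 0 by rw [hG, map_zero]
  refine eq_of_eval_eq_avoiding (fun i => span_mom_ne_top hn (lam i)) fun z hz => ?_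
  have := congrFun h (offMk hr (B z) fun i => by rw [mem_point_iff hB]; exact hz i)
  rw [sec_apply, eval_extVec_rename] at this
  simpa [offMk] using this

/-- Apply `mem_span_cfgProd` with all parameters as `Λ` and `b (lam i) = d + e i`; the assumption `n
+ 2 ≤ r` leaves room to move every root into `Λ`. -/
theorem mem_span_prod_hankelSec (hn : 2 ≤ n) (hr : n + 2 ≤ r) (hlam : Function.Injective lam)
    (hB : ∀ i, (p i).submodule = Submodule.span ℂ {B (mom n (lam i))}) {D : Div r}
    {F : Off p → ℂ} (hF : F ∈ H0 p D) :
    F ∈ Submodule.span ℂ {S | ∃ (N : ℕ) (k : Fin N → ℕ) (I : Fin N → Finset (Fin r)),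
      (∀ j, (I j).card + 2 * k j = n + 2) ∧ ((∑ j, k j : ℕ) : ℤ) = D.1 ∧
      (∀ i, ((Finset.univ.filter fun j => i ∉ I j).card : ℤ) ≤ D.1 + D.2 i) ∧
      S = ∏ j, hankelSec p B lam (k j) (I j)} := by
  classical
  have hr0 : 0 < r := by omega
  obtain ⟨G, rfl⟩ := exists_sec_eq_of_mem_H0 hn hr0 B hF
  by_cases hG0 : G = 0
  · rw [hG0, map_zero, map_zero]
    exact Submodule.zero_mem _
  obtain ⟨d, hd⟩ : ∃ d : ℕ, D.1 = d := by
    obtain ⟨s, hs⟩ := exists_coeff_ne_zero hG0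
    exact ⟨_, (isHomogeneous_of_mem_H0 hn hr0 hB hF hs).symm⟩
  obtain ⟨D1, e⟩ := D
  obtain rfl : D1 = d := hd
  have hG : G.IsHomogeneous d := fun s hs => by
    have := isHomogeneous_of_mem_H0 hn hr0 hB hF hs
    exact (DFunLike.congr_fun Finsupp.degree_eq_weight_one s).symm.trans (Nat.cast_injective this)
  have hdop := fun i k hk => dop_pow_eq_zero_of_mem_H0 hn hr0 hlam hB hG hF i (k := k) hk
  have hpos : ∀ i, 0 ≤ d + e i := by
    intro i
    by_contra! hneg
    have h1 := hdop i 0 (by simpa using hneg)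
    rw [pow_zero, Module.End.one_apply] at h1
    exact hG0 (rename_injective _ Fin.val_injective (by rw [h1, map_zero]))
  let b : ℂ → ℕ := Function.extend lam (fun i => (d + e i).toNat) 0
  have hb : ∀ i, b (lam i) = (d + e i).toNat := fun i => hlam.extend_apply _ _ i
  have hspan := mem_span_cfgProd (Λ := Finset.univ.image lam) (b := b) (q := n + 2)
    hG.rename_isHomogeneous (rename_val_supported G) (fun l hl => by
      obtain ⟨i, -, rfl⟩ := Finset.mem_image.1 hl
      refine hdop i _ ?_
      have := hpos i
      rw [hb]
      omega) (by rw [Finset.card_image_of_injective _ hlam]; simpa using hr)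
  have hmap := Submodule.mem_map_of_mem (f := (sec p B).toLinearMap) hspan
  rw [Submodule.map_span] at hmap
  refine Submodule.span_mono ?_ hmap
  rintro _ ⟨_, ⟨N, k, I, hI, hsub, rfl⟩, rfl⟩
  have himg : ∀ j, (Finset.univ.filter fun i => lam i ∈ I j).image lam = I j := by
    intro j
    ext c
    simp only [Finset.mem_image, Finset.mem_filter, Finset.mem_univ, true_and]
    constructor
    · rintro ⟨i, hi, rfl⟩
      exact hi
    · intro hc
      obtain ⟨i, -, rfl⟩ := Finset.mem_image.1 (hsub j hc)
      exact ⟨i, hc, rfl⟩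
  refine ⟨N, k, fun j => Finset.univ.filter fun i => lam i ∈ I j, fun j => ?_, ?_, fun i => ?_, ?_⟩
  · rw [← Finset.card_image_of_injective _ hlam, himg]
    exact hI.card j
  · exact congrArg Nat.cast hI.sum
  · have h1 := hI.mult (lam i) (Finset.mem_image_of_mem lam (Finset.mem_univ i))
    have h2 := card_filter_notMem I (lam i)
    have h3 := hpos i
    rw [hb] at h1
    simp only [Finset.mem_filter, Finset.mem_univ, true_and]
    omega
  · simp only [hankelSec, himg]
    change sec p B (cfgProd k I) = _
    rw [cfgProd, map_prod]

theorem H0_E_le_span (hn : 2 ≤ n) (hr : n + 2 ≤ r) (hlam : Function.Injective lam)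
    (hB : ∀ i, (p i).submodule = Submodule.span ℂ {B (mom n (lam i))}) (i : Fin r) :
    H0 p (E i) ≤ Submodule.span ℂ {1} := by
  intro F hF
  refine Submodule.span_mono ?_ (mem_span_prod_hankelSec hn hr hlam hB hF)
  rintro _ ⟨N, k, I, -, hsum, -, rfl⟩
  have h0 : ∑ j, k j = 0 := Nat.cast_injective (R := ℤ) hsum
  refine Finset.prod_eq_one fun j _ => ?_
  rw [hankelSec, Finset.sum_eq_zero_iff.1 h0 j (Finset.mem_univ j), hankel_zero, map_one]

theorem sum_card_notMem {N : ℕ} (I : Fin N → Finset (Fin r)) :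
    ∑ i, (Finset.univ.filter fun j => i ∉ I j).card + ∑ j, (I j).card = N * r := by
  classical
  have h1 : ∑ i, (Finset.univ.filter fun j => i ∉ I j).card = ∑ j, (I j)ᶜ.card := by
    simp only [Finset.card_filter]
    rw [Finset.sum_comm]
    refine Finset.sum_congr rfl fun j _ => ?_
    rw [← Finset.card_filter]
    congr 1
    ext i
    simp
  rw [h1, ← Finset.sum_add_distrib, Finset.sum_congr rfl fun j _ => Finset.card_compl_add_card (I j)]
  simp

/-- Count pairs of a factor and a point that is not among its roots: there are `N r - N (n + 2) +
2k` of them, and at most `r - (n + 2 - 2k)` are allowed. Hence `(N - 1)(r - n - 2) ≤ 0`, so `N = 1`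
by `n + 3 ≤ r`, and the multiplicities then determine the roots. -/
theorem H0_minimalDivisor_le_span (hn : 2 ≤ n) (hr : n + 3 ≤ r) (hlam : Function.Injective lam)
    (hB : ∀ i, (p i).submodule = Submodule.span ℂ {B (mom n (lam i))}) {k : ℕ} (hk : 1 ≤ k)
    {I : Finset (Fin r)} (hI : I.card + 2 * k = n + 2) :
    H0 p (minimalDivisor k I) ≤ Submodule.span ℂ {hankelSec p B lam k I} := by
  intro F hF
  refine Submodule.span_mono ?_ (mem_span_prod_hankelSec hn (by omega) hlam hB hF)
  rintro _ ⟨N, l, J, hcard, hsum, hmult, rfl⟩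
  rw [minimalDivisor_eq] at hsum hmult
  have hsum' : ∑ j, l j = k := Nat.cast_injective (R := ℤ) hsum
  simp only [add_sub_cancel] at hmult
  have hle : ∑ i, (Finset.univ.filter fun j => i ∉ J j).card ≤ Iᶜ.card := by
    have : ∀ i, (Finset.univ.filter fun j => i ∉ J j).card ≤ if i ∈ I then 0 else 1 := fun i => by
      exact_mod_cast hmult i
    refine (Finset.sum_le_sum fun i _ => this i).trans (le_of_eq ?_)
    rw [show Iᶜ = Finset.univ.filter (· ∉ I) by ext; simp, Finset.card_filter]
    exact Finset.sum_congr rfl fun i _ => by split_ifs <;> simp_all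
  have htot := sum_card_notMem J
  have hJ : ∑ j, (J j).card + 2 * k = N * (n + 2) := by
    rw [← hsum', Finset.mul_sum, ← Finset.sum_add_distrib, Finset.sum_congr rfl fun j _ => hcard j]
    simp
  have hIc := Finset.card_compl_add_card I
  rw [Fintype.card_fin] at hIc
  have hN : N = 1 := by
    have h0 : N ≠ 0 := by
      rintro rfl
      simp at hsum'
      omega
    obtain ⟨c, rfl⟩ : ∃ c, r = n + 3 + c := ⟨r - (n + 3), by omega⟩
    obtain ⟨N, rfl⟩ : ∃ N', N = N' + 1 := ⟨N - 1, by omega⟩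
    have h1 : (N + 1) * (n + 3 + c) = (N + 1) * (n + 2) + N * (c + 1) + (c + 1) := by ring
    have h2 : N * (c + 1) = 0 := by omega
    simpa using h2
  subst hN
  have hl : l 0 = k := by simpa using hsum'
  have hIJ : I = J 0 := by
    refine Finset.eq_of_subset_of_card_le (fun i hi => ?_) ?_
    · have := hmult i
      rw [if_pos hi] at this
      by_contra hnot
      have h1 : (0 : Fin 1) ∈ Finset.univ.filter fun j => i ∉ J j := by simpa using hnot
      have h2 := Finset.card_pos.2 ⟨_, h1⟩
      omega
    · have := hcard 0
      rw [hl] at this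
      omega
  rw [Set.mem_singleton_iff, Fin.prod_univ_one, hl, hIJ]

theorem finrank_H0 (hn : 2 ≤ n) (hr : n + 3 ≤ r) (hlam : Function.Injective lam)
    (hB : ∀ i, (p i).submodule = Submodule.span ℂ {B (mom n (lam i))}) {D : Div r}
    (hD : D ∈ generatorDivisors n r) : Module.finrank ℂ (H0 p D) = 1 := by
  suffices h : ∃ s ∈ H0 p D, s ≠ 0 ∧ H0 p D ≤ Submodule.span ℂ {s} by
    obtain ⟨s, hs, hs0, hle⟩ := h
    rw [le_antisymm hle ((Submodule.span_singleton_le_iff_mem _ _).2 hs)]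
    exact finrank_span_singleton hs0
  have hr0 : 0 < r := by omega
  obtain ⟨i, rfl⟩ | ⟨k, I, hk, hkn, hI, rfl⟩ := hD
  · refine ⟨1, one_mem_H0_E hn hr0 hlam hB i, ?_, H0_E_le_span hn (by omega) hlam hB i⟩
    have := sec_ne_zero hn hr0 hB (one_mem _) one_ne_zero
    rwa [map_one] at this
  · have hI' : I.card + 2 * k = n + 2 := by omega
    exact ⟨_, hankelSec_mem_H0 hn hr0 hlam hB hI',
      sec_ne_zero hn hr0 hB (hankel_image_supported hlam hI') (hankel_ne_zero _ (rootPoly_ne_zero _)),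
      H0_minimalDivisor_le_span hn hr hlam hB hk hI'⟩

end Hankel

/-! ### Generation of the Cox ring -/

section Generation

variable {n r : ℕ} {p : Fin r → ℙ ℂ (Vec n)}

/-- The sections of `D` whose classes in the Cox ring lie in a subalgebra. -/
def goodSec (A : Subalgebra ℂ (Cox p)) (D : Div r) : Submodule ℂ (Off p → ℂ) :=
  ((Subalgebra.toSubmodule A).comap (DirectSum.lof ℂ (Div r) (fun D => H0 p D) D)).map
    (H0 p D).subtype

variable {A : Subalgebra ℂ (Cox p)}

theorem mem_goodSec {D : Div r} {F : Off p → ℂ} : F ∈ goodSec A D ↔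
    ∃ h : F ∈ H0 p D, DirectSum.of (fun D => H0 p D) D ⟨F, h⟩ ∈ A := by
  rw [goodSec, Submodule.mem_map]
  constructor
  · rintro ⟨⟨F, h⟩, hA, rfl⟩
    exact ⟨h, hA⟩
  · rintro ⟨h, hA⟩
    exact ⟨⟨F, h⟩, hA, rfl⟩

theorem one_mem_goodSec : (1 : Off p → ℂ) ∈ goodSec A 0 :=
  mem_goodSec.2 ⟨SetLike.GradedOne.one_mem, A.one_mem⟩

theorem mul_mem_goodSec {D D' : Div r} {F F' : Off p → ℂ} (h : F ∈ goodSec A D)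
    (h' : F' ∈ goodSec A D') : F * F' ∈ goodSec A (D + D') := by
  obtain ⟨hF, hA⟩ := mem_goodSec.1 h
  obtain ⟨hF', hA'⟩ := mem_goodSec.1 h'
  have := A.mul_mem hA hA'
  rw [DirectSum.of_mul_of] at this
  exact mem_goodSec.2 ⟨SetLike.GradedMul.mul_mem hF hF', this⟩

theorem prod_mem_goodSec {ι : Type*} (s : Finset ι) {D : ι → Div r} {F : ι → Off p → ℂ}
    (h : ∀ i ∈ s, F i ∈ goodSec A (D i)) : ∏ i ∈ s, F i ∈ goodSec A (∑ i ∈ s, D i) := by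
  classical
  induction s using Finset.induction_on with
  | empty => simpa using one_mem_goodSec
  | insert i s hi ih =>
    rw [Finset.prod_insert hi, Finset.sum_insert hi]
    exact mul_mem_goodSec (h i (Finset.mem_insert_self i s))
      (ih fun j hj => h j (Finset.mem_insert_of_mem hj))

theorem one_mem_goodSec_nsmul {D : Div r} (h : (1 : Off p → ℂ) ∈ goodSec A D) (m : ℕ) :
    (1 : Off p → ℂ) ∈ goodSec A (m • D) := by
  have := prod_mem_goodSec (Finset.range m) (D := fun _ => D) (F := fun _ => 1) fun _ _ => h
  simpa using this

theorem finite_generatorDivisors (n r : ℕ) : (generatorDivisors n r).Finite := by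
  refine ((Set.finite_range (E : Fin r → Div r)).union
    ((Set.finite_Iic (n + 2)).image2 (fun k I => minimalDivisor k I)
      (Set.finite_univ : (Set.univ : Set (Finset (Fin r))).Finite))).subset ?_
  rintro D (⟨i, rfl⟩ | ⟨k, I, -, hk, -, rfl⟩)
  · exact Or.inl ⟨i, rfl⟩
  · exact Or.inr ⟨k, by simp only [Set.mem_Iic]; omega, I, trivial, rfl⟩

variable {B : Vec n ≃ₗ[ℂ] Vec n} {lam : Fin r → ℂ}

/-- A product of Hankel sections belongs to a sum of minimal divisors that differs from `D` by the
combination of the `E i` with the slacks of the multiplicity inequalities as coefficients;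
multiplication by the sections `1` of the `E i` fills this gap. -/
theorem H0_le_goodSec (hn : 2 ≤ n) (hr : n + 3 ≤ r) (hlam : Function.Injective lam)
    (hB : ∀ i, (p i).submodule = Submodule.span ℂ {B (mom n (lam i))})
    (hgen : ∀ D ∈ generatorDivisors n r, H0 p D ≤ goodSec A D) (D : Div r) :
    H0 p D ≤ goodSec A D := by
  classical
  have hr0 : 0 < r := by omega
  have hE : ∀ i, (1 : Off p → ℂ) ∈ goodSec A (E i) := fun i =>
    hgen _ (Or.inl ⟨i, rfl⟩) (one_mem_H0_E hn hr0 hlam hB i)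
  have hH : ∀ (k : ℕ) (I : Finset (Fin r)), I.card + 2 * k = n + 2 →
      hankelSec p B lam k I ∈ goodSec A (minimalDivisor k I) := by
    intro k I hI
    -- Factors of size `0` are not among the generators: such a factor is `1`, viewed as a section
    -- of the sum of the `E i` with `i ∉ I`.
    rcases Nat.eq_zero_or_pos k with rfl | hk
    · have := prod_mem_goodSec Iᶜ (F := fun _ => 1) fun i _ => hE i
      rw [hankelSec, hankel_zero, map_one]
      simpa [minimalDivisor] using this
    · exact hgen _ (Or.inr ⟨k, I, hk, by omega, by omega, rfl⟩) (hankelSec_mem_H0 hn hr0 hlam hB hI)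
  intro F hF
  refine (Submodule.span_le.2 ?_) (mem_span_prod_hankelSec hn (by omega) hlam hB hF)
  rintro _ ⟨N, k, I, hcard, hsum, hmult, rfl⟩
  choose m hm using fun i => Int.le.dest (hmult i)
  have h1 := prod_mem_goodSec Finset.univ fun j _ => hH (k j) (I j) (hcard j)
  have h2 := prod_mem_goodSec Finset.univ (F := fun _ => 1)
    fun i _ => one_mem_goodSec_nsmul (hE i) (m i)
  have h3 := mul_mem_goodSec h1 h2
  rw [Finset.prod_const_one, mul_one] at h3
  suffices hD : D = ∑ j, minimalDivisor (k j) (I j) + ∑ i, m i • E i by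
    rw [hD]
    exact h3
  refine Prod.ext ?_ ?_
  · rw [Prod.fst_add, Prod.fst_sum, Prod.fst_sum, ← hsum]
    simp [minimalDivisor_eq, E]
  · funext i
    rw [Prod.snd_add, Prod.snd_sum, Prod.snd_sum, Pi.add_apply, Finset.sum_apply, Finset.sum_apply]
    simp only [minimalDivisor_eq, E, Prod.smul_snd, Pi.smul_apply, Pi.single_apply]
    have h4 : ∑ j, ((if i ∈ I j then (0 : ℤ) else 1) - (k j : ℤ)) =
        (Finset.univ.filter fun j => i ∉ I j).card - D.1 := by
      rw [Finset.sum_sub_distrib, ← hsum, Finset.card_filter]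
      push_cast
      congr 1
      exact Finset.sum_congr rfl fun j _ => by split_ifs <;> simp_all
    rw [h4]
    simp
    have := hm i
    omega

theorem adjoin_eq_top (hn : 2 ≤ n) (hr : n + 3 ≤ r) (hlam : Function.Injective lam)
    (hB : ∀ i, (p i).submodule = Submodule.span ℂ {B (mom n (lam i))}) (x : ∀ D : Div r, H0 p D)
    (hx : ∀ D ∈ generatorDivisors n r, x D ≠ 0) :
    Algebra.adjoin ℂ {s : Cox p | ∃ D ∈ generatorDivisors n r,
      s = DirectSum.of (fun D => H0 p D) D (x D)} = ⊤ := by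
  set A := Algebra.adjoin ℂ {s : Cox p | ∃ D ∈ generatorDivisors n r,
      s = DirectSum.of (fun D => H0 p D) D (x D)} with hA
  have hgood := H0_le_goodSec (A := A) hn hr hlam hB fun D hD F hF => by
    obtain ⟨c, hc⟩ := exists_smul_eq_of_finrank_eq_one (finrank_H0 hn hr hlam hB hD) (hx D hD)
      ⟨F, hF⟩
    refine mem_goodSec.2 ⟨hF, ?_⟩
    rw [← hc, DirectSum.of_smul]
    exact A.smul_mem (Algebra.subset_adjoin ⟨D, hD, rfl⟩) c
  refine eq_top_iff.2 fun s _ => ?_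
  induction s using DirectSum.induction_on with
  | zero => exact A.zero_mem
  | of D F =>
    exact (mem_goodSec.1 (hgood D F.2)).2
  | add s t hs ht => exact A.add_mem (hs trivial) (ht trivial)

end Generation

end BlowUpCox

end

/-! ### One-dimensionality, generation and finiteness combined -/

theorem theorem1p2 (n r : ℕ) (hn : 2 ≤ n) (hr : n + 3 ≤ r)
    (C : Set (ℙ ℂ (BlowUpCox.Vec n))) (hC : BlowUpCox.IsRationalNormalCurve C)
    (p : Fin r → ℙ ℂ (BlowUpCox.Vec n)) (hp : Function.Injective p) (hpC : ∀ i, p i ∈ C) :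
    (∀ D ∈ BlowUpCox.generatorDivisors n r, Module.finrank ℂ (BlowUpCox.H0 p D) = 1) ∧
    (∀ x : ∀ D : BlowUpCox.Div r, BlowUpCox.H0 p D,
      (∀ D ∈ BlowUpCox.generatorDivisors n r, x D ≠ 0) →
      Algebra.adjoin ℂ {s : BlowUpCox.Cox p | ∃ D ∈ BlowUpCox.generatorDivisors n r,
        s = DirectSum.of (fun D => BlowUpCox.H0 p D) D (x D)} = ⊤) ∧
    Algebra.FiniteType ℂ (BlowUpCox.Cox p) := by
  classical
  obtain ⟨B, lam, hlam, hB⟩ := BlowUpCox.exists_normal_form hC hp hpC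
  have h1 : ∀ D ∈ BlowUpCox.generatorDivisors n r, Module.finrank ℂ (BlowUpCox.H0 p D) = 1 :=
    fun D hD => BlowUpCox.finrank_H0 hn hr hlam hB hD
  have h2 := BlowUpCox.adjoin_eq_top (p := p) hn hr hlam hB
  refine ⟨h1, h2, ⟨?_⟩⟩
  -- Nonzero sections are needed only for the finitely many generator divisors; elsewhere the value
  -- `0` is harmless.
  have hx : ∀ D : BlowUpCox.Div r, ∃ x : BlowUpCox.H0 p D,
      D ∈ BlowUpCox.generatorDivisors n r → x ≠ 0 := by
    intro D
    by_cases hD : D ∈ BlowUpCox.generatorDivisors n r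
    · have : Nontrivial (BlowUpCox.H0 p D) :=
        Module.nontrivial_of_finrank_pos (R := ℂ) (by rw [h1 D hD]; exact one_pos)
      obtain ⟨x, hx⟩ := exists_ne (0 : BlowUpCox.H0 p D)
      exact ⟨x, fun _ => hx⟩
    · exact ⟨0, fun h => absurd h hD⟩
  choose x hx using hx
  rw [Subalgebra.fg_def]
  refine ⟨_, ?_, h2 x hx⟩
  refine ((BlowUpCox.finite_generatorDivisors n r).image
    fun D => DirectSum.of (fun D => BlowUpCox.H0 p D) D (x D)).subset ?_
  rintro s ⟨D, hD, rfl⟩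
  exact ⟨D, hD, rfl⟩
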